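/- **Setting.** A vertically rigid (VR) sub-Riemannian space is a smooth manifold $M$ with a smooth distribution $V_0\subset TM$ of rank $k+1$ carrying a smooth inner product, together with a smooth complement $V$ of $V_0$, a global smooth frame $T_1,\dots,T_m$ of $V$, a Riemannian metric $g$ that extends the inner product of $V_0$, makes $V\perp V_0$ and makes $T_1,\dots,T_m$ orthonormal, and an equivalence relation $\sim$ on $\{1,\dots,m\}$ such that $g([X,T_j],T_i)=0$ for all sections $X$ of $V_0$ whenever $i\sim j$. Here $\dim M=k+m+1$ and we assume $k\ge 1$. A connection $\nabla$ on $TM$ is *adapted* if $\nabla g=0$, $\nabla T_j=0$ for all $j$, and $\mathrm{Tor}(X,Y)\in V$ for all horizontal $X,Y$. Let $\Sigma\subset M$ be a non-empty embedded $C^2$ hypersurface. It is *noncharacteristic* if $V_0(x)\not\subset T_x\Sigma$ for every $x\in\Sigma$. Its horizontal perimeter is $P(\Sigma)=\int_\Sigma|(\nu_g)_0|\,d\sigma_g$, where $\nu_g$ is the Riemannian unit normal, $(\cdot)_0$ the orthogonal projection onto $V_0$, and $\sigma_g$ the Riemannian hypersurface measure. $\Sigma$ is *minimal* if it is a critical point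 of $P$ under all compactly supported $C^2$ variations of its local patches. Let $\nu=e_0$ be the unit horizontal normal (unique up to sign, defined locally), i.e. the unit vector of $V_0$ orthogonal to $T_x\Sigma\cap V_0$, and $e_1,\dots,e_k$ an orthonormal basis of $T_x\Sigma\cap V_0$. The horizontal second fundamental form at $x$ is the (not necessarily symmetric) matrix $II_0=(\langle\nabla_{e_i}\nu,e_j\rangle)_{1\le i,j\le k}$ of an adapted connection, and $H=\mathrm{trace}\,II_0$. $\Sigma$ is *horizontally positively curved* at $x$ if the quadratic form $v\mapsto\langle II_0v,v\rangle$ is positive definite or negative definite. The *horizontal exponential surface* $\Sigma_0(x)$ is the union of all horizontal $C^1$ curves in $\Sigma$ through $x$. The *horizontal tangent plane* is $T^h_x\Sigma=\{\exp_x(w): w\in T_xM,\ g(w,\nu(x))=0\}$, with $\exp$ the Riemannian exponential map of $g$. When $M$ is a Carnot group, $\Sigma$ is *locally horizontally geometrically convex at $x$* if, in some neighbourhood of $x$, $\Sigma_0(x)\setminus\{x\}$ lies strictly to one side of $T^h_x\Sigma$, the two local sides being $\{\exp_x(w): w \text{ small},\ g(w,\nu(x))>0\}$ and $\{\exp_x(w):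 w\text{ small},\ g(w,\nu(x))<0\}$. It is *locally horizontally geometrically convex* if it is so at each of its noncharacteristic points. **Theorem.** Let $\Sigma$ be a non-empty $C^2$ noncharacteristic minimal hypersurface in a VR space $M$ with $k\ge1$. Then, for every adapted connection, $H=0$ at every point of $\Sigma$, and $\Sigma$ has no point at which it is horizontally positively curved. If, moreover, $M$ is a Carnot group (a simply connected Lie group whose Lie algebra is graded, $\mathfrak m=\bigoplus_{j\ge 0}\mathfrak v_j$ with $\mathfrak v_{j+1}=[\mathfrak v_0,\mathfrak v_j]$, with a left-invariant metric $g$, $V_0$ spanned by $\mathfrak v_0$, and $T_1,\dots,T_m$ left-invariant, each in some layer $\mathfrak v_j$, $j>0$, with $i\sim i'$ if and only if $T_i$ and $T_{i'}$ lie in the same layer), then $\Sigma$ is not locally horizontally geometrically convex. -/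

import Mathlib

open Set Filter Topology Manifold ContDiff Bundle MeasureTheory

noncomputable section

/-- A vertically rigid (VR) structure on a smooth manifold `M` of dimension `k + m + 1`, with a
horizontal distribution `V₀` of rank `k + 1` and a global frame `T₁, …, T_m` of the vertical
complement `V`. Since `V = span (T₁, …, T_m)`, and `V₀` is the `g`-orthogonal complement of `V` on
which the sub-Riemannian inner product is the restriction of `g`, the data are: the Riemannian
metric `g`, the `g`-orthonormal smooth vertical fields, and the equivalence relation `∼` on their
indices. `V₀` and `V` are then `VRStructure.horizontal` and `VRStructure.vertical` below. -/
structure VRStructure (k m : ℕ) (M : Type*) [TopologicalSpace M]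
    [ChartedSpace (EuclideanSpace ℝ (Fin (k + m + 1))) M] [IsManifold (𝓡 (k + m + 1)) ∞ M] where
  /-- the Riemannian metric `g` -/
  metric : ContMDiffRiemannianMetric (𝓡 (k + m + 1)) ∞ (EuclideanSpace ℝ (Fin (k + m + 1)))
    (fun x : M ↦ TangentSpace (𝓡 (k + m + 1)) x)
  /-- the vertical frame `T₁, …, T_m` -/
  T : Fin m → (p : M) → TangentSpace (𝓡 (k + m + 1)) p
  contMDiff_T : ∀ j, ContMDiff (𝓡 (k + m + 1)) (𝓡 (k + m + 1)).tangent ∞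
    (fun p ↦ (⟨p, T j p⟩ : TangentBundle (𝓡 (k + m + 1)) M))
  orthonormal_T : ∀ p i j, metric.inner p (T i p) (T j p) = if i = j then 1 else 0
  /-- the partition of the vertical indices -/
  rel : Setoid (Fin m)
  /-- `g([X, T_j], T_i) = 0` for every section `X` of `V₀` whenever `j ∼ i` -/
  bracket_rigid : ∀ X : (p : M) → TangentSpace (𝓡 (k + m + 1)) p,
    ContMDiff (𝓡 (k + m + 1)) (𝓡 (k + m + 1)).tangent ∞
      (fun p ↦ (⟨p, X p⟩ : TangentBundle (𝓡 (k + m + 1)) M)) →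
    (∀ p j, metric.inner p (X p) (T j p) = 0) →
    ∀ i j, rel j i → ∀ p,
      metric.inner p (VectorField.mlieBracket (𝓡 (k + m + 1)) X (T j) p) (T i p) = 0

/-- The velocity `γ'(t)` of a curve in a manifold. -/
def curveVelocity {d : ℕ} {M : Type*} [TopologicalSpace M]
    [ChartedSpace (EuclideanSpace ℝ (Fin d)) M] (γ : ℝ → M) (t : ℝ) :
    TangentSpace (𝓡 d) (γ t) :=
  mfderiv 𝓘(ℝ, ℝ) (𝓡 d) γ t (1 : ℝ)

/-- The vectors tangent to the subset `S` at `p`: the velocities at `p` of `C¹` curves in `S`. For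
an embedded submanifold and `p ∈ S` this is the usual tangent space `T_p S`. -/
def tangentVectors {d : ℕ} {M : Type*} [TopologicalSpace M]
    [ChartedSpace (EuclideanSpace ℝ (Fin d)) M] (S : Set M) (p : M) :
    Set (TangentSpace (𝓡 d) p) :=
  {v | ∃ γ : ℝ → M, ContMDiffAt 𝓘(ℝ, ℝ) (𝓡 d) 1 γ 0 ∧ (∀ᶠ t in 𝓝 (0 : ℝ), γ t ∈ S) ∧
    (⟨γ 0, curveVelocity γ 0⟩ : TangentBundle (𝓡 d) M) = ⟨p, v⟩}

/-- `S` is an embedded `C²` hypersurface (without boundary): near each of its points it is the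
zero set of a `C²` function with non-vanishing differential. -/
def IsC2Hypersurface (d : ℕ) {M : Type*} [TopologicalSpace M]
    [ChartedSpace (EuclideanSpace ℝ (Fin d)) M] (S : Set M) : Prop :=
  ∀ p ∈ S, ∃ (U : Set M) (f : M → ℝ), IsOpen U ∧ p ∈ U ∧
    ContMDiffOn (𝓡 d) 𝓘(ℝ, ℝ) 2 f U ∧
    (∀ q ∈ U, mfderiv (𝓡 d) 𝓘(ℝ, ℝ) f q ≠ 0) ∧
    S ∩ U = {q ∈ U | f q = 0}

/-- `φ`, restricted to the open set `W ⊆ ℝⁿ`, is an injective `C²` immersion into `S`; for a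
hypersurface `S` of an `(n+1)`-dimensional manifold, a local parametrization of `S`. -/
structure IsC2Patch {n : ℕ} {M : Type*} [TopologicalSpace M]
    [ChartedSpace (EuclideanSpace ℝ (Fin (n + 1))) M] (S : Set M)
    (W : Set (EuclideanSpace ℝ (Fin n))) (φ : EuclideanSpace ℝ (Fin n) → M) : Prop where
  isOpen : IsOpen W
  contMDiffOn : ContMDiffOn (𝓡 n) (𝓡 (n + 1)) 2 φ W
  injOn : InjOn φ W
  immersion : ∀ y ∈ W, Function.Injective (mfderiv (𝓡 n) (𝓡 (n + 1)) φ y)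
  mapsTo : MapsTo φ W S

/-- A `C²` variation `Φ` of the patch `φ : W → M`, defined for `|t| < δ`, that is fixed outside
the compact set `K ⊆ W`. -/
structure IsC2Variation {n : ℕ} {M : Type*} [TopologicalSpace M]
    [ChartedSpace (EuclideanSpace ℝ (Fin (n + 1))) M]
    (W : Set (EuclideanSpace ℝ (Fin n))) (φ : EuclideanSpace ℝ (Fin n) → M)
    (K : Set (EuclideanSpace ℝ (Fin n))) (δ : ℝ)
    (Φ : ℝ → EuclideanSpace ℝ (Fin n) → M) : Prop where
  delta_pos : 0 < δ
  isCompact : IsCompact K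
  subset : K ⊆ W
  contMDiffOn : ContMDiffOn 𝓘(ℝ, ℝ × EuclideanSpace ℝ (Fin n)) (𝓡 (n + 1)) 2
    (fun z : ℝ × EuclideanSpace ℝ (Fin n) ↦ Φ z.1 z.2) (Ioo (-δ) δ ×ˢ W)
  initial : ∀ y ∈ W, Φ 0 y = φ y
  fixed : ∀ t ∈ Ioo (-δ) δ, ∀ y ∈ W \ K, Φ t y = φ y

namespace VRStructure

variable {k m : ℕ} {M : Type*} [TopologicalSpace M]
  [ChartedSpace (EuclideanSpace ℝ (Fin (k + m + 1))) M] [IsManifold (𝓡 (k + m + 1)) ∞ M]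
  (V : VRStructure k m M)

/-- The horizontal space `V₀` at `p`. -/
def horizontal (p : M) : Submodule ℝ (TangentSpace (𝓡 (k + m + 1)) p) where
  carrier := {v | ∀ j, V.metric.inner p v (V.T j p) = 0}
  zero_mem' := fun j ↦ by simp
  add_mem' := fun {v w} hv hw j ↦ by simp [hv j, hw j]
  smul_mem' := fun c v hv j ↦ by simp [hv j]

/-- The vertical space `V` at `p`. -/
def vertical (p : M) : Submodule ℝ (TangentSpace (𝓡 (k + m + 1)) p) :=
  Submodule.span ℝ (range fun j ↦ V.T j p)

/-- The orthogonal projection `v ↦ v₀` onto the horizontal space. -/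
def horizontalPart (p : M) (v : TangentSpace (𝓡 (k + m + 1)) p) :
    TangentSpace (𝓡 (k + m + 1)) p :=
  v - ∑ j, V.metric.inner p v (V.T j p) • V.T j p

/-- A connection `∇` on `TM` (with `∇_X Y` at `p` written `D Y p (X p)`) is compatible with the
metric: `u g(X, Y) = g(∇_u X, Y) + g(X, ∇_u Y)`. -/
def IsMetricConnection
    (D : CovariantDerivative (𝓡 (k + m + 1)) (EuclideanSpace ℝ (Fin (k + m + 1)))
      (fun x : M ↦ TangentSpace (𝓡 (k + m + 1)) x)) : Prop :=
  ∀ (p : M) (X Y : (q : M) → TangentSpace (𝓡 (k + m + 1)) q),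
    MDifferentiableAt (𝓡 (k + m + 1)) (𝓡 (k + m + 1)).tangent
      (fun q ↦ (⟨q, X q⟩ : TangentBundle (𝓡 (k + m + 1)) M)) p →
    MDifferentiableAt (𝓡 (k + m + 1)) (𝓡 (k + m + 1)).tangent
      (fun q ↦ (⟨q, Y q⟩ : TangentBundle (𝓡 (k + m + 1)) M)) p →
    ∀ u : TangentSpace (𝓡 (k + m + 1)) p,
      (mfderiv (𝓡 (k + m + 1)) 𝓘(ℝ, ℝ) (fun q ↦ V.metric.inner q (X q) (Y q)) p u : ℝ) =
        V.metric.inner p (D X p u) (Y p) + V.metric.inner p (X p) (D Y p u)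

/-- `∇` is adapted to the vertically rigid structure: `∇ g = 0`, `∇ T_j = 0` for all `j`, and
the torsion of two horizontal vectors is vertical. -/
structure IsAdapted
    (D : CovariantDerivative (𝓡 (k + m + 1)) (EuclideanSpace ℝ (Fin (k + m + 1)))
      (fun x : M ↦ TangentSpace (𝓡 (k + m + 1)) x)) : Prop where
  metric : V.IsMetricConnection D
  parallel_T : ∀ j p, D (V.T j) p = 0
  torsion : ∀ p, ∀ u ∈ V.horizontal p, ∀ v ∈ V.horizontal p, D.torsion p u v ∈ V.vertical p

/-- `∇` is the Levi-Civita connection of the Riemannian metric `g`. -/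
structure IsLeviCivita
    (D : CovariantDerivative (𝓡 (k + m + 1)) (EuclideanSpace ℝ (Fin (k + m + 1)))
      (fun x : M ↦ TangentSpace (𝓡 (k + m + 1)) x)) : Prop where
  metric : V.IsMetricConnection D
  torsion : ∀ p, D.torsion p = 0

/-! ### Perimeter and minimal hypersurfaces -/

/-- The density at `y` of the horizontal perimeter of the parametrized hypersurface `ψ`: the
Riemannian area density `√det (g(∂ᵢψ, ∂ⱼψ))` times `|(ν_g)₀|`, where `ν_g` is a Riemannian unit
normal. At an immersed point there are exactly two unit normals `± ν_g`, so the supremum is over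
a single value. -/
def perimeterDensity (ψ : EuclideanSpace ℝ (Fin (k + m)) → M)
    (y : EuclideanSpace ℝ (Fin (k + m))) : ℝ :=
  let dψ : Fin (k + m) → TangentSpace (𝓡 (k + m + 1)) (ψ y) := fun i ↦
    mfderiv (𝓡 (k + m)) (𝓡 (k + m + 1)) ψ y (EuclideanSpace.single i (1 : ℝ))
  √(Matrix.of fun i j ↦ V.metric.inner (ψ y) (dψ i) (dψ j)).det *
    sSup {r : ℝ | ∃ ν : TangentSpace (𝓡 (k + m + 1)) (ψ y),
      V.metric.inner (ψ y) ν ν = 1 ∧ (∀ i, V.metric.inner (ψ y) ν (dψ i) = 0) ∧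
      r = √(V.metric.inner (ψ y) (V.horizontalPart (ψ y) ν) (V.horizontalPart (ψ y) ν))}

/-- `S` is minimal: a critical point of the horizontal perimeter under all compactly supported
(fixed boundary) variations of its patches. -/
def IsMinimal (S : Set M) : Prop :=
  ∀ (W : Set (EuclideanSpace ℝ (Fin (k + m)))) (φ : EuclideanSpace ℝ (Fin (k + m)) → M)
    (K : Set (EuclideanSpace ℝ (Fin (k + m)))) (δ : ℝ)
    (Φ : ℝ → EuclideanSpace ℝ (Fin (k + m)) → M),
    IsC2Patch S W φ → IsC2Variation W φ K δ Φ →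
      HasDerivAt (fun t ↦ ∫ y in K, V.perimeterDensity (Φ t) y) 0 0

/-! ### The horizontal second fundamental form -/

/-- `p` is a noncharacteristic point of `S`: the horizontal space is not contained in `T_p S`. -/
def IsNoncharacteristicAt (S : Set M) (p : M) : Prop :=
  ¬ ((V.horizontal p : Set (TangentSpace (𝓡 (k + m + 1)) p)) ⊆ tangentVectors S p)

/-- `ν` is a unit horizontal normal of `S` at `p`: a horizontal unit vector orthogonal to the
horizontal part `T_p S ∩ V₀` of the tangent space. At a noncharacteristic point of a hypersurface
it is unique up to sign, and is the normalized horizontal projection of a Riemannian normal. -/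
structure IsUnitHorizontalNormal (S : Set M) (p : M)
    (ν : TangentSpace (𝓡 (k + m + 1)) p) : Prop where
  mem : ν ∈ V.horizontal p
  unit : V.metric.inner p ν ν = 1
  orthogonal : ∀ w ∈ tangentVectors S p, w ∈ V.horizontal p → V.metric.inner p ν w = 0

/-- `N` is a `C¹` vector field near `p` that extends a unit horizontal normal of `S` near `p`. -/
structure IsHorizontalNormalField (S : Set M) (p : M)
    (N : (q : M) → TangentSpace (𝓡 (k + m + 1)) q) : Prop where
  contMDiffAt : ContMDiffAt (𝓡 (k + m + 1)) (𝓡 (k + m + 1)).tangent 1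
    (fun q ↦ (⟨q, N q⟩ : TangentBundle (𝓡 (k + m + 1)) M)) p
  normal : ∀ᶠ q in 𝓝 p, q ∈ S → V.IsUnitHorizontalNormal S q (N q)

/-- `e₁, …, e_k` is an orthonormal basis of the horizontal part `T_p S ∩ V₀` of the tangent space
(which has dimension `k` at noncharacteristic points of a hypersurface). -/
structure IsHorizontalTangentFrame (S : Set M) (p : M)
    (e : Fin k → TangentSpace (𝓡 (k + m + 1)) p) : Prop where
  mem_tangent : ∀ i, e i ∈ tangentVectors S p
  mem_horizontal : ∀ i, e i ∈ V.horizontal p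
  orthonormal : ∀ i j, V.metric.inner p (e i) (e j) = if i = j then 1 else 0

/-- The horizontal second fundamental form `II₀`, the matrix `⟨∇_{e_i} ν, e_j⟩`. -/
def secondFundamentalForm
    (D : CovariantDerivative (𝓡 (k + m + 1)) (EuclideanSpace ℝ (Fin (k + m + 1)))
      (fun x : M ↦ TangentSpace (𝓡 (k + m + 1)) x))
    (p : M) (N : (q : M) → TangentSpace (𝓡 (k + m + 1)) q)
    (e : Fin k → TangentSpace (𝓡 (k + m + 1)) p) : Matrix (Fin k) (Fin k) ℝ :=
  Matrix.of fun i j ↦ V.metric.inner p (D N p (e i)) (e j)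

/-- The horizontal mean curvature `H`, the trace of `II₀`. -/
def meanCurvature
    (D : CovariantDerivative (𝓡 (k + m + 1)) (EuclideanSpace ℝ (Fin (k + m + 1)))
      (fun x : M ↦ TangentSpace (𝓡 (k + m + 1)) x))
    (p : M) (N : (q : M) → TangentSpace (𝓡 (k + m + 1)) q)
    (e : Fin k → TangentSpace (𝓡 (k + m + 1)) p) : ℝ :=
  (V.secondFundamentalForm D p N e).trace

/-- `S` is horizontally positively curved at `p`: the (in general non-symmetric) matrix `II₀` is
positive definite or negative definite. -/
def IsHorizontallyPositivelyCurvedAt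
    (D : CovariantDerivative (𝓡 (k + m + 1)) (EuclideanSpace ℝ (Fin (k + m + 1)))
      (fun x : M ↦ TangentSpace (𝓡 (k + m + 1)) x))
    (S : Set M) (p : M) : Prop :=
  ∃ (N : (q : M) → TangentSpace (𝓡 (k + m + 1)) q)
    (e : Fin k → TangentSpace (𝓡 (k + m + 1)) p),
    V.IsHorizontalNormalField S p N ∧ V.IsHorizontalTangentFrame S p e ∧
    ((∀ v : Fin k → ℝ, v ≠ 0 → 0 < v ⬝ᵥ (V.secondFundamentalForm D p N e).mulVec v) ∨
     (∀ v : Fin k → ℝ, v ≠ 0 → v ⬝ᵥ (V.secondFundamentalForm D p N e).mulVec v < 0))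

/-! ### Horizontal geometric convexity -/

/-- The horizontal exponential surface `Σ₀(x)`: the union of the horizontal `C¹` curves in `S`
through `x`. -/
def horizontalExpSurface (S : Set M) (x : M) : Set M :=
  {y | ∃ γ : ℝ → M, ContMDiff 𝓘(ℝ, ℝ) (𝓡 (k + m + 1)) 1 γ ∧
    (∀ t, γ t ∈ S ∧ curveVelocity γ t ∈ V.horizontal (γ t)) ∧ γ 0 = x ∧ γ 1 = y}

/-- `γ` is a geodesic of the Riemannian metric `g` on the time set `J`: near every time `t` it is
an integral curve of some `C¹` vector field `X` with `∇_X X = 0` at `γ(t)`, where `∇` is the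
Levi-Civita connection; that is, `∇_{γ'} γ' = 0`. -/
def IsGeodesicOn (γ : ℝ → M) (J : Set ℝ) : Prop :=
  ∃ D : CovariantDerivative (𝓡 (k + m + 1)) (EuclideanSpace ℝ (Fin (k + m + 1)))
      (fun x : M ↦ TangentSpace (𝓡 (k + m + 1)) x),
    V.IsLeviCivita D ∧ ∀ t ∈ J, ∃ X : (q : M) → TangentSpace (𝓡 (k + m + 1)) q,
      ContMDiffAt (𝓡 (k + m + 1)) (𝓡 (k + m + 1)).tangent 1
        (fun q ↦ (⟨q, X q⟩ : TangentBundle (𝓡 (k + m + 1)) M)) (γ t) ∧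
      IsMIntegralCurveAt γ X t ∧ D X (γ t) (X (γ t)) = 0

/-- The image of the set `A` of tangent vectors at `x` under the Riemannian exponential map
`exp_x`. -/
def expImage (x : M) (A : Set (TangentSpace (𝓡 (k + m + 1)) x)) : Set M :=
  {y | ∃ w ∈ A, ∃ γ : ℝ → M, V.IsGeodesicOn γ (Icc 0 1) ∧
    (⟨γ 0, curveVelocity γ 0⟩ : TangentBundle (𝓡 (k + m + 1)) M) = ⟨x, w⟩ ∧ γ 1 = y}

/-- `S` is locally horizontally geometrically convex at `x`: in a neighbourhood of `x`, the
horizontal exponential surface `Σ₀(x)` lies, apart from `x` itself, strictly to one side of the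
horizontal tangent plane `T_x^h S = exp_x {w | g(w, ν) = 0}`. Within a normal neighbourhood
`exp_x B` of `x`, the sides of this plane are the images under `exp_x` of `{w ∈ B | g(w, ν) > 0}`
and `{w ∈ B | g(w, ν) < 0}`; the latter side is covered by exchanging the unit horizontal normals
`ν` and `-ν`. The neighbourhood `B` is arbitrarily small, since far away `exp_x` need not be
injective. -/
def IsLocallyHGConvexAt (S : Set M) (x : M) : Prop :=
  ∃ ν : TangentSpace (𝓡 (k + m + 1)) x, V.IsUnitHorizontalNormal S x ν ∧
    ∀ B ∈ 𝓝 (0 : TangentSpace (𝓡 (k + m + 1)) x), ∃ U ∈ 𝓝 x,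
      (V.horizontalExpSurface S x ∩ U) \ {x} ⊆
        V.expImage x {w ∈ B | 0 < V.metric.inner x w ν}

/-- `S` is locally horizontally geometrically convex: it is so at each noncharacteristic point. -/
def IsLocallyHGConvex (S : Set M) : Prop :=
  ∀ x ∈ S, V.IsNoncharacteristicAt S x → V.IsLocallyHGConvexAt S x

/-! ### Carnot groups -/

/-- The Lie group `M` is a Carnot group and `V` is its vertically rigid structure: the Lie algebra
has a grading `𝔳₀ ⊕ 𝔳₁ ⊕ ⋯` with `𝔳_{j+1} = [𝔳₀, 𝔳_j]`, the metric is left-invariant,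
`V₀` is spanned by `𝔳₀`, and the `T_i` are left-invariant fields taken from the layers
`𝔳_j`, `j > 0`, grouped by layers. -/
structure IsCarnot [Group M] : Prop where
  simplyConnected : SimplyConnectedSpace M
  exists_grading : ∃ 𝔳 : ℕ → Submodule ℝ (GroupLieAlgebra (𝓡 (k + m + 1)) M),
    DirectSum.IsInternal 𝔳 ∧
    (∀ j, 𝔳 (j + 1) = Submodule.span ℝ {z | ∃ x ∈ 𝔳 0, ∃ y ∈ 𝔳 j, z = ⁅x, y⁆}) ∧
    V.horizontal 1 = 𝔳 0 ∧
    ∃ (layer : Fin m → ℕ) (τ : Fin m → GroupLieAlgebra (𝓡 (k + m + 1)) M),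
      (∀ i, 0 < layer i ∧ τ i ∈ 𝔳 (layer i) ∧ V.T i = mulInvariantVectorField (τ i)) ∧
      (∀ i j, V.rel i j ↔ layer i = layer j)
  leftInvariant : ∀ (p : M) (u v : GroupLieAlgebra (𝓡 (k + m + 1)) M),
    V.metric.inner p (mulInvariantVectorField u p) (mulInvariantVectorField v p) =
      V.metric.inner 1 u v

end VRStructure

end

/-!
The proof has three steps.

**Minimal hypersurfaces have `H = 0`.** No differentiation of the perimeter density is needed. Near
a point of `S` the horizontal normal extends to a horizontal unit field `Y` of class `C¹`
(`VRStructure.IsHorizontalNormalField.exists_unit_horizontal`). In a chart in which `S` is a graph,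
the flux of `Y` through a nearby graph is at most its horizontal perimeter, with equality for `S`
(`VRStructure.flux_le_areaAt`, `VRStructure.flux_eq_areaAt`): `Y` is a calibration to first order.
A function that dominates the flux and touches it has the same derivative, so the flux is critical
too; its first variation is the integral of the Riemannian divergence of `Y`, which therefore
vanishes on `S` (`prodDivergence_eq_zero_of_calibration`, `VRStructure.IsMinimal.sum_eq_zero`). For
an adapted connection this divergence is `H`: the torsion terms vanish because the torsion of
horizontal vectors is vertical and by vertical rigidity
(`VRStructure.IsMetricConnection.divergence_eq`, `VRStructure.meanCurvature_eq_sum`).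

**No horizontally positively curved points.** The diagonal entries of a definite matrix are nonzero
of one sign, whereas the trace `H` is zero.

**Carnot groups.** Let `N` be the normalized horizontal gradient of a defining function of `S`, and
`∇` the flat connection of the left-invariant fields, which is adapted. Let `u` be a horizontal
left-invariant field tangent to `S` at `x`. The projection `u - ⟨u, N⟩ N` is horizontal and tangent
to the level sets of the defining function, so its integral curve `c` from `x` belongs to `Σ₀(x)`.
It separates from the integral curve of `u` by `-t²/2 ⟨∇_u N, u⟩ N + o(t²)`
(`IsIntegralArc.eventually_norm_sub_le`). The latter is a geodesic: brackets with a horizontal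
vector are vertical, so `u` is a rest point of the Euler–Arnold equation
(`VRStructure.IsCarnot.isEulerCurve_of_horizontal`). In the chart at `x`, the time-one map of the
Euler–Arnold system is to first order the identity in the initial velocity, also for differences
(`VRStructure.IsCarnot.exists_isEulerCurve_sub_le`). So convexity at `x` forces `⟨∇_u N, u⟩` to have
one sign for all `u` (`le_map_of_eventually_exists`), and `H = 0` makes it vanish, at all points of
`S`. Then `⟨u, N⟩` is constant along `c`, hence zero, so `c` is itself the geodesic with initial
velocity `u(x)`. Since `u(x)` is orthogonal to the normal, `c` is not strictly on one side of the
horizontal tangent plane (`VRStructure.IsCarnot.not_isLocallyHGConvex`).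
-/

noncomputable section

/-! ### First variation of the flux through a graph -/

/-- Differentiation under the integral sign over a compact set, for an integrand that is jointly
continuous together with its derivative in the parameter. -/
theorem hasDerivAt_setIntegral_of_continuousOn {G : Type*} [TopologicalSpace G] [T2Space G]
    [MeasurableSpace G] [OpensMeasurableSpace G]
    {μ : Measure G} [IsFiniteMeasureOnCompacts μ] {K : Set G} (hK : IsCompact K)
    {ε : ℝ} (hε : 0 < ε) {J J' : ℝ → G → ℝ}
    (hJ : ContinuousOn (fun z : ℝ × G ↦ J z.1 z.2) (Icc (-ε) ε ×ˢ K))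
    (hJ' : ContinuousOn (fun z : ℝ × G ↦ J' z.1 z.2) (Icc (-ε) ε ×ˢ K))
    (hd : ∀ t ∈ Ioo (-ε) ε, ∀ y ∈ K, HasDerivAt (fun s ↦ J s y) (J' t y) t) :
    HasDerivAt (fun t ↦ ∫ y in K, J t y ∂μ) (∫ y in K, J' 0 y ∂μ) 0 := by
  have slice : ∀ {F : ℝ → G → ℝ}, ContinuousOn (fun z : ℝ × G ↦ F z.1 z.2) (Icc (-ε) ε ×ˢ K) →
      ∀ t ∈ Icc (-ε) ε, ContinuousOn (F t) K := fun hF t ht ↦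
    hF.comp (f := fun y ↦ (t, y)) (by fun_prop) fun y hy ↦ ⟨ht, hy⟩
  have h0 : (0 : ℝ) ∈ Icc (-ε) ε := ⟨by linarith, hε.le⟩
  obtain ⟨C, hC⟩ := (isCompact_Icc.prod hK).exists_bound_of_continuousOn hJ'
  refine (hasDerivAt_integral_of_dominated_loc_of_deriv_le (bound := fun _ ↦ C)
    (Ioo_mem_nhds (by linarith) hε : Ioo (-ε) ε ∈ 𝓝 (0 : ℝ)) ?_ ?_ ?_ ?_ ?_ ?_).2
  · filter_upwards [Icc_mem_nhds (by linarith : -ε < 0) hε] with t ht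
    exact (slice hJ t ht).aestronglyMeasurable_of_isCompact hK hK.measurableSet
  · exact (slice hJ 0 h0).integrableOn_compact hK
  · exact (slice hJ' 0 h0).aestronglyMeasurable_of_isCompact hK hK.measurableSet
  · filter_upwards [ae_restrict_mem hK.measurableSet] with y hy t ht
    exact hC (t, y) ⟨Ioo_subset_Icc_self ht, hy⟩
  · exact integrableOn_const hK.measure_lt_top.ne
  · filter_upwards [ae_restrict_mem hK.measurableSet] with y hy t ht
    exact hd t ht y hy

/-- Along a compactly supported variation `φ + t η` of a function `φ`, the graphs stay for small
`t` in a given open neighbourhood `Ω` of the graph of `φ`. -/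
theorem exists_forall_graph_variation_mem {G : Type*} [TopologicalSpace G] {W : Set G}
    (hW : IsOpen W) {φ : G → ℝ} (hφ : ContinuousOn φ W) {η : G → ℝ} (hη : Continuous η)
    (hηc : HasCompactSupport η) (hηW : tsupport η ⊆ W) {Ω : Set (ℝ × G)} (hΩ : IsOpen Ω)
    (hgraph : ∀ y ∈ W, (φ y, y) ∈ Ω) :
    ∃ δ > 0, ∀ t ∈ Icc (-δ) δ, ∀ y ∈ W, (φ y + t * η y, y) ∈ Ω := by
  have h : ∀ᶠ t in 𝓝 (0 : ℝ), ∀ y ∈ tsupport η, (φ y + t * η y, y) ∈ Ω := by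
    refine IsCompact.eventually_forall_of_forall_eventually hηc fun y hy ↦ ?_
    have hc : ContinuousAt (fun z : ℝ × G ↦ (φ z.2 + z.1 * η z.2, z.2)) (0, y) := by
      have h1 : ContinuousAt (fun z : ℝ × G ↦ φ z.2) (0, y) :=
        ContinuousAt.comp (f := Prod.snd) (x := ((0 : ℝ), y)) (hφ.continuousAt (hW.mem_nhds (hηW hy))) continuousAt_snd
      exact (h1.add (continuousAt_fst.mul (hη.continuousAt.comp continuousAt_snd))).prodMk
        continuousAt_snd
    have := hc.preimage_mem_nhds (hΩ.mem_nhds (by simpa using hgraph y (hηW hy)))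
    exact this
  obtain ⟨δ, hδ, hb⟩ := Metric.eventually_nhds_iff_ball.1 h
  refine ⟨δ / 2, half_pos hδ, fun t ht y hy ↦ ?_⟩
  by_cases hyη : y ∈ tsupport η
  · refine hb t ?_ y hyη
    rw [Metric.mem_ball, dist_zero_right, Real.norm_eq_abs, abs_lt]
    constructor <;> linarith [ht.1, ht.2]
  · simpa [image_eq_zero_of_notMem_tsupport hyη] using hgraph y hy

section Flux

variable {n : ℕ}

/-- The flux density of the vector field `(X₀, X)` on `ℝ × ℝⁿ` through the graph of `φ`, with
respect to the upward conormal `(1, -∇φ)`. -/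
def fluxDensity (X₀ : ℝ × EuclideanSpace ℝ (Fin n) → ℝ)
    (X : Fin n → ℝ × EuclideanSpace ℝ (Fin n) → ℝ) (φ : EuclideanSpace ℝ (Fin n) → ℝ)
    (y : EuclideanSpace ℝ (Fin n)) : ℝ :=
  X₀ (φ y, y) - ∑ i, X i (φ y, y) * fderiv ℝ φ y (EuclideanSpace.single i 1)

/-- The divergence of the vector field `(X₀, X)` on `ℝ × ℝⁿ`. -/
def prodDivergence (X₀ : ℝ × EuclideanSpace ℝ (Fin n) → ℝ)
    (X : Fin n → ℝ × EuclideanSpace ℝ (Fin n) → ℝ) (z : ℝ × EuclideanSpace ℝ (Fin n)) : ℝ :=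
  fderiv ℝ X₀ z (1, 0) + ∑ i, fderiv ℝ (X i) z (0, EuclideanSpace.single i 1)

variable {X₀ : ℝ × EuclideanSpace ℝ (Fin n) → ℝ} {X : Fin n → ℝ × EuclideanSpace ℝ (Fin n) → ℝ}
  {Ω : Set (ℝ × EuclideanSpace ℝ (Fin n))} {W : Set (EuclideanSpace ℝ (Fin n))}
  {φ η : EuclideanSpace ℝ (Fin n) → ℝ}

theorem fderiv_add_mul_of_mem (hW : IsOpen W) (hφ : ContDiffOn ℝ 2 φ W) (hη : ContDiff ℝ ∞ η)
    {y : EuclideanSpace ℝ (Fin n)} (hy : y ∈ W) (t : ℝ) (v : EuclideanSpace ℝ (Fin n)) :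
    fderiv ℝ (fun y ↦ φ y + t * η y) y v = fderiv ℝ φ y v + t * fderiv ℝ η y v := by
  have h1 : DifferentiableAt ℝ φ y :=
    (hφ.contDiffAt (hW.mem_nhds hy)).differentiableAt (by norm_num)
  have h2 : DifferentiableAt ℝ η y := hη.differentiable (by simp) y
  rw [fderiv_fun_add h1 (h2.const_mul t), fderiv_const_mul h2]
  simp

/-- The first variation of the flux, before integration by parts. -/
theorem hasDerivAt_integral_fluxDensity (hW : IsOpen W) (hφ : ContDiffOn ℝ 2 φ W)
    (hη : ContDiff ℝ ∞ η) (hηc : HasCompactSupport η) (hηW : tsupport η ⊆ W)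
    (hΩ : IsOpen Ω) (hX₀ : ContDiffOn ℝ 1 X₀ Ω) (hX : ∀ i, ContDiffOn ℝ 1 (X i) Ω)
    (hgraph : ∀ y ∈ W, (φ y, y) ∈ Ω) :
    HasDerivAt (fun t : ℝ ↦ ∫ y in tsupport η, fluxDensity X₀ X (fun y ↦ φ y + t * η y) y)
      (∫ y in tsupport η, (η y * fderiv ℝ X₀ (φ y, y) (1, 0) -
        ∑ i, (η y * fderiv ℝ (X i) (φ y, y) (1, 0) * fderiv ℝ φ y (EuclideanSpace.single i 1)
          + X i (φ y, y) * fderiv ℝ η y (EuclideanSpace.single i 1)))) 0 := by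
  obtain ⟨δ, hδ, hmem⟩ :=
    exists_forall_graph_variation_mem hW hφ.continuousOn hη.continuous hηc hηW hΩ hgraph
  -- the integrand, with the gradient of `φ + t η` expanded
  let J : ℝ → EuclideanSpace ℝ (Fin n) → ℝ := fun t y ↦ X₀ (φ y + t * η y, y) -
    ∑ i, X i (φ y + t * η y, y) * (fderiv ℝ φ y (EuclideanSpace.single i 1) +
      t * fderiv ℝ η y (EuclideanSpace.single i 1))
  let J' : ℝ → EuclideanSpace ℝ (Fin n) → ℝ := fun t y ↦
    η y * fderiv ℝ X₀ (φ y + t * η y, y) (1, 0) -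
    ∑ i, (η y * fderiv ℝ (X i) (φ y + t * η y, y) (1, 0) *
      (fderiv ℝ φ y (EuclideanSpace.single i 1) + t * fderiv ℝ η y (EuclideanSpace.single i 1))
      + X i (φ y + t * η y, y) * fderiv ℝ η y (EuclideanSpace.single i 1))
  have hcW : ContinuousOn (fun z : ℝ × EuclideanSpace ℝ (Fin n) ↦ φ z.2) (Icc (-δ) δ ×ˢ tsupport η) :=
    hφ.continuousOn.comp continuousOn_snd fun z hz ↦ hηW hz.2
  have hcz : ContinuousOn (fun z : ℝ × EuclideanSpace ℝ (Fin n) ↦ (φ z.2 + z.1 * η z.2, z.2))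
      (Icc (-δ) δ ×ˢ tsupport η) := by
    have := hη.continuous
    exact (hcW.add (by fun_prop)).prodMk continuousOn_snd
  have hmaps : MapsTo (fun z : ℝ × EuclideanSpace ℝ (Fin n) ↦ (φ z.2 + z.1 * η z.2, z.2))
      (Icc (-δ) δ ×ˢ tsupport η) Ω := fun z hz ↦ hmem z.1 hz.1 z.2 (hηW hz.2)
  have hφ' : ∀ v, ContinuousOn (fun z : ℝ × EuclideanSpace ℝ (Fin n) ↦ fderiv ℝ φ z.2 v)
      (Icc (-δ) δ ×ˢ tsupport η) := fun v ↦
    ((hφ.continuousOn_fderiv_of_isOpen hW (by norm_num)).clm_apply continuousOn_const).comp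
      continuousOn_snd fun z hz ↦ hηW hz.2
  have hη' : ∀ v, Continuous fun y ↦ fderiv ℝ η y v := fun v ↦
    (hη.continuous_fderiv (by simp)).clm_apply continuous_const
  have hXc : ∀ F : ℝ × EuclideanSpace ℝ (Fin n) → ℝ, ContDiffOn ℝ 1 F Ω →
      ContinuousOn (fun z : ℝ × EuclideanSpace ℝ (Fin n) ↦ F (φ z.2 + z.1 * η z.2, z.2))
        (Icc (-δ) δ ×ˢ tsupport η) := fun F hF ↦ hF.continuousOn.comp hcz hmaps
  have hXd : ∀ F : ℝ × EuclideanSpace ℝ (Fin n) → ℝ, ContDiffOn ℝ 1 F Ω →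
      ContinuousOn (fun z : ℝ × EuclideanSpace ℝ (Fin n) ↦
        fderiv ℝ F (φ z.2 + z.1 * η z.2, z.2) (1, 0)) (Icc (-δ) δ ×ˢ tsupport η) := fun F hF ↦
    ((hF.continuousOn_fderiv_of_isOpen hΩ le_rfl).clm_apply continuousOn_const).comp hcz hmaps
  have hηc2 : ContinuousOn (fun z : ℝ × EuclideanSpace ℝ (Fin n) ↦ η z.2) (Icc (-δ) δ ×ˢ tsupport η) :=
    (hη.continuous.comp continuous_snd).continuousOn
  have hηc3 : ∀ v, ContinuousOn (fun z : ℝ × EuclideanSpace ℝ (Fin n) ↦ fderiv ℝ η z.2 v)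
      (Icc (-δ) δ ×ˢ tsupport η) := fun v ↦ ((hη' v).comp continuous_snd).continuousOn
  have hJc : ContinuousOn (fun z : ℝ × EuclideanSpace ℝ (Fin n) ↦ J z.1 z.2)
      (Icc (-δ) δ ×ˢ tsupport η) :=
    (hXc X₀ hX₀).sub (continuousOn_finsetSum _ fun i _ ↦
      (hXc (X i) (hX i)).mul ((hφ' _).add (continuousOn_fst.mul (hηc3 _))))
  have hJc' : ContinuousOn (fun z : ℝ × EuclideanSpace ℝ (Fin n) ↦ J' z.1 z.2)
      (Icc (-δ) δ ×ˢ tsupport η) :=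
    (hηc2.mul (hXd X₀ hX₀)).sub (continuousOn_finsetSum _ fun i _ ↦
      ((hηc2.mul (hXd (X i) (hX i))).mul ((hφ' _).add (continuousOn_fst.mul (hηc3 _)))).add
        ((hXc (X i) (hX i)).mul (hηc3 _)))
  have hJd : ∀ t ∈ Ioo (-δ) δ, ∀ y ∈ tsupport η, HasDerivAt (fun s ↦ J s y) (J' t y) t := by
    intro t ht y hy
    have hin := hmem t (Ioo_subset_Icc_self ht) y (hηW hy)
    have hcurve : HasDerivAt (fun s : ℝ ↦ (φ y + s * η y, y)) (η y, (0 : EuclideanSpace ℝ (Fin n))) t := by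
      have h1 : HasDerivAt (fun s : ℝ ↦ φ y + s * η y) (η y) t := by
        simpa using ((hasDerivAt_id t).mul_const (η y)).const_add (φ y)
      exact h1.prodMk (hasDerivAt_const t y)
    have hF : ∀ F : ℝ × EuclideanSpace ℝ (Fin n) → ℝ, ContDiffOn ℝ 1 F Ω →
        HasDerivAt (fun s : ℝ ↦ F (φ y + s * η y, y))
          (η y * fderiv ℝ F (φ y + t * η y, y) (1, 0)) t := by
      intro F hF
      have h := ((hF.contDiffAt (hΩ.mem_nhds hin)).differentiableAt one_ne_zero).hasFDerivAt.comp_hasDerivAt t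
        hcurve
      have e : ((η y, 0) : ℝ × EuclideanSpace ℝ (Fin n)) = η y • (1, 0) := by simp
      rw [e, map_smul, smul_eq_mul] at h
      exact h
    have hlin : ∀ a b : ℝ, HasDerivAt (fun s : ℝ ↦ a + s * b) b t := fun a b ↦ by
      simpa using ((hasDerivAt_id t).mul_const b).const_add a
    refine (hF X₀ hX₀).sub (HasDerivAt.fun_sum fun i _ ↦ ?_)
    exact (hF (X i) (hX i)).mul (hlin _ _)
  have h := hasDerivAt_setIntegral_of_continuousOn (μ := volume) hηc hδ hJc hJc' hJd
  have e1 : (fun t : ℝ ↦ ∫ y in tsupport η, fluxDensity X₀ X (fun y ↦ φ y + t * η y) y) =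
      fun t ↦ ∫ y in tsupport η, J t y := by
    funext t
    refine setIntegral_congr_fun hηc.measurableSet fun y hy ↦ ?_
    simp only [fluxDensity, J, fderiv_add_mul_of_mem hW hφ hη (hηW hy)]
  rw [e1]
  convert! h using 2
  funext y
  simp [J']

/-- Integration by parts in the first variation of the flux: it is the integral over the graph of
the divergence against the variation. -/
theorem integral_firstVariation_eq (hW : IsOpen W) (hφ : ContDiffOn ℝ 2 φ W)
    (hη : ContDiff ℝ ∞ η) (hηc : HasCompactSupport η) (hηW : tsupport η ⊆ W)
    (hΩ : IsOpen Ω) (hX₀ : ContDiffOn ℝ 1 X₀ Ω) (hX : ∀ i, ContDiffOn ℝ 1 (X i) Ω)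
    (hgraph : ∀ y ∈ W, (φ y, y) ∈ Ω) :
    (∫ y in tsupport η, (η y * fderiv ℝ X₀ (φ y, y) (1, 0) -
        ∑ i, (η y * fderiv ℝ (X i) (φ y, y) (1, 0) * fderiv ℝ φ y (EuclideanSpace.single i 1)
          + X i (φ y, y) * fderiv ℝ η y (EuclideanSpace.single i 1)))) =
      ∫ y, η y * prodDivergence X₀ X (φ y, y) := by
  have hgd : ∀ y ∈ W, HasFDerivAt (fun y ↦ (φ y, y))
      ((fderiv ℝ φ y).prod (ContinuousLinearMap.id ℝ (EuclideanSpace ℝ (Fin n)))) y := fun y hy ↦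
    (((hφ.contDiffAt (hW.mem_nhds hy)).differentiableAt (by norm_num)).hasFDerivAt).prodMk
      (hasFDerivAt_id y)
  -- the restriction of a component of the field to the graph, and its derivative
  have hcomp : ∀ F : ℝ × EuclideanSpace ℝ (Fin n) → ℝ, ContDiffOn ℝ 1 F Ω →
      ContDiffOn ℝ 1 (fun y ↦ F (φ y, y)) W := fun F hF ↦
    hF.comp (f := fun y ↦ (φ y, y)) ((hφ.of_le (by norm_num)).prodMk contDiffOn_id) hgraph
  have hder : ∀ F : ℝ × EuclideanSpace ℝ (Fin n) → ℝ, ContDiffOn ℝ 1 F Ω → ∀ y ∈ W, ∀ v,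
      fderiv ℝ (fun y ↦ F (φ y, y)) y v =
        fderiv ℝ φ y v * fderiv ℝ F (φ y, y) (1, 0) + fderiv ℝ F (φ y, y) (0, v) := by
    intro F hF y hy v
    have h := HasFDerivAt.comp (f := fun y ↦ (φ y, y)) y ((hF.contDiffAt
      (hΩ.mem_nhds (hgraph y hy))).differentiableAt one_ne_zero).hasFDerivAt (hgd y hy)
    have h' : fderiv ℝ (fun y ↦ F (φ y, y)) y = _ := h.fderiv
    rw [h']
    have e : ((fderiv ℝ φ y v, v) : ℝ × EuclideanSpace ℝ (Fin n)) =
        fderiv ℝ φ y v • (1, 0) + (0, v) := by simp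
    simp only [ContinuousLinearMap.comp_apply, ContinuousLinearMap.prod_apply,
      ContinuousLinearMap.id_apply]
    rw [e, map_add, map_smul, smul_eq_mul]
  have hηz : ∀ y, y ∉ tsupport η → η y = 0 := fun y hy ↦ image_eq_zero_of_notMem_tsupport hy
  have hdηz : ∀ y, y ∉ tsupport η → ∀ v, fderiv ℝ η y v = 0 := fun y hy v ↦ by
    rw [image_eq_zero_of_notMem_tsupport (fun h ↦ hy (tsupport_fderiv_subset ℝ h))]; rfl
  have hηs : ∀ (F : EuclideanSpace ℝ (Fin n) → ℝ), ContinuousOn F (tsupport η) →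
      ∀ ζ : EuclideanSpace ℝ (Fin n) → ℝ, Continuous ζ → (∀ y, y ∉ tsupport η → ζ y = 0) →
      Integrable (fun y ↦ F y * ζ y) := by
    intro F hF ζ hζ hz
    rw [← integrableOn_iff_integrable_of_support_subset (s := tsupport η)]
    · exact (hF.mul hζ.continuousOn).integrableOn_compact hηc
    · intro y hy
      by_contra hc
      exact hy (by simp [hz y hc])
  have hη' : ∀ v, Continuous fun y ↦ fderiv ℝ η y v := fun v ↦
    (hη.continuous_fderiv (by simp)).clm_apply continuous_const
  have hfc : ∀ F : ℝ × EuclideanSpace ℝ (Fin n) → ℝ, ContDiffOn ℝ 1 F Ω → ∀ v,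
      ContinuousOn (fun y ↦ fderiv ℝ F (φ y, y) v) (tsupport η) := fun F hF v ↦
    (((hF.continuousOn_fderiv_of_isOpen hΩ le_rfl).clm_apply continuousOn_const).comp
      (f := fun y ↦ (φ y, y)) (hφ.continuousOn.prodMk continuousOn_id) hgraph).mono hηW
  have hφc : ∀ v, ContinuousOn (fun y ↦ fderiv ℝ φ y v) (tsupport η) := fun v ↦
    ((hφ.continuousOn_fderiv_of_isOpen hW (by norm_num)).clm_apply continuousOn_const).mono hηW
  have ibp : ∀ i, ∫ y, X i (φ y, y) * fderiv ℝ η y (EuclideanSpace.single i 1) =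
      - ∫ y, fderiv ℝ (fun y ↦ X i (φ y, y)) y (EuclideanSpace.single i 1) * η y := by
    intro i
    refine integral_mul_fderiv_eq_neg_fderiv_mul_of_integrable
      (f := fun y ↦ X i (φ y, y)) (g := η) ?_ ?_ ?_ ?_ ?_
    · exact hηs _ ((((hcomp _ (hX i)).continuousOn_fderiv_of_isOpen hW le_rfl).clm_apply
        continuousOn_const).mono hηW) η hη.continuous hηz
    · exact hηs _ ((hcomp _ (hX i)).continuousOn.mono hηW) _ (hη' _) fun y hy ↦ hdηz y hy _
    · exact hηs _ ((hcomp _ (hX i)).continuousOn.mono hηW) η hη.continuous hηz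
    · exact fun y hy ↦ ((hcomp _ (hX i)).contDiffAt (hW.mem_nhds (hηW hy))).differentiableAt
        one_ne_zero
    · exact fun y _ ↦ hη.differentiable (by simp) y
  have i0 : Integrable fun y ↦ fderiv ℝ X₀ (φ y, y) (1, 0) * η y :=
    hηs _ (hfc X₀ hX₀ _) η hη.continuous hηz
  have i1 : ∀ i, Integrable fun y ↦ (fderiv ℝ (X i) (φ y, y) (1, 0) *
      fderiv ℝ φ y (EuclideanSpace.single i 1)) * η y := fun i ↦
    hηs _ ((hfc _ (hX i) _).mul (hφc _)) η hη.continuous hηz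
  have i2 : ∀ i, Integrable fun y ↦ X i (φ y, y) * fderiv ℝ η y (EuclideanSpace.single i 1) :=
    fun i ↦ hηs _ ((hcomp _ (hX i)).continuousOn.mono hηW) _ (hη' _) fun y hy ↦ hdηz y hy _
  have i3 : ∀ i, Integrable fun y ↦
      fderiv ℝ (fun y ↦ X i (φ y, y)) y (EuclideanSpace.single i 1) * η y := fun i ↦
    hηs _ ((((hcomp _ (hX i)).continuousOn_fderiv_of_isOpen hW le_rfl).clm_apply
        continuousOn_const).mono hηW) η hη.continuous hηz
  rw [setIntegral_eq_integral_of_forall_compl_eq_zero]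
  swap
  · intro y hy
    simp [hηz y hy, hdηz y hy]
  have e1 : (∫ y, (η y * fderiv ℝ X₀ (φ y, y) (1, 0) -
        ∑ i, (η y * fderiv ℝ (X i) (φ y, y) (1, 0) * fderiv ℝ φ y (EuclideanSpace.single i 1)
          + X i (φ y, y) * fderiv ℝ η y (EuclideanSpace.single i 1)))) =
      (∫ y, fderiv ℝ X₀ (φ y, y) (1, 0) * η y) - ∑ i, ((∫ y, (fderiv ℝ (X i) (φ y, y) (1, 0) *
      fderiv ℝ φ y (EuclideanSpace.single i 1)) * η y) +
        ∫ y, X i (φ y, y) * fderiv ℝ η y (EuclideanSpace.single i 1)) := by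
    have : ∀ i, (∫ y, (fderiv ℝ (X i) (φ y, y) (1, 0) *
      fderiv ℝ φ y (EuclideanSpace.single i 1)) * η y) +
        ∫ y, X i (φ y, y) * fderiv ℝ η y (EuclideanSpace.single i 1) =
        ∫ y, ((fderiv ℝ (X i) (φ y, y) (1, 0) *
      fderiv ℝ φ y (EuclideanSpace.single i 1)) * η y +
         X i (φ y, y) * fderiv ℝ η y (EuclideanSpace.single i 1)) := fun i ↦
      (integral_add (i1 i) (i2 i)).symm
    have i12 : ∀ i, Integrable fun y ↦ ((fderiv ℝ (X i) (φ y, y) (1, 0) *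
        fderiv ℝ φ y (EuclideanSpace.single i 1)) * η y +
         X i (φ y, y) * fderiv ℝ η y (EuclideanSpace.single i 1)) := fun i ↦ (i1 i).add (i2 i)
    simp only [this]
    rw [← integral_finsetSum _ fun i _ ↦ i12 i, ← integral_sub i0
      (integrable_finsetSum _ fun i _ ↦ i12 i)]
    congr 1
    funext y
    simp only [mul_comm, mul_left_comm]
  have e2 : (∫ y, η y * prodDivergence X₀ X (φ y, y)) =
      (∫ y, fderiv ℝ X₀ (φ y, y) (1, 0) * η y) - ∑ i, ((∫ y, (fderiv ℝ (X i) (φ y, y) (1, 0) *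
      fderiv ℝ φ y (EuclideanSpace.single i 1)) * η y) -
        ∫ y, fderiv ℝ (fun y ↦ X i (φ y, y)) y (EuclideanSpace.single i 1) * η y) := by
    have : ∀ i, (∫ y, (fderiv ℝ (X i) (φ y, y) (1, 0) *
      fderiv ℝ φ y (EuclideanSpace.single i 1)) * η y) -
        ∫ y, fderiv ℝ (fun y ↦ X i (φ y, y)) y (EuclideanSpace.single i 1) * η y =
        ∫ y, ((fderiv ℝ (X i) (φ y, y) (1, 0) *
      fderiv ℝ φ y (EuclideanSpace.single i 1)) * η y -
         fderiv ℝ (fun y ↦ X i (φ y, y)) y (EuclideanSpace.single i 1) * η y) := fun i ↦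
      (integral_sub (i1 i) (i3 i)).symm
    have i13 : ∀ i, Integrable fun y ↦ ((fderiv ℝ (X i) (φ y, y) (1, 0) *
        fderiv ℝ φ y (EuclideanSpace.single i 1)) * η y -
         fderiv ℝ (fun y ↦ X i (φ y, y)) y (EuclideanSpace.single i 1) * η y) := fun i ↦
      (i1 i).sub (i3 i)
    simp only [this]
    rw [← integral_finsetSum _ fun i _ ↦ i13 i, ← integral_sub i0
      (integrable_finsetSum _ fun i _ ↦ i13 i)]
    congr 1
    funext y
    by_cases hy : y ∈ tsupport η
    · simp only [hder _ (hX _) y (hηW hy), prodDivergence, mul_add, Finset.mul_sum]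
      rw [sub_eq_add_neg, ← Finset.sum_neg_distrib]
      congr 1
      · ring
      · exact Finset.sum_congr rfl fun i _ ↦ by ring
    · simp [hηz y hy]
  rw [e1, e2]
  simp only [ibp, sub_eq_add_neg]

/-- **Calibration principle.** If a functional `P` of the variations of the graph of `φ` dominates
the flux of a `C¹` field, agrees with it at the graph itself, and is critical there, then the field
is divergence free along the graph. -/
theorem prodDivergence_eq_zero_of_calibration (hW : IsOpen W) (hφ : ContDiffOn ℝ 2 φ W)
    (hΩ : IsOpen Ω) (hX₀ : ContDiffOn ℝ 1 X₀ Ω) (hX : ∀ i, ContDiffOn ℝ 1 (X i) Ω)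
    (hgraph : ∀ y ∈ W, (φ y, y) ∈ Ω)
    (hP : ∀ η : EuclideanSpace ℝ (Fin n) → ℝ, ContDiff ℝ ∞ η → HasCompactSupport η →
      tsupport η ⊆ W → ∃ P : ℝ → ℝ, HasDerivAt P 0 0 ∧
        P 0 = (∫ y in tsupport η, fluxDensity X₀ X (fun y ↦ φ y + 0 * η y) y) ∧
        ∀ᶠ t in 𝓝 (0 : ℝ), (∫ y in tsupport η, fluxDensity X₀ X (fun y ↦ φ y + t * η y) y) ≤ P t)
    {y₀ : EuclideanSpace ℝ (Fin n)} (hy₀ : y₀ ∈ W) :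
    prodDivergence X₀ X (φ y₀, y₀) = 0 := by
  have key : ∀ η : EuclideanSpace ℝ (Fin n) → ℝ, ContDiff ℝ ∞ η → HasCompactSupport η →
      tsupport η ⊆ W → ∫ y, η y • prodDivergence X₀ X (φ y, y) = 0 := by
    intro η hη hηc hηW
    obtain ⟨P, hPd, hP0, hPle⟩ := hP η hη hηc hηW
    have hflux := hasDerivAt_integral_fluxDensity hW hφ hη hηc hηW hΩ hX₀ hX hgraph
    rw [integral_firstVariation_eq hW hφ hη hηc hηW hΩ hX₀ hX hgraph] at hflux
    have hmin : IsLocalMin (fun t ↦ P t -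
        ∫ y in tsupport η, fluxDensity X₀ X (fun y ↦ φ y + t * η y) y) 0 := by
      filter_upwards [hPle] with t ht
      rw [hP0, sub_self]
      exact sub_nonneg.2 ht
    have := hmin.hasDerivAt_eq_zero (hPd.sub hflux)
    simpa using this
  have hcont : ContinuousOn (fun y ↦ prodDivergence X₀ X (φ y, y)) W := by
    have hfc : ∀ F : ℝ × EuclideanSpace ℝ (Fin n) → ℝ, ContDiffOn ℝ 1 F Ω → ∀ v,
        ContinuousOn (fun y ↦ fderiv ℝ F (φ y, y) v) W := fun F hF v ↦
      ((hF.continuousOn_fderiv_of_isOpen hΩ le_rfl).clm_apply continuousOn_const).comp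
        (f := fun y ↦ (φ y, y)) (hφ.continuousOn.prodMk continuousOn_id) hgraph
    exact (hfc X₀ hX₀ _).add (continuousOn_finsetSum _ fun i _ ↦ hfc _ (hX i) _)
  have hae := hW.ae_eq_zero_of_integral_contDiff_smul_eq_zero
    (hcont.locallyIntegrableOn hW.measurableSet) key
  have hae' : (fun y ↦ prodDivergence X₀ X (φ y, y)) =ᵐ[volume.restrict W] fun _ ↦ 0 :=
    (ae_restrict_iff' hW.measurableSet).2 hae
  exact MeasureTheory.Measure.eqOn_open_of_ae_eq hae' hW hcont continuousOn_const hy₀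

end Flux

/-! ### Gram determinants and the perimeter density -/

section Gram

variable {F : Type*} [NormedAddCommGroup F] [InnerProductSpace ℝ F]

theorem Matrix.gram_sum_smul {ι κ : Type*} [Fintype κ] [Fintype ι]
    (A : Matrix ι κ ℝ) (b : κ → F) :
    Matrix.gram ℝ (fun i ↦ ∑ a, A i a • b a) = A * Matrix.gram ℝ b * A.transpose := by
  ext i j
  simp only [Matrix.gram_apply, Matrix.mul_apply, sum_inner, inner_sum, inner_smul_left,
    inner_smul_right, Matrix.transpose_apply, Finset.sum_mul, Finset.mul_sum]
  refine Finset.sum_congr rfl fun x _ ↦ Finset.sum_congr rfl fun y _ ↦ ?_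
  simp only [conj_trivial]
  ring

theorem Matrix.det_gram_sum_smul {ι : Type*} [Fintype ι] [DecidableEq ι]
    (A : Matrix ι ι ℝ) (b : ι → F) :
    (Matrix.gram ℝ (fun i ↦ ∑ a, A i a • b a)).det = A.det ^ 2 * (Matrix.gram ℝ b).det := by
  rw [Matrix.gram_sum_smul, Matrix.det_mul, Matrix.det_mul, Matrix.det_transpose]
  ring

/-- The Gram determinant of a vector together with the tangent vectors of a graph: with respect to
the frame `b`, the volume is multiplied by the value of the conormal `(1, -p)` on the vector. -/
theorem det_gram_graph {n : ℕ} (b : Unit ⊕ Fin n → F) (a : ℝ) (c p : Fin n → ℝ) :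
    (Matrix.gram ℝ (Sum.elim (fun _ : Unit ↦ a • b (.inl ()) + ∑ i, c i • b (.inr i))
      fun i ↦ b (.inr i) + p i • b (.inl ()))).det =
      (a - ∑ i, c i * p i) ^ 2 * (Matrix.gram ℝ b).det := by
  let A : Matrix (Unit ⊕ Fin n) (Unit ⊕ Fin n) ℝ :=
    Matrix.fromBlocks (Matrix.of fun _ _ ↦ a) (Matrix.of fun _ i ↦ c i) (Matrix.of fun i _ ↦ p i) 1
  have h : (Sum.elim (fun _ : Unit ↦ a • b (.inl ()) + ∑ i, c i • b (.inr i))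
      fun i ↦ b (.inr i) + p i • b (.inl ())) = fun i ↦ ∑ x, A i x • b x := by
    funext i
    rcases i with i | i
    · simp [A]
    · simp [A, Matrix.one_apply, add_comm]
  rw [h, Matrix.det_gram_sum_smul, Matrix.det_fromBlocks_one₂₂]
  congr 2
  simp [Matrix.mul_apply]

/-- Adding to the vectors `w` a vector whose projection to the unit normal line is `a ν` multiplies
the Gram determinant by `a²`. -/
theorem det_gram_elim_of_normal {n : ℕ} {w : Fin n → F} {ν : F} (hν : ‖ν‖ = 1)
    (hνw : ∀ i, inner ℝ ν (w i) = 0) (a : ℝ) (c : Fin n → ℝ) :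
    (Matrix.gram ℝ (Sum.elim (fun _ : Unit ↦ a • ν + ∑ i, c i • w i) w)).det =
      a ^ 2 * (Matrix.gram ℝ w).det := by
  have h := det_gram_graph (Sum.elim (fun _ : Unit ↦ ν) w) a c 0
  have e : Matrix.gram ℝ (Sum.elim (fun _ : Unit ↦ ν) w) =
      Matrix.fromBlocks 1 0 0 (Matrix.gram ℝ w) := by
    ext i j
    rcases i with i | i <;> rcases j with j | j
    · simp [Matrix.gram_apply, hν]
    · simp [Matrix.gram_apply, hνw]
    · simp [Matrix.gram_apply, real_inner_comm, hνw]
    · simp [Matrix.gram_apply]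
  rw [e, Matrix.det_fromBlocks_zero₂₁] at h
  simpa using h

variable {n : ℕ}

/-- `n` vectors in an `(n+1)`-dimensional inner product space have a common unit normal. -/
theorem exists_unit_normal [FiniteDimensional ℝ F] (hF : Module.finrank ℝ F = n + 1) (w : Fin n → F) :
    ∃ ν : F, ‖ν‖ = 1 ∧ ∀ i, inner ℝ ν (w i) = 0 := by
  have hlt : Module.finrank ℝ (Submodule.span ℝ (range w)) < Module.finrank ℝ F := by
    have := finrank_range_le_card (R := ℝ) w
    rw [Fintype.card_fin] at this
    rw [hF]
    exact Nat.lt_succ_of_le this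
  obtain ⟨v, hv⟩ : ∃ v : (Submodule.span ℝ (range w))ᗮ, v ≠ 0 := by
    have := Submodule.finrank_add_finrank_orthogonal (Submodule.span ℝ (range w))
    have hpos : 0 < Module.finrank ℝ (Submodule.span ℝ (range w))ᗮ := by omega
    have := Module.finrank_pos_iff.1 hpos
    exact exists_ne 0
  have hv' : (v : F) ≠ 0 := fun h ↦ hv (Subtype.ext h)
  refine ⟨(‖(v : F)‖⁻¹ : ℝ) • (v : F), norm_smul_inv_norm hv', fun i ↦ ?_⟩
  rw [inner_smul_left, real_inner_comm,
    (Submodule.mem_orthogonal _ _).1 v.2 _ (Submodule.subset_span ⟨i, rfl⟩)]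
  simp

/-- Every vector is the sum of its component along a unit normal of a linearly independent
`w₁, …, w_n` and of a combination of the `wᵢ`. -/
theorem exists_eq_normal_add_sum [FiniteDimensional ℝ F] (hF : Module.finrank ℝ F = n + 1) {w : Fin n → F}
    (hw : LinearIndependent ℝ w) {ν : F} (hν : ‖ν‖ = 1) (hνw : ∀ i, inner ℝ ν (w i) = 0) (v : F) :
    ∃ c : Fin n → ℝ, v = inner ℝ v ν • ν + ∑ i, c i • w i := by
  have hspan : (Submodule.span ℝ (range w))ᗮ = Submodule.span ℝ {ν} := by
    symm
    refine Submodule.eq_of_le_of_finrank_eq ?_ ?_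
    · rw [Submodule.span_singleton_le_iff_mem, Submodule.mem_orthogonal]
      intro u hu
      induction hu using Submodule.span_induction with
      | mem x hx => obtain ⟨i, rfl⟩ := hx; rw [real_inner_comm]; exact hνw i
      | zero => simp
      | add x y _ _ hx hy => rw [inner_add_left, hx, hy, add_zero]
      | smul a x _ hx => rw [inner_smul_left, hx, mul_zero]
    · rw [finrank_span_singleton (by rintro rfl; simp at hν)]
      have := Submodule.finrank_add_finrank_orthogonal (Submodule.span ℝ (range w))
      rw [finrank_span_eq_card hw, Fintype.card_fin] at this
      omega
  have hmem : v - inner ℝ v ν • ν ∈ Submodule.span ℝ (range w) := by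
    rw [← Submodule.orthogonal_orthogonal (Submodule.span ℝ (range w)), hspan,
      Submodule.mem_orthogonal_singleton_iff_inner_right, inner_sub_right, inner_smul_right,
      real_inner_self_eq_norm_sq, hν, real_inner_comm]
    ring
  obtain ⟨c, hc⟩ := (Submodule.mem_span_range_iff_exists_fun ℝ).1 hmem
  exact ⟨c, by rw [hc]; abel⟩

/-- The projection of `v` onto the orthogonal complement of the orthonormal vectors `T`. -/
def projOrth {m : ℕ} (T : Fin m → F) (v : F) : F := v - ∑ j, inner ℝ v (T j) • T j

variable {m : ℕ} {T : Fin m → F}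

theorem inner_projOrth_right (hT : Orthonormal ℝ T) (v : F) (j : Fin m) :
    inner ℝ (projOrth T v) (T j) = 0 := by
  simp [projOrth, inner_sub_left, sum_inner, inner_smul_left, orthonormal_iff_ite.1 hT]

theorem inner_projOrth_of_orthogonal {v u : F} (hu : ∀ j, inner ℝ u (T j) = 0) :
    inner ℝ u (projOrth T v) = inner ℝ u v := by
  simp [projOrth, inner_sub_right, inner_sum, inner_smul_right, hu]

theorem inner_projOrth_self (hT : Orthonormal ℝ T) (v : F) :
    inner ℝ (projOrth T v) (projOrth T v) = inner ℝ v v - ∑ j, inner ℝ v (T j) ^ 2 := by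
  rw [inner_projOrth_of_orthogonal (inner_projOrth_right hT v)]
  simp only [projOrth, inner_sub_left, sum_inner, inner_smul_left, conj_trivial]
  congr 1
  exact Finset.sum_congr rfl fun j _ ↦ by rw [real_inner_comm v (T j)]; ring

/-- The horizontal area density spanned by `w₁, …, w_n`, where the horizontal space is the
orthogonal complement of the orthonormal vectors `T`. -/
def horizontalArea (T : Fin m → F) (w : Fin n → F) : ℝ :=
  √(Matrix.gram ℝ w).det * sSup {r : ℝ | ∃ ν : F, inner ℝ ν ν = 1 ∧ (∀ i, inner ℝ ν (w i) = 0) ∧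
    r = √(inner ℝ (projOrth T ν) (projOrth T ν))}

theorem horizontalArea_eq_of_normal [FiniteDimensional ℝ F] (hF : Module.finrank ℝ F = n + 1) {w : Fin n → F}
    (hw : LinearIndependent ℝ w) {ν : F} (hν : ‖ν‖ = 1) (hνw : ∀ i, inner ℝ ν (w i) = 0)
    (T : Fin m → F) : horizontalArea T w = √(Matrix.gram ℝ w).det * ‖projOrth T ν‖ := by
  have hset : {r : ℝ | ∃ ν : F, inner ℝ ν ν = 1 ∧ (∀ i, inner ℝ ν (w i) = 0) ∧
      r = √(inner ℝ (projOrth T ν) (projOrth T ν))} = {‖projOrth T ν‖} := by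
    refine subset_antisymm ?_ ?_
    · rintro r ⟨μ, hμ, hμw, rfl⟩
      obtain ⟨c, hc⟩ := exists_eq_normal_add_sum hF hw hν hνw μ
      -- a vector of the span of `w` that is orthogonal to it vanishes, so `μ = ± ν`
      have hz : ∑ i, c i • w i = 0 := by
        rw [← inner_self_eq_zero (𝕜 := ℝ)]
        have e : ∑ i, c i • w i = μ - inner ℝ μ ν • ν := eq_sub_of_add_eq' hc.symm
        conv_lhs => arg 2; rw [e]
        simp [inner_sub_left, inner_sum, inner_smul_right, inner_smul_left, hμw, hνw]
      rw [hz, add_zero] at hc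
      have h1 : (inner ℝ μ ν : ℝ) ^ 2 = 1 := by
        rw [hc, inner_smul_left, inner_smul_right, real_inner_self_eq_norm_sq, hν] at hμ
        simp only [conj_trivial] at hμ
        nlinarith
      have hp : projOrth T μ = inner ℝ μ ν • projOrth T ν := by
        conv_lhs => rw [hc]
        simp only [projOrth, inner_smul_left, conj_trivial, smul_sub, Finset.smul_sum, smul_smul]
      rw [mem_singleton_iff, hp, inner_smul_left, inner_smul_right, ← mul_assoc]
      simp only [conj_trivial]
      rw [← sq, h1, one_mul, real_inner_self_eq_norm_sq, Real.sqrt_sq (norm_nonneg _)]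
    · rintro _ rfl
      exact ⟨ν, by rw [real_inner_self_eq_norm_sq, hν, one_pow], hνw,
        by rw [real_inner_self_eq_norm_sq, Real.sqrt_sq (norm_nonneg _)]⟩
  rw [horizontalArea, hset, csSup_singleton]

theorem det_gram_elim_eq [FiniteDimensional ℝ F] (hF : Module.finrank ℝ F = n + 1) {w : Fin n → F}
    (hw : LinearIndependent ℝ w) {ν : F} (hν : ‖ν‖ = 1) (hνw : ∀ i, inner ℝ ν (w i) = 0) (v : F) :
    (Matrix.gram ℝ (Sum.elim (fun _ : Unit ↦ v) w)).det =
      inner ℝ v ν ^ 2 * (Matrix.gram ℝ w).det := by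
  obtain ⟨c, hc⟩ := exists_eq_normal_add_sum hF hw hν hνw v
  rw [← det_gram_elim_of_normal hν hνw (inner ℝ v ν) c, ← hc]

/-- The horizontal area in terms of Gram determinants alone. -/
theorem horizontalArea_eq_sqrt [FiniteDimensional ℝ F] (hF : Module.finrank ℝ F = n + 1) {w : Fin n → F}
    (hw : LinearIndependent ℝ w) (hT : Orthonormal ℝ T) :
    horizontalArea T w = √((Matrix.gram ℝ w).det -
      ∑ j, (Matrix.gram ℝ (Sum.elim (fun _ : Unit ↦ T j) w)).det) := by
  obtain ⟨ν, hν, hνw⟩ := exists_unit_normal hF w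
  have hdet := (Matrix.posSemidef_gram ℝ w).det_nonneg
  rw [horizontalArea_eq_of_normal hF hw hν hνw T, ← Real.sqrt_sq (norm_nonneg (projOrth T ν)),
    ← Real.sqrt_mul hdet, ← real_inner_self_eq_norm_sq, inner_projOrth_self hT,
    real_inner_self_eq_norm_sq, hν]
  congr 1
  simp only [det_gram_elim_eq hF hw hν hνw, mul_sub, Finset.mul_sum, one_pow, mul_one]
  congr 1
  exact Finset.sum_congr rfl fun j _ ↦ by rw [real_inner_comm]; ring

/-- The volume spanned by a horizontal unit vector and `w` is at most the horizontal area of `w`. -/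
theorem sqrt_det_gram_le_horizontalArea [FiniteDimensional ℝ F] (hF : Module.finrank ℝ F = n + 1) {w : Fin n → F}
    (hw : LinearIndependent ℝ w) {Y : F} (hY : ‖Y‖ = 1)
    (hYT : ∀ j, inner ℝ Y (T j) = 0) :
    √(Matrix.gram ℝ (Sum.elim (fun _ : Unit ↦ Y) w)).det ≤ horizontalArea T w := by
  obtain ⟨ν, hν, hνw⟩ := exists_unit_normal hF w
  rw [horizontalArea_eq_of_normal hF hw hν hνw T, det_gram_elim_eq hF hw hν hνw,
    Real.sqrt_mul (sq_nonneg _), Real.sqrt_sq_eq_abs, mul_comm]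
  refine mul_le_mul_of_nonneg_left ?_ (Real.sqrt_nonneg _)
  rw [← inner_projOrth_of_orthogonal hYT]
  simpa [hY] using abs_real_inner_le_norm Y (projOrth T ν)

/-- The volume spanned by a horizontal unit vector `Y` and `w` equals the horizontal area of `w` if
`Y` is orthogonal to the horizontal combinations of `w`. -/
theorem horizontalArea_eq_sqrt_det_gram [FiniteDimensional ℝ F] (hF : Module.finrank ℝ F = n + 1) {w : Fin n → F}
    (hw : LinearIndependent ℝ w) (hT : Orthonormal ℝ T) {Y : F} (hY : ‖Y‖ = 1)
    (hYT : ∀ j, inner ℝ Y (T j) = 0)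
    (horth : ∀ c : Fin n → ℝ, (∀ j, inner ℝ (∑ i, c i • w i) (T j) = 0) →
      inner ℝ Y (∑ i, c i • w i) = 0) :
    horizontalArea T w = √(Matrix.gram ℝ (Sum.elim (fun _ : Unit ↦ Y) w)).det := by
  obtain ⟨ν, hν, hνw⟩ := exists_unit_normal hF w
  rw [horizontalArea_eq_of_normal hF hw hν hνw T, det_gram_elim_eq hF hw hν hνw,
    Real.sqrt_mul (sq_nonneg _), Real.sqrt_sq_eq_abs, mul_comm]
  congr 1
  set h := projOrth T ν with hh
  have hYν : inner ℝ Y ν = inner ℝ Y h := (inner_projOrth_of_orthogonal hYT).symm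
  rcases eq_or_ne h 0 with h0 | h0
  · rw [hYν, h0]; simp
  -- the part `u` of `Y` orthogonal to `h` is a horizontal combination of `w`
  have hn : ‖h‖ ^ 2 ≠ 0 := pow_ne_zero 2 (norm_ne_zero_iff.2 h0)
  set u := Y - (inner ℝ Y h / ‖h‖ ^ 2) • h with hu
  have huT : ∀ j, inner ℝ u (T j) = 0 := fun j ↦ by
    rw [hu, inner_sub_left, inner_smul_left, hYT, hh, inner_projOrth_right hT]; simp
  have huν : inner ℝ u ν = 0 := by
    rw [← inner_projOrth_of_orthogonal huT, ← hh, hu, inner_sub_left, inner_smul_left,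
      real_inner_self_eq_norm_sq]
    simp only [conj_trivial]
    rw [div_mul_cancel₀ _ hn, sub_self]
  obtain ⟨c, hc⟩ := exists_eq_normal_add_sum hF hw hν hνw u
  rw [huν, zero_smul, zero_add] at hc
  have hYu : inner ℝ Y u = 0 := by
    rw [hc]
    exact horth c fun j ↦ by rw [← hc]; exact huT j
  rw [hu, inner_sub_right, inner_smul_right, real_inner_self_eq_norm_sq, hY] at hYu
  have hsq : (inner ℝ Y h : ℝ) ^ 2 = ‖h‖ ^ 2 := by
    field_simp at hYu
    linarith
  rw [hYν]
  exact ((sq_eq_sq₀ (norm_nonneg _) (abs_nonneg _)).1 (by rw [sq_abs, hsq]))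

end Gram

/-- **Jacobi's formula** at the identity: the derivative of the determinant is the trace. -/
theorem hasFDerivAt_det_of_eq_one {H ι : Type*} [NormedAddCommGroup H] [NormedSpace ℝ H]
    [Fintype ι] [DecidableEq ι] {A : H → Matrix ι ι ℝ} {A' : ι → ι → H →L[ℝ] ℝ} {x : H}
    (hA : ∀ i j, HasFDerivAt (fun y ↦ A y i j) (A' i j) x) (h1 : A x = 1) :
    HasFDerivAt (fun y ↦ (A y).det) (∑ i, A' i i) x := by
  simp only [Matrix.det_apply]
  have h : HasFDerivAt (fun y ↦ ∑ σ : Equiv.Perm ι, Equiv.Perm.sign σ • ∏ i, A y (σ i) i)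
      (∑ σ : Equiv.Perm ι, Equiv.Perm.sign σ •
        ∑ i, (∏ j ∈ Finset.univ.erase i, A x (σ j) j) • A' (σ i) i) x :=
    HasFDerivAt.fun_sum fun σ _ ↦
      (HasFDerivAt.finsetProd fun i _ ↦ hA (σ i) i).fun_const_smul _
  convert! h using 1
  rw [Finset.sum_eq_single (1 : Equiv.Perm ι)]
  · simp [h1]
  · intro σ _ hσ
    rw [Finset.sum_eq_zero, smul_zero]
    intro i _
    -- a permutation other than the identity moves an index different from `i`
    obtain ⟨j, hj, hji⟩ : ∃ j, σ j ≠ j ∧ j ≠ i := by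
      obtain ⟨j, hj⟩ := not_forall.1 fun h ↦ hσ (Equiv.ext h)
      rcases eq_or_ne j i with rfl | hji
      · refine ⟨σ j, fun h ↦ hj (σ.injective h), hj⟩
      · exact ⟨j, hj, hji⟩
    rw [Finset.prod_eq_zero (Finset.mem_erase.2 ⟨hji, Finset.mem_univ j⟩), zero_smul]
    rw [h1, Matrix.one_apply_ne hj]
  · simp

/-! ### Charts, coordinate fields and derivatives -/

section Chart

variable {d : ℕ} {M : Type*} [TopologicalSpace M] [ChartedSpace (EuclideanSpace ℝ (Fin d)) M]
  [IsManifold (𝓡 d) ∞ M]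

/-- The vector field that has the constant coordinates `v` in the chart at `p`. -/
def chartField (p : M) (v : EuclideanSpace ℝ (Fin d)) (q : M) : TangentSpace (𝓡 d) q :=
  (trivializationAt (EuclideanSpace ℝ (Fin d)) (TangentSpace (𝓡 d)) p).symmL ℝ q v

/-- The coordinates in the chart at `p` of a tangent vector at `q`. -/
def chartCoord (p q : M) : TangentSpace (𝓡 d) q →L[ℝ] EuclideanSpace ℝ (Fin d) :=
  (trivializationAt (EuclideanSpace ℝ (Fin d)) (TangentSpace (𝓡 d)) p).continuousLinearMapAt ℝ q

theorem chartField_chartCoord {p q : M} (hq : q ∈ (chartAt (EuclideanSpace ℝ (Fin d)) p).source)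
    (w : TangentSpace (𝓡 d) q) : chartField p (chartCoord p q w) q = w :=
  (trivializationAt (EuclideanSpace ℝ (Fin d)) (TangentSpace (𝓡 d)) p).symmL_continuousLinearMapAt
    (by simpa using hq) w

theorem chartCoord_chartField {p q : M} (hq : q ∈ (chartAt (EuclideanSpace ℝ (Fin d)) p).source)
    (v : EuclideanSpace ℝ (Fin d)) : chartCoord p q (chartField p v q) = v :=
  (trivializationAt (EuclideanSpace ℝ (Fin d)) (TangentSpace (𝓡 d)) p).continuousLinearMapAt_symmL
    (by simpa using hq) v

theorem chartCoord_self (p : M) (v : TangentSpace (𝓡 d) p) : chartCoord p p v = v := by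
  unfold chartCoord
  rw [TangentBundle.continuousLinearMapAt_trivializationAt (by simp), mfderiv_extChartAt_self]
  rfl

theorem chartField_self (p : M) (v : EuclideanSpace ℝ (Fin d)) : chartField p v p = v := by
  have h := chartField_chartCoord (p := p) (q := p) (mem_chart_source _ p) v
  have e : chartCoord p p (v : TangentSpace (𝓡 d) p) = v := chartCoord_self p v
  exact (congrArg (fun w ↦ chartField p w p) e).symm.trans h

theorem chartField_add (p : M) (v w : EuclideanSpace ℝ (Fin d)) (q : M) :
    chartField p (v + w) q = chartField p v q + chartField p w q := map_add _ _ _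

theorem chartField_smul (p : M) (c : ℝ) (v : EuclideanSpace ℝ (Fin d)) (q : M) :
    chartField p (c • v) q = c • chartField p v q := map_smul _ _ _

theorem chartField_sum {ι : Type*} [Fintype ι] (p : M) (v : ι → EuclideanSpace ℝ (Fin d)) (q : M) :
    chartField p (∑ i, v i) q = ∑ i, chartField p (v i) q := map_sum _ _ _

theorem contMDiffAt_chartField {p q : M}
    (hq : q ∈ (chartAt (EuclideanSpace ℝ (Fin d)) p).source) (v : EuclideanSpace ℝ (Fin d)) :
    ContMDiffAt (𝓡 d) (𝓡 d).tangent ∞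
      (fun q ↦ (⟨q, chartField p v q⟩ : TangentBundle (𝓡 d) M)) q := by
  have h := (trivializationAt (EuclideanSpace ℝ (Fin d)) (TangentSpace (𝓡 d) (M := M)) p).contMDiffAt_section_iff
      (IB := 𝓡 d) (n := ∞) (s := fun q ↦ chartField p v q) (by simpa using hq)
  refine h.2 ?_
  refine (contMDiffAt_const (c := v)).congr_of_eventuallyEq ?_
  filter_upwards [(chartAt (EuclideanSpace ℝ (Fin d)) p).open_source.mem_nhds hq] with x hx
  have := chartCoord_chartField hx v
  simpa [chartCoord, Trivialization.continuousLinearMapAt_apply, Trivialization.linearMapAt_apply, hx] using this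

/-- The coordinates of a `C^n` vector field in the chart at `p`, as a function on the chart. -/
theorem contDiffAt_chartCoord {n : ℕ∞ω} (hn : n ≤ ∞) {X : (q : M) → TangentSpace (𝓡 d) q} {p : M}
    (hX : ContMDiffAt (𝓡 d) (𝓡 d).tangent n (fun q ↦ (⟨q, X q⟩ : TangentBundle (𝓡 d) M)) p) :
    ContDiffAt ℝ n (fun x ↦ chartCoord p ((extChartAt (𝓡 d) p).symm x)
      (X ((extChartAt (𝓡 d) p).symm x))) (extChartAt (𝓡 d) p p) := by
  have h1 : ContMDiffAt 𝓘(ℝ, EuclideanSpace ℝ (Fin d)) (𝓡 d) n (extChartAt (𝓡 d) p).symm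
      (extChartAt (𝓡 d) p p) :=
    ((contMDiffOn_extChartAt_symm (n := ∞) (I := 𝓡 d) p).contMDiffAt
      (extChartAt_target_mem_nhds p)).of_le hn
  have h2 := (contMDiffAt_section p).1 hX
  rw [← extChartAt_to_inv (I := 𝓡 d) p] at h2
  have h3 := (h2.comp (extChartAt (𝓡 d) p p) h1).contDiffAt
  rw [extChartAt_to_inv (I := 𝓡 d) p] at h3
  refine h3.congr_of_eventuallyEq ?_
  filter_upwards [extChartAt_target_mem_nhds (I := 𝓡 d) p] with x hx
  have hs : (extChartAt (𝓡 d) p).symm x ∈ (chartAt (EuclideanSpace ℝ (Fin d)) p).source := by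
    rw [← extChartAt_source (I := 𝓡 d)]; exact (extChartAt (𝓡 d) p).map_target hx
  simp only [chartCoord, Trivialization.continuousLinearMapAt_apply, Function.comp_apply]
  rw [Trivialization.linearMapAt_apply, if_pos (by simpa using hs)]

/-- A function on the manifold that is `C^n` at a point, read in a chart. -/
theorem contDiffAt_comp_extChartAt_symm {n : ℕ∞ω} (hn : n ≤ ∞) {f : M → ℝ} {p : M}
    {x : EuclideanSpace ℝ (Fin d)} (hx : x ∈ (extChartAt (𝓡 d) p).target)
    (hf : ContMDiffAt (𝓡 d) 𝓘(ℝ, ℝ) n f ((extChartAt (𝓡 d) p).symm x)) :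
    ContDiffAt ℝ n (f ∘ (extChartAt (𝓡 d) p).symm) x := by
  have h1 : ContMDiffAt 𝓘(ℝ, EuclideanSpace ℝ (Fin d)) (𝓡 d) n (extChartAt (𝓡 d) p).symm x :=
    ((contMDiffOn_extChartAt_symm (n := ∞) (I := 𝓡 d) p).contMDiffAt
      ((isOpen_extChartAt_target p).mem_nhds hx)).of_le hn
  exact (hf.comp x h1).contDiffAt

theorem hasMFDerivAt_extChartAt_symm {p : M} {x : EuclideanSpace ℝ (Fin d)}
    (hx : x ∈ (extChartAt (𝓡 d) p).target) :
    HasMFDerivAt 𝓘(ℝ, EuclideanSpace ℝ (Fin d)) (𝓡 d) (extChartAt (𝓡 d) p).symm x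
      ((trivializationAt (EuclideanSpace ℝ (Fin d)) (TangentSpace (𝓡 d)) p).symmL ℝ
        ((extChartAt (𝓡 d) p).symm x)) := by
  have h := (mdifferentiableWithinAt_extChartAt_symm (I := 𝓡 d) hx).hasMFDerivWithinAt
  have hs : (extChartAt (𝓡 d) p).symm x ∈ (chartAt (EuclideanSpace ℝ (Fin d)) p).source := by
    rw [← extChartAt_source (I := 𝓡 d)]; exact (extChartAt (𝓡 d) p).map_target hx
  rw [TangentBundle.symmL_trivializationAt hs, (extChartAt (𝓡 d) p).right_inv hx]
  simp only [modelWithCornersSelf_coe, range_id, hasMFDerivWithinAt_univ] at h ⊢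
  exact h

theorem hasMFDerivAt_extChartAt_chartCoord {p q : M}
    (hq : q ∈ (chartAt (EuclideanSpace ℝ (Fin d)) p).source) :
    HasMFDerivAt (𝓡 d) 𝓘(ℝ, EuclideanSpace ℝ (Fin d)) (extChartAt (𝓡 d) p) q (chartCoord p q) := by
  unfold chartCoord
  rw [TangentBundle.continuousLinearMapAt_trivializationAt hq]
  exact (mdifferentiableAt_extChartAt hq).hasMFDerivAt

/-- The derivative of a parametrization `symm ∘ Ψ` given in a chart. -/
theorem hasMFDerivAt_extChartAt_symm_comp {G : Type*} [NormedAddCommGroup G] [NormedSpace ℝ G]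
    {p : M} {Ψ : G → EuclideanSpace ℝ (Fin d)} {Ψ' : G →L[ℝ] EuclideanSpace ℝ (Fin d)} {y : G}
    (hΨ : HasFDerivAt Ψ Ψ' y) (hy : Ψ y ∈ (extChartAt (𝓡 d) p).target) :
    HasMFDerivAt 𝓘(ℝ, G) (𝓡 d) (fun y ↦ (extChartAt (𝓡 d) p).symm (Ψ y)) y
      (((trivializationAt (EuclideanSpace ℝ (Fin d)) (TangentSpace (𝓡 d)) p).symmL ℝ
        ((extChartAt (𝓡 d) p).symm (Ψ y))).comp Ψ') :=
  HasMFDerivAt.comp y (hasMFDerivAt_extChartAt_symm hy) hΨ.hasMFDerivAt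

theorem mfderiv_extChartAt_symm_comp_apply {G : Type*} [NormedAddCommGroup G] [NormedSpace ℝ G]
    {p : M} {Ψ : G → EuclideanSpace ℝ (Fin d)} {Ψ' : G →L[ℝ] EuclideanSpace ℝ (Fin d)} {y : G}
    (hΨ : HasFDerivAt Ψ Ψ' y) (hy : Ψ y ∈ (extChartAt (𝓡 d) p).target) (v : G) :
    mfderiv 𝓘(ℝ, G) (𝓡 d) (fun y ↦ (extChartAt (𝓡 d) p).symm (Ψ y)) y v =
      chartField p (Ψ' v) ((extChartAt (𝓡 d) p).symm (Ψ y)) := by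
  rw [(hasMFDerivAt_extChartAt_symm_comp hΨ hy).mfderiv]; rfl

/-- The derivative of a function along a coordinate field, computed in the chart. -/
theorem fderiv_comp_extChartAt_symm {f : M → ℝ} {p : M} {x : EuclideanSpace ℝ (Fin d)}
    (hx : x ∈ (extChartAt (𝓡 d) p).target)
    (hf : MDifferentiableAt (𝓡 d) 𝓘(ℝ, ℝ) f ((extChartAt (𝓡 d) p).symm x))
    (v : EuclideanSpace ℝ (Fin d)) :
    fderiv ℝ (f ∘ (extChartAt (𝓡 d) p).symm) x v =
      mfderiv (𝓡 d) 𝓘(ℝ, ℝ) f ((extChartAt (𝓡 d) p).symm x)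
        (chartField p v ((extChartAt (𝓡 d) p).symm x)) := by
  have h := HasMFDerivAt.comp x hf.hasMFDerivAt (hasMFDerivAt_extChartAt_symm hx)
  rw [← mfderiv_eq_fderiv, h.mfderiv]
  rfl

/-- Derivative at the centre of the chart, where coordinate vectors are tangent vectors. -/
theorem fderiv_comp_extChartAt_symm_self {f : M → ℝ} {p : M}
    (hf : MDifferentiableAt (𝓡 d) 𝓘(ℝ, ℝ) f p) (v : EuclideanSpace ℝ (Fin d)) :
    fderiv ℝ (f ∘ (extChartAt (𝓡 d) p).symm) (extChartAt (𝓡 d) p p) v =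
      mfderiv (𝓡 d) 𝓘(ℝ, ℝ) f p v := by
  have hp : (extChartAt (𝓡 d) p).symm (extChartAt (𝓡 d) p p) = p := extChartAt_to_inv p
  have h := fderiv_comp_extChartAt_symm (f := f) (p := p) (mem_extChartAt_target p)
    (by rw [hp]; exact hf) v
  rw [h, hp, chartField_self]

omit [IsManifold (𝓡 d) ∞ M] in
theorem tangentBundle_mk_congr {p q : M} (h : p = q) (v : EuclideanSpace ℝ (Fin d)) :
    (⟨p, v⟩ : TangentBundle (𝓡 d) M) = ⟨q, v⟩ := by
  subst h; rfl

omit [IsManifold (𝓡 d) ∞ M] in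
/-- The derivative of a function along a curve. -/
theorem hasDerivAt_comp_curve {f : M → ℝ} {γ : ℝ → M} {t : ℝ}
    (hf : MDifferentiableAt (𝓡 d) 𝓘(ℝ, ℝ) f (γ t))
    (hγ : MDifferentiableAt 𝓘(ℝ, ℝ) (𝓡 d) γ t) :
    HasDerivAt (fun s ↦ f (γ s)) (mfderiv (𝓡 d) 𝓘(ℝ, ℝ) f (γ t) (curveVelocity γ t)) t := by
  have h := HasMFDerivAt.comp t hf.hasMFDerivAt hγ.hasMFDerivAt
  have h2 : HasFDerivAt (𝕜 := ℝ) (E := ℝ) (F := ℝ) (fun s ↦ f (γ s)) _ t := h.hasFDerivAt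
  exact h2.hasDerivAt

/-- The chart image of a curve. -/
theorem hasDerivAt_extChartAt_curve {p : M} {γ : ℝ → M} {t : ℝ}
    (hq : γ t ∈ (chartAt (EuclideanSpace ℝ (Fin d)) p).source)
    (hγ : MDifferentiableAt 𝓘(ℝ, ℝ) (𝓡 d) γ t) :
    HasDerivAt (fun s ↦ extChartAt (𝓡 d) p (γ s)) (chartCoord p (γ t) (curveVelocity γ t)) t := by
  have h := HasMFDerivAt.comp t (hasMFDerivAt_extChartAt_chartCoord hq) hγ.hasMFDerivAt
  have h2 : HasFDerivAt (𝕜 := ℝ) (E := ℝ) (F := EuclideanSpace ℝ (Fin d))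
    (fun s ↦ extChartAt (𝓡 d) p (γ s)) _ t := h.hasFDerivAt
  exact h2.hasDerivAt

variable (g : ContMDiffRiemannianMetric (𝓡 d) ∞ (EuclideanSpace ℝ (Fin d))
    (fun x : M ↦ TangentSpace (𝓡 d) x))

theorem contMDiffAt_metric_inner {n : ℕ∞ω} (hn : n ≤ ∞) {X Y : (q : M) → TangentSpace (𝓡 d) q} {p : M}
    (hX : ContMDiffAt (𝓡 d) (𝓡 d).tangent n (fun q ↦ (⟨q, X q⟩ : TangentBundle (𝓡 d) M)) p)
    (hY : ContMDiffAt (𝓡 d) (𝓡 d).tangent n (fun q ↦ (⟨q, Y q⟩ : TangentBundle (𝓡 d) M)) p) :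
    ContMDiffAt (𝓡 d) 𝓘(ℝ, ℝ) n (fun q ↦ g.inner q (X q) (Y q)) p := by
  let : RiemannianBundle (fun x : M ↦ TangentSpace (𝓡 d) x) := ⟨g.toRiemannianMetric⟩
  have : IsContMDiffRiemannianBundle (𝓡 d) n (EuclideanSpace ℝ (Fin d))
      (fun x : M ↦ TangentSpace (𝓡 d) x) :=
    IsContMDiffRiemannianBundle.of_le (n := ∞) hn
  exact ContMDiffAt.inner_bundle hX hY

theorem mdifferentiableAt_metric_inner {X Y : (q : M) → TangentSpace (𝓡 d) q} {p : M}
    (hX : MDifferentiableAt (𝓡 d) (𝓡 d).tangent (fun q ↦ (⟨q, X q⟩ : TangentBundle (𝓡 d) M)) p)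
    (hY : MDifferentiableAt (𝓡 d) (𝓡 d).tangent (fun q ↦ (⟨q, Y q⟩ : TangentBundle (𝓡 d) M)) p) :
    MDifferentiableAt (𝓡 d) 𝓘(ℝ, ℝ) (fun q ↦ g.inner q (X q) (Y q)) p := by
  let : RiemannianBundle (fun x : M ↦ TangentSpace (𝓡 d) x) := ⟨g.toRiemannianMetric⟩
  have : IsContMDiffRiemannianBundle (𝓡 d) 1 (EuclideanSpace ℝ (Fin d))
      (fun x : M ↦ TangentSpace (𝓡 d) x) :=
    IsContMDiffRiemannianBundle.of_le (n := ∞) (by norm_num)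
  exact MDifferentiableAt.inner_bundle hX hY

/-- Orthonormal vectors indexed by part of an index set of the right size extend to an orthonormal
basis. -/
theorem exists_metric_orthonormal_extension {ι : Type*} [Fintype ι] [DecidableEq ι]
    (hι : Fintype.card ι = d) (p : M) (v : ι → TangentSpace (𝓡 d) p) (s : Set ι)
    (hv : ∀ i ∈ s, ∀ j ∈ s, g.inner p (v i) (v j) = if i = j then 1 else 0) :
    ∃ b : Module.Basis ι ℝ (TangentSpace (𝓡 d) p),
      (∀ i j, g.inner p (b i) (b j) = if i = j then 1 else 0) ∧ ∀ i ∈ s, b i = v i := by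
  let : RiemannianBundle (fun x : M ↦ TangentSpace (𝓡 d) x) := ⟨g.toRiemannianMetric⟩
  have : FiniteDimensional ℝ (TangentSpace (𝓡 d) p) :=
    inferInstanceAs (FiniteDimensional ℝ (EuclideanSpace ℝ (Fin d)))
  have hfin : Module.finrank ℝ (TangentSpace (𝓡 d) p) = Fintype.card ι := by
    rw [hι]; exact finrank_euclideanSpace_fin
  have hon : Orthonormal ℝ (s.domRestrict v) := by
    rw [orthonormal_iff_ite]
    rintro ⟨i, hi⟩ ⟨j, hj⟩
    have := hv i hi j hj
    simp only [Set.domRestrict_apply, Subtype.mk.injEq]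
    exact this
  obtain ⟨b, hb⟩ := hon.exists_orthonormalBasis_extension_of_card_eq hfin
  refine ⟨b.toBasis, fun i j ↦ ?_, fun i hi ↦ by simpa using hb i hi⟩
  have := orthonormal_iff_ite.1 b.orthonormal i j
  simp only [OrthonormalBasis.coe_toBasis]
  exact this

end Chart

/-! ### Tangent vectors of a hypersurface -/

/-- The implicit function theorem for a scalar `C²` equation `F (y, s) = 0`, solved for `s`. -/
theorem exists_implicit_scalar {G : Type*} [NormedAddCommGroup G] [NormedSpace ℝ G] [CompleteSpace G]
    {F : G × ℝ → ℝ} {y₀ : G} {s₀ : ℝ} (hF : ContDiffAt ℝ 2 F (y₀, s₀)) (h0 : F (y₀, s₀) = 0)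
    (hs : fderiv ℝ F (y₀, s₀) (0, 1) ≠ 0) :
    ∃ φ : G → ℝ, ContDiffAt ℝ 2 φ y₀ ∧ φ y₀ = s₀ ∧ ∀ᶠ y in 𝓝 y₀, F (y, φ y) = 0 := by
  have hinv : (fderiv ℝ F (y₀, s₀) ∘L .inr ℝ G ℝ).IsInvertible := by
    refine ⟨ContinuousLinearEquiv.unitsEquivAut ℝ (Units.mk0 _ hs), ?_⟩
    ext
    simp
  refine ⟨hF.implicitFunction two_ne_zero hinv, hF.contDiffAt_implicitFunction two_ne_zero hinv,
    hF.implicitFunction_apply_self two_ne_zero hinv, ?_⟩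
  filter_upwards [hF.eventually_apply_implicitFunction two_ne_zero hinv] with y hy
  rw [hy, h0]

section Tangent

variable {d : ℕ} {M : Type*} [TopologicalSpace M] [ChartedSpace (EuclideanSpace ℝ (Fin d)) M]

theorem mem_tangentVectors_of_eventually {S : Set M} {γ : ℝ → M} {p : M} {v : TangentSpace (𝓡 d) p}
    (hγ : ContMDiffAt 𝓘(ℝ, ℝ) (𝓡 d) 1 γ 0) (hS : ∀ᶠ t in 𝓝 (0 : ℝ), γ t ∈ S) (h0 : γ 0 = p)
    (hv : curveVelocity γ 0 = (v : EuclideanSpace ℝ (Fin d))) : v ∈ tangentVectors S p := by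
  refine ⟨γ, hγ, hS, ?_⟩
  subst h0
  exact congrArg _ hv

theorem mfderiv_eq_zero_of_mem_tangentVectors {S U : Set M} {f : M → ℝ} (hU : IsOpen U)
    (hSU : S ∩ U = {q ∈ U | f q = 0}) {p : M} (hp : p ∈ U)
    (hf : MDifferentiableAt (𝓡 d) 𝓘(ℝ, ℝ) f p) {v : TangentSpace (𝓡 d) p}
    (hv : v ∈ tangentVectors S p) : mfderiv (𝓡 d) 𝓘(ℝ, ℝ) f p v = 0 := by
  obtain ⟨γ, hγ, hγS, he⟩ := hv
  rw [TotalSpace.mk.injEq] at he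
  obtain ⟨rfl, hv⟩ := he
  obtain rfl := eq_of_heq hv
  have h := hasDerivAt_comp_curve hf (hγ.mdifferentiableAt one_ne_zero)
  have hz : (fun s ↦ f (γ s)) =ᶠ[𝓝 0] fun _ ↦ 0 := by
    filter_upwards [hγS, hγ.continuousAt.preimage_mem_nhds (hU.mem_nhds hp)] with t ht1 ht2
    exact (hSU.subset ⟨ht1, ht2⟩ : γ t ∈ {q ∈ U | f q = 0}).2
  exact (h.congr_of_eventuallyEq hz.symm).unique (hasDerivAt_const _ _)

variable [IsManifold (𝓡 d) ∞ M]

/-- The vectors in the kernel of the differential of a defining function are tangent. -/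
theorem mem_tangentVectors_of_mfderiv_eq_zero {S U : Set M} {f : M → ℝ} (hU : IsOpen U)
    (hSU : S ∩ U = {q ∈ U | f q = 0}) {p : M} (hp : p ∈ U) (hpS : p ∈ S)
    (hf : ContMDiffAt (𝓡 d) 𝓘(ℝ, ℝ) 2 f p) (hdf : mfderiv (𝓡 d) 𝓘(ℝ, ℝ) f p ≠ 0)
    {v : TangentSpace (𝓡 d) p} (hv : mfderiv (𝓡 d) 𝓘(ℝ, ℝ) f p v = 0) :
    v ∈ tangentVectors S p := by
  have hfd : MDifferentiableAt (𝓡 d) 𝓘(ℝ, ℝ) f p := hf.mdifferentiableAt (by norm_num)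
  obtain ⟨ξ, hξ⟩ : ∃ ξ : EuclideanSpace ℝ (Fin d), mfderiv (𝓡 d) 𝓘(ℝ, ℝ) f p ξ ≠ 0 := by
    by_contra! h
    exact hdf (ContinuousLinearMap.ext fun ξ ↦ h ξ)
  set x₀ := extChartAt (𝓡 d) p p with hx₀
  have hp' : (extChartAt (𝓡 d) p).symm x₀ = p := extChartAt_to_inv p
  let v' : EuclideanSpace ℝ (Fin d) := v
  -- solve `f (p + t v + s ξ) = 0` for `s` in the chart
  let A : ℝ × ℝ →L[ℝ] EuclideanSpace ℝ (Fin d) :=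
    (ContinuousLinearMap.fst ℝ ℝ ℝ).smulRight v' + (ContinuousLinearMap.snd ℝ ℝ ℝ).smulRight ξ
  obtain ⟨fh, hfh⟩ : ∃ fh, fh = f ∘ (extChartAt (𝓡 d) p).symm := ⟨_, rfl⟩
  have hfc : ContDiffAt ℝ 2 fh x₀ :=
    hfh ▸ contDiffAt_comp_extChartAt_symm ENat.LEInfty.out (mem_extChartAt_target p)
      (by rw [hp']; exact hf)
  have hfv : ∀ x, fh x = f ((extChartAt (𝓡 d) p).symm x) := fun x ↦ by rw [hfh]; rfl
  have hfx := (hfc.differentiableAt (by norm_num)).hasFDerivAt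
  have hAx : HasFDerivAt (fun z : ℝ × ℝ ↦ x₀ + A z) A 0 := by
    simpa using A.hasFDerivAt.const_add x₀
  have hF : ContDiffAt ℝ 2 (fun z : ℝ × ℝ ↦ fh (x₀ + A z)) 0 := by
    refine ContDiffAt.comp (0 : ℝ × ℝ) (by simpa using hfc) ?_
    exact (contDiff_const.add A.contDiff).contDiffAt
  have hFd : HasFDerivAt (fun z : ℝ × ℝ ↦ fh (x₀ + A z))
      ((fderiv ℝ fh x₀).comp A) 0 :=
    HasFDerivAt.comp (0 : ℝ × ℝ) (by simpa using hfx) hAx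
  have hdir : ∀ w, fderiv ℝ fh x₀ w = mfderiv (𝓡 d) 𝓘(ℝ, ℝ) f p w :=
    fun w ↦ by rw [hfh]; exact fderiv_comp_extChartAt_symm_self hfd w
  have hf0 : f p = 0 := (hSU.subset ⟨hpS, hp⟩ : p ∈ {q ∈ U | f q = 0}).2
  obtain ⟨φ, hφ, hφ0, hφz⟩ := exists_implicit_scalar (F := fun z : ℝ × ℝ ↦
      fh (x₀ + A z)) (y₀ := (0 : ℝ)) (s₀ := (0 : ℝ)) hF
    (by
      have : A (0, 0) = 0 := map_zero A
      simp only [this, add_zero, hfv, hp', hf0]) (by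
      have : fderiv ℝ (fun z : ℝ × ℝ ↦ fh (x₀ + A z)) (0, 0) = _ :=
        hFd.fderiv
      have hA : A (0, 1) = ξ := by simp [A]
      rw [this, ContinuousLinearMap.comp_apply, hA, hdir]
      exact hξ)
  have hφd := (hφ.differentiableAt (by norm_num)).hasDerivAt
  have hφ' : deriv φ 0 = 0 := by
    have hg : HasDerivAt (fun t ↦ (t, φ t)) (1, deriv φ 0) 0 := (hasDerivAt_id 0).prodMk hφd
    have h1 : HasDerivAt (fun t ↦ fh (x₀ + A (t, φ t)))
        (((fderiv ℝ fh x₀).comp A) (1, deriv φ 0)) 0 := by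
      have hFd' : HasFDerivAt (fun z : ℝ × ℝ ↦ fh (x₀ + A z)) ((fderiv ℝ fh x₀).comp A)
          ((fun t ↦ (t, φ t)) 0) := by
        have e : ((0 : ℝ), φ 0) = (0 : ℝ × ℝ) := by rw [hφ0]; rfl
        change HasFDerivAt _ _ ((0 : ℝ), φ 0)
        rw [e]
        exact hFd
      exact HasFDerivAt.comp_hasDerivAt (l := fun z : ℝ × ℝ ↦ fh (x₀ + A z))
        (f := fun t ↦ (t, φ t)) (0 : ℝ) hFd' hg
    have h2 := (h1.congr_of_eventuallyEq (f₁ := fun _ ↦ (0 : ℝ))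
      (hφz.mono fun t ht ↦ ht.symm)).unique (hasDerivAt_const _ _)
    have h3 : fderiv ℝ fh x₀ v' = 0 := (hdir v').trans hv
    simp only [A, ContinuousLinearMap.comp_apply, add_apply,
      ContinuousLinearMap.smulRight_apply, ContinuousLinearMap.coe_fst',
      ContinuousLinearMap.coe_snd', map_add, map_smul, h3, smul_eq_mul, mul_zero, zero_add,
      hdir ξ] at h2
    exact (mul_eq_zero.1 h2).resolve_right hξ
  -- the curve obtained from the solution
  let c : ℝ → EuclideanSpace ℝ (Fin d) := fun t ↦ x₀ + A (t, φ t)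
  have hc0 : c 0 = x₀ := by
    have : A (0, 0) = 0 := map_zero A
    simp [c, hφ0, this]
  have hcd : HasDerivAt c v' 0 := by
    have hg : HasDerivAt (fun t ↦ (t, φ t)) (1, deriv φ 0) 0 := (hasDerivAt_id 0).prodMk hφd
    have := (A.hasFDerivAt.comp_hasDerivAt (0 : ℝ) hg).const_add x₀
    have e : A (1, deriv φ 0) = v' := by simp [A, hφ']
    rw [e] at this
    exact this
  have hcc : ContDiffAt ℝ 2 c 0 :=
    contDiffAt_const.add (A.contDiff.contDiffAt.comp (0 : ℝ) (contDiffAt_id.prodMk hφ))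
  have hsymm : ContMDiffAt 𝓘(ℝ, EuclideanSpace ℝ (Fin d)) (𝓡 d) 1 (extChartAt (𝓡 d) p).symm
      (c 0) := by
    rw [hc0]
    exact ((contMDiffOn_extChartAt_symm (n := ∞) (I := 𝓡 d) p).contMDiffAt
      (extChartAt_target_mem_nhds p)).of_le (by exact_mod_cast le_top)
  have hγ : ContMDiffAt 𝓘(ℝ, ℝ) (𝓡 d) 1 (fun t ↦ (extChartAt (𝓡 d) p).symm (c t)) 0 :=
    hsymm.comp (0 : ℝ) (hcc.of_le (by norm_num)).contMDiffAt
  refine mem_tangentVectors_of_eventually (γ := fun t ↦ (extChartAt (𝓡 d) p).symm (c t)) hγ ?_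
    (by simp only [hc0, hp']) ?_
  · simp only [hfv] at hφz
    have hUγ : ∀ᶠ t in 𝓝 (0 : ℝ), (extChartAt (𝓡 d) p).symm (c t) ∈ U :=
      hγ.continuousAt.preimage_mem_nhds (hU.mem_nhds (by simpa only [hc0, hp'] using hp))
    filter_upwards [hUγ, hφz] with t ht1 ht2
    exact (hSU.superset ⟨ht1, ht2⟩ : _ ∈ S ∩ U).1
  · have h := mfderiv_extChartAt_symm_comp_apply (p := p) hcd.hasFDerivAt
      (by rw [hc0]; exact mem_extChartAt_target p) 1
    have e : (extChartAt (𝓡 d) p).symm (c 0) = p := by rw [hc0, hp']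
    unfold curveVelocity
    refine h.trans ?_
    simp only [ContinuousLinearMap.toSpanSingleton_apply, one_smul]
    rw [e]
    exact chartField_self p v'

end Tangent

/-! ### Adapted connections -/

section Chart

variable {d : ℕ} {M : Type*} [TopologicalSpace M] [ChartedSpace (EuclideanSpace ℝ (Fin d)) M]
  [IsManifold (𝓡 d) ∞ M]

theorem mdifferentiableAt_chartField {p q : M}
    (hq : q ∈ (chartAt (EuclideanSpace ℝ (Fin d)) p).source) (v : EuclideanSpace ℝ (Fin d)) :
    MDifferentiableAt (𝓡 d) (𝓡 d).tangent
      (fun q ↦ (⟨q, chartField p v q⟩ : TangentBundle (𝓡 d) M)) q :=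
  (contMDiffAt_chartField hq v).mdifferentiableAt (by simp)

theorem mpullbackWithin_extChartAt_symm_chartField {p : M} (v : EuclideanSpace ℝ (Fin d))
    {x : EuclideanSpace ℝ (Fin d)} (hx : x ∈ (extChartAt (𝓡 d) p).target) :
    VectorField.mpullbackWithin 𝓘(ℝ, EuclideanSpace ℝ (Fin d)) (𝓡 d) (extChartAt (𝓡 d) p).symm
      (chartField p v) (range (𝓡 d)) x = v := by
  have hs : (extChartAt (𝓡 d) p).symm x ∈ (chartAt (EuclideanSpace ℝ (Fin d)) p).source := by
    rw [← extChartAt_source (I := 𝓡 d)]; exact (extChartAt (𝓡 d) p).map_target hx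
  have h := hasMFDerivAt_extChartAt_symm hx
  let L : EuclideanSpace ℝ (Fin d) →L[ℝ] TangentSpace (𝓡 d) ((extChartAt (𝓡 d) p).symm x) :=
    (trivializationAt (EuclideanSpace ℝ (Fin d)) (TangentSpace (𝓡 d)) p).symmL ℝ
      ((extChartAt (𝓡 d) p).symm x)
  have hinv : L.inverse = chartCoord p ((extChartAt (𝓡 d) p).symm x) :=
    ContinuousLinearMap.inverse_eq
      (ContinuousLinearMap.ext fun w ↦ chartField_chartCoord hs w)
      (ContinuousLinearMap.ext fun w ↦ chartCoord_chartField hs w)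
  have e : mfderivWithin 𝓘(ℝ, EuclideanSpace ℝ (Fin d)) (𝓡 d) (extChartAt (𝓡 d) p).symm
      (range (𝓡 d)) x = L := by
    have hr : range (𝓡 d) = univ := by simp
    rw [hr, mfderivWithin_univ, h.mfderiv]
  rw [VectorField.mpullbackWithin_apply, e]
  exact (congrArg (fun A : TangentSpace (𝓡 d) ((extChartAt (𝓡 d) p).symm x) →L[ℝ]
    EuclideanSpace ℝ (Fin d) ↦ A (chartField p v _)) hinv).trans (chartCoord_chartField hs v)

/-- Coordinate fields commute. -/
theorem mlieBracket_chartField (p : M) (v w : EuclideanSpace ℝ (Fin d)) :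
    VectorField.mlieBracket (𝓡 d) (chartField p v) (chartField p w) p = 0 := by
  rw [← VectorField.mlieBracketWithin_univ, VectorField.mlieBracketWithin_apply]
  let F : EuclideanSpace ℝ (Fin d) → EuclideanSpace ℝ (Fin d) → EuclideanSpace ℝ (Fin d) :=
    fun v ↦ VectorField.mpullbackWithin 𝓘(ℝ, EuclideanSpace ℝ (Fin d)) (𝓡 d)
      (extChartAt (𝓡 d) p).symm (chartField p v) (range (𝓡 d))
  have hv : ∀ v : EuclideanSpace ℝ (Fin d), F v =ᶠ[𝓝 (extChartAt (𝓡 d) p p)] fun _ ↦ v := fun v ↦ by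
    filter_upwards [extChartAt_target_mem_nhds (I := 𝓡 d) p] with x hx
    exact mpullbackWithin_extChartAt_symm_chartField v hx
  have hz := (hv v).lieBracket_vectorField_eq (𝕜 := ℝ) (hv w)
  have h0 : VectorField.lieBracketWithin ℝ (F v) (F w)
      ((extChartAt (𝓡 d) p).symm ⁻¹' univ ∩ range (𝓡 d)) (extChartAt (𝓡 d) p p) = 0 := by
    have hu : (extChartAt (𝓡 d) p).symm ⁻¹' univ ∩ range (𝓡 d) = univ := by simp
    rw [hu, VectorField.lieBracketWithin_univ, hz]
    simp [VectorField.lieBracket]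
  exact (congrArg _ h0).trans (map_zero _)

/-- A connection depends only on the germ of the section, on which it is additive and satisfies
the Leibniz rule: its value on a combination of coordinate fields. -/
theorem CovariantDerivative.apply_eq_sum_chartField
    (D : CovariantDerivative (𝓡 d) (EuclideanSpace ℝ (Fin d)) (fun x : M ↦ TangentSpace (𝓡 d) x))
    {ι : Type*} [Fintype ι] {p : M} (b : ι → EuclideanSpace ℝ (Fin d)) {y : ι → M → ℝ}
    (hy : ∀ i, MDifferentiableAt (𝓡 d) 𝓘(ℝ, ℝ) (y i) p)
    {Y : (q : M) → TangentSpace (𝓡 d) q}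
    (hYd : MDifferentiableAt (𝓡 d) (𝓡 d).tangent (fun q ↦ (⟨q, Y q⟩ : TangentBundle (𝓡 d) M)) p)
    (hY : ∀ᶠ q in 𝓝 p, Y q = ∑ i, y i q • chartField p (b i) q) (u : TangentSpace (𝓡 d) p) :
    D Y p u = ∑ i, (y i p • D (chartField p (b i)) p u +
      mvfderiv (𝓡 d) (y i) p u • chartField p (b i) p) := by
  have key : ∀ s : Finset ι, MDifferentiableAt (𝓡 d) (𝓡 d).tangent
      (fun q ↦ (⟨q, (∑ i ∈ s, y i • chartField p (b i)) q⟩ : TangentBundle (𝓡 d) M)) p ∧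
      D (∑ i ∈ s, y i • chartField p (b i)) p u = ∑ i ∈ s, (y i p • D (chartField p (b i)) p u +
      mvfderiv (𝓡 d) (y i) p u • chartField p (b i) p) := by
    classical
    intro s
    induction s using Finset.induction_on with
    | empty =>
      refine ⟨?_, ?_⟩
      · simp only [Finset.sum_empty]
        exact mdifferentiableAt_zeroSection ..
      · simp [CovariantDerivative.zero]
    | insert a s ha ih =>
      have hsm : MDifferentiableAt (𝓡 d) (𝓡 d).tangent
          (fun q ↦ (⟨q, (y a • chartField p (b a)) q⟩ : TangentBundle (𝓡 d) M)) p :=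
        (hy a).smul_section (mdifferentiableAt_chartField (mem_chart_source _ p) (b a))
      refine ⟨?_, ?_⟩
      · rw [Finset.sum_insert ha]
        exact mdifferentiableAt_add_section hsm ih.1
      · rw [Finset.sum_insert ha, Finset.sum_insert ha,
          D.isCovariantDerivativeOn.add hsm ih.1 (mem_univ p),
          D.isCovariantDerivativeOn.leibniz
            (mdifferentiableAt_chartField (mem_chart_source _ p) (b a)) (hy a) (mem_univ p),
          add_apply, ih.2]
        rfl
  rw [← (key Finset.univ).2]
  refine congrArg (fun L ↦ L u) (D.isCovariantDerivativeOn.congr_of_eventuallyEq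
    (s := univ) hYd (key Finset.univ).1 univ_mem ?_)
  filter_upwards [hY] with q hq
  rw [hq]
  simp
end Chart

section Tangent

variable {d : ℕ} {M : Type*} [TopologicalSpace M] [ChartedSpace (EuclideanSpace ℝ (Fin d)) M]

/-- A function that vanishes on `S` near `p` has vanishing derivative along `S` at `p`. -/
theorem mfderiv_eq_zero_of_eventually_of_mem_tangentVectors {S : Set M} {f : M → ℝ} {p : M}
    (hf : MDifferentiableAt (𝓡 d) 𝓘(ℝ, ℝ) f p) (h0 : ∀ᶠ q in 𝓝 p, q ∈ S → f q = 0)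
    {v : TangentSpace (𝓡 d) p} (hv : v ∈ tangentVectors S p) :
    mfderiv (𝓡 d) 𝓘(ℝ, ℝ) f p v = 0 := by
  obtain ⟨γ, hγ, hγS, he⟩ := hv
  rw [TotalSpace.mk.injEq] at he
  obtain ⟨rfl, hv⟩ := he
  obtain rfl := eq_of_heq hv
  have h := hasDerivAt_comp_curve hf (hγ.mdifferentiableAt one_ne_zero)
  have hz : (fun s ↦ f (γ s)) =ᶠ[𝓝 0] fun _ ↦ 0 := by
    filter_upwards [hγS, hγ.continuousAt.eventually h0] with t ht1 ht2 using ht2 ht1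
  exact (h.congr_of_eventuallyEq hz.symm).unique (hasDerivAt_const _ _)

variable [IsManifold (𝓡 d) ∞ M]

theorem contMDiffAt_chartCoord_of_mem {n : ℕ∞ω} (hn : n ≤ ∞)
    {X : (q : M) → TangentSpace (𝓡 d) q} {p q : M}
    (hq : q ∈ (chartAt (EuclideanSpace ℝ (Fin d)) p).source)
    (hX : ContMDiffAt (𝓡 d) (𝓡 d).tangent n (fun q ↦ (⟨q, X q⟩ : TangentBundle (𝓡 d) M)) q) :
    ContMDiffAt (𝓡 d) 𝓘(ℝ, EuclideanSpace ℝ (Fin d)) n (fun q ↦ chartCoord p q (X q)) q := by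
  have : ContMDiffVectorBundle n (EuclideanSpace ℝ (Fin d)) (TangentSpace (𝓡 d) : M → Type _)
    (𝓡 d) := ContMDiffVectorBundle.of_le (n := ∞) hn
  have h := (trivializationAt (EuclideanSpace ℝ (Fin d)) (TangentSpace (𝓡 d) (M := M))
    p).contMDiffAt_section_iff (IB := 𝓡 d) (n := n) (s := X) (by simpa using hq)
  refine (h.1 hX).congr_of_eventuallyEq ?_
  filter_upwards [(chartAt (EuclideanSpace ℝ (Fin d)) p).open_source.mem_nhds hq] with q hq
  simp only [chartCoord, Trivialization.continuousLinearMapAt_apply]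
  rw [Trivialization.linearMapAt_apply, if_pos (by simpa using hq)]

theorem contMDiffAt_chartCoord {n : ℕ∞ω} (hn : n ≤ ∞) {X : (q : M) → TangentSpace (𝓡 d) q} {p : M}
    (hX : ContMDiffAt (𝓡 d) (𝓡 d).tangent n (fun q ↦ (⟨q, X q⟩ : TangentBundle (𝓡 d) M)) p) :
    ContMDiffAt (𝓡 d) 𝓘(ℝ, EuclideanSpace ℝ (Fin d)) n (fun q ↦ chartCoord p q (X q)) p :=
  contMDiffAt_chartCoord_of_mem hn (mem_chart_source _ p) hX

/-- Every tangent vector is the value of a smooth vector field. -/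
theorem exists_contMDiff_vectorField [T2Space M] (p : M) (u : TangentSpace (𝓡 d) p) :
    ∃ X : (q : M) → TangentSpace (𝓡 d) q,
      ContMDiff (𝓡 d) (𝓡 d).tangent ∞ (fun q ↦ (⟨q, X q⟩ : TangentBundle (𝓡 d) M)) ∧ X p = u := by
  obtain ⟨χ⟩ : Nonempty (SmoothBumpFunction (𝓡 d) p) := inferInstance
  refine ⟨(χ : M → ℝ) • chartField p u, ?_, ?_⟩
  · refine ContMDiffOn.smul_section_of_tsupport (u := (chartAt (EuclideanSpace ℝ (Fin d)) p).source)
      χ.contMDiff.contMDiffOn (chartAt _ p).open_source χ.tsupport_subset_chartAt_source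
      fun q hq ↦ (contMDiffAt_chartField hq u).contMDiffWithinAt
  · have : χ p = 1 := χ.eq_one
    simp only [Pi.smul_apply', this, one_smul]
    exact chartField_self p u

end Tangent

namespace VRStructure

variable {k m : ℕ} {M : Type*} [TopologicalSpace M]
  [ChartedSpace (EuclideanSpace ℝ (Fin (k + m + 1))) M] [IsManifold (𝓡 (k + m + 1)) ∞ M]
  (V : VRStructure k m M)

theorem inner_comm (p : M) (u v : TangentSpace (𝓡 (k + m + 1)) p) :
    V.metric.inner p u v = V.metric.inner p v u := V.metric.symm p u v

theorem inner_sum_smul_T (p : M) (c : Fin m → ℝ) (j : Fin m) :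
    V.metric.inner p (∑ i, c i • V.T i p) (V.T j p) = c j := by
  simp [map_sum, V.orthonormal_T, sum_apply]

theorem horizontalPart_mem (p : M) (v : TangentSpace (𝓡 (k + m + 1)) p) :
    V.horizontalPart p v ∈ V.horizontal p := by
  intro j
  simp only [horizontalPart, map_sub, sub_apply, V.inner_sum_smul_T, sub_self]

theorem horizontalPart_of_mem {p : M} {v : TangentSpace (𝓡 (k + m + 1)) p}
    (hv : v ∈ V.horizontal p) : V.horizontalPart p v = v := by
  simp only [horizontalPart, hv _, zero_smul, Finset.sum_const_zero, sub_zero]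

theorem inner_of_mem_vertical {p : M} {u v : TangentSpace (𝓡 (k + m + 1)) p}
    (hu : u ∈ V.horizontal p) (hv : v ∈ V.vertical p) : V.metric.inner p u v = 0 := by
  refine Submodule.span_induction (p := fun v _ ↦ V.metric.inner p u v = 0) ?_ ?_ ?_ ?_ hv
  · rintro _ ⟨j, rfl⟩; exact hu j
  · exact map_zero _
  · intro x y _ _ hx hy; rw [map_add, hx, hy, add_zero]
  · intro c x _ hx; rw [map_smul, hx, smul_zero]

theorem contMDiffAt_horizontalPart {n : ℕ∞ω} (hn : n ≤ ∞)
    {X : (q : M) → TangentSpace (𝓡 (k + m + 1)) q} {p : M}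
    (hX : ContMDiffAt (𝓡 (k + m + 1)) (𝓡 (k + m + 1)).tangent n
      (fun q ↦ (⟨q, X q⟩ : TangentBundle (𝓡 (k + m + 1)) M)) p) :
    ContMDiffAt (𝓡 (k + m + 1)) (𝓡 (k + m + 1)).tangent n
      (fun q ↦ (⟨q, V.horizontalPart q (X q)⟩ : TangentBundle (𝓡 (k + m + 1)) M)) p := by
  refine hX.sub_section (ContMDiffAt.sum_section fun j _ ↦ ?_)
  have hT : ContMDiffAt (𝓡 (k + m + 1)) (𝓡 (k + m + 1)).tangent n
      (fun q ↦ (⟨q, V.T j q⟩ : TangentBundle (𝓡 (k + m + 1)) M)) p :=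
    (V.contMDiff_T j).contMDiffAt.of_le hn
  exact (contMDiffAt_metric_inner V.metric hn hX hT).smul_section hT

theorem mdifferentiableAt_T (j : Fin m) (p : M) :
    MDifferentiableAt (𝓡 (k + m + 1)) (𝓡 (k + m + 1)).tangent
      (fun q ↦ (⟨q, V.T j q⟩ : TangentBundle (𝓡 (k + m + 1)) M)) p :=
  (V.contMDiff_T j).contMDiffAt.mdifferentiableAt (by simp)

variable {V} {D : CovariantDerivative (𝓡 (k + m + 1)) (EuclideanSpace ℝ (Fin (k + m + 1)))
      (fun x : M ↦ TangentSpace (𝓡 (k + m + 1)) x)}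

/-- Differentiating a constant inner product. -/
theorem IsMetricConnection.inner_add_eq_zero (hD : V.IsMetricConnection D) {p : M}
    {X Y : (q : M) → TangentSpace (𝓡 (k + m + 1)) q}
    (hX : MDifferentiableAt (𝓡 (k + m + 1)) (𝓡 (k + m + 1)).tangent
      (fun q ↦ (⟨q, X q⟩ : TangentBundle (𝓡 (k + m + 1)) M)) p)
    (hY : MDifferentiableAt (𝓡 (k + m + 1)) (𝓡 (k + m + 1)).tangent
      (fun q ↦ (⟨q, Y q⟩ : TangentBundle (𝓡 (k + m + 1)) M)) p) {c : ℝ}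
    (hc : ∀ᶠ q in 𝓝 p, V.metric.inner q (X q) (Y q) = c) (u : TangentSpace (𝓡 (k + m + 1)) p) :
    V.metric.inner p (D X p u) (Y p) + V.metric.inner p (X p) (D Y p u) = 0 := by
  rw [← hD p X Y hX hY u]
  have h : (fun q ↦ V.metric.inner q (X q) (Y q)) =ᶠ[𝓝 p] fun _ ↦ c := hc
  rw [h.mfderiv_eq, mfderiv_const]
  rfl

/-- Vertical rigidity, as a property of the torsion of an adapted connection. -/
theorem IsAdapted.inner_torsion_T [T2Space M] (hD : V.IsAdapted D) {p : M}
    {u : TangentSpace (𝓡 (k + m + 1)) p} (hu : u ∈ V.horizontal p) (j : Fin m) :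
    V.metric.inner p (D.torsion p u (V.T j p)) (V.T j p) = 0 := by
  obtain ⟨X₀, hX₀, hX₀p⟩ := exists_contMDiff_vectorField p u
  let X : (q : M) → TangentSpace (𝓡 (k + m + 1)) q := fun q ↦ V.horizontalPart q (X₀ q)
  have hX : ContMDiff (𝓡 (k + m + 1)) (𝓡 (k + m + 1)).tangent ∞
      (fun q ↦ (⟨q, X q⟩ : TangentBundle (𝓡 (k + m + 1)) M)) := fun q ↦
    V.contMDiffAt_horizontalPart le_rfl hX₀.contMDiffAt
  have hXp : X p = u := by
    change V.horizontalPart p (X₀ p) = u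
    rw [hX₀p, V.horizontalPart_of_mem hu]
  have hXd := hX.contMDiffAt.mdifferentiableAt (x := p) (by simp)
  have hXT : ∀ q i, V.metric.inner q (X q) (V.T i q) = 0 := fun q i ↦
    V.horizontalPart_mem q (X₀ q) i
  have h1 := hD.metric.inner_add_eq_zero hXd (V.mdifferentiableAt_T j p)
    (.of_forall fun q ↦ hXT q j) (V.T j p)
  rw [hD.parallel_T, zero_apply, map_zero, add_zero] at h1
  have h2 := V.bracket_rigid X hX hXT j j (V.rel.refl j) p
  have h3 := D.torsion_apply hXd (V.mdifferentiableAt_T j p)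
  rw [hXp] at h3
  rw [h3, hD.parallel_T, zero_apply, zero_sub, map_sub, map_neg, sub_apply, neg_apply, h1, h2,
    neg_zero, sub_zero]

/-- The divergence of a vector field with coordinates `y^A`, in terms of a metric connection. The
left-hand side is `ρ⁻¹ ∑ ∂_A (ρ y^A)` at the centre of the chart, where the coordinate basis is
orthonormal and `ρ = √det (g_AB)` is the Riemannian volume density. -/
theorem IsMetricConnection.divergence_eq {ι : Type*} [Fintype ι] [DecidableEq ι]
    (hD : V.IsMetricConnection D) {p : M}
    (b : Module.Basis ι ℝ (TangentSpace (𝓡 (k + m + 1)) p))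
    (hb : ∀ i j, V.metric.inner p (b i) (b j) = if i = j then 1 else 0)
    {Y : (q : M) → TangentSpace (𝓡 (k + m + 1)) q}
    (hY : ContMDiffAt (𝓡 (k + m + 1)) (𝓡 (k + m + 1)).tangent 1
      (fun q ↦ (⟨q, Y q⟩ : TangentBundle (𝓡 (k + m + 1)) M)) p) :
    ∑ i, (mvfderiv (𝓡 (k + m + 1)) (fun q ↦ b.repr (chartCoord p q (Y q)) i) p (b i) +
      2⁻¹ * mvfderiv (𝓡 (k + m + 1))
        (fun q ↦ V.metric.inner q (chartField p (b i) q) (chartField p (b i) q)) p (Y p)) =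
    ∑ i, (V.metric.inner p (D Y p (b i)) (b i) + V.metric.inner p (D.torsion p (Y p) (b i)) (b i)) := by
  -- the basis vectors, as coordinate vectors
  let c : ι → EuclideanSpace ℝ (Fin (k + m + 1)) := fun i ↦ b i
  have hcp : ∀ i, chartField p (c i) p = b i := fun i ↦ chartField_self p (c i)
  let y : ι → M → ℝ := fun i q ↦ b.repr (chartCoord p q (Y q)) i
  have hYd := hY.mdifferentiableAt one_ne_zero
  have hy : ∀ i, MDifferentiableAt (𝓡 (k + m + 1)) 𝓘(ℝ, ℝ) (y i) p := fun i ↦ by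
    have : FiniteDimensional ℝ (TangentSpace (𝓡 (k + m + 1)) p) :=
      inferInstanceAs (FiniteDimensional ℝ (EuclideanSpace ℝ (Fin (k + m + 1))))
    let ℓ : EuclideanSpace ℝ (Fin (k + m + 1)) →L[ℝ] ℝ := LinearMap.toContinuousLinearMap (b.coord i)
    exact (ℓ.contMDiff (n := 1)).contMDiffAt.comp p (contMDiffAt_chartCoord (by norm_num) hY)
      |>.mdifferentiableAt one_ne_zero
  have hC : ∀ v : EuclideanSpace ℝ (Fin (k + m + 1)),
      MDifferentiableAt (𝓡 (k + m + 1)) (𝓡 (k + m + 1)).tangent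
      (fun q ↦ (⟨q, chartField p v q⟩ : TangentBundle (𝓡 (k + m + 1)) M)) p := fun v ↦
    mdifferentiableAt_chartField (mem_chart_source _ p) v
  have hsum : ∀ q ∈ (chartAt (EuclideanSpace ℝ (Fin (k + m + 1))) p).source,
      Y q = ∑ i, y i q • chartField p (c i) q := fun q hq ↦ by
    have h1 : chartCoord p q (Y q) = ∑ i, y i q • c i :=
      (b.sum_repr (chartCoord p q (Y q))).symm
    rw [← chartField_chartCoord hq (Y q), h1, chartField_sum]
    simp only [chartField_smul]
  have hDY : ∀ u, D Y p u = ∑ i, (y i p • D (chartField p (c i)) p u +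
      mvfderiv (𝓡 (k + m + 1)) (y i) p u • b i) := fun u ↦ by
    rw [CovariantDerivative.apply_eq_sum_chartField D c hy hYd
      ((chartAt _ p).open_source.mem_nhds (mem_chart_source _ p) |> fun h ↦
        Filter.mem_of_superset h hsum) u]
    exact Finset.sum_congr rfl fun i _ ↦ by rw [hcp]
  have hYp : Y p = ∑ i, y i p • b i := by
    rw [hsum p (mem_chart_source _ p)]
    exact Finset.sum_congr rfl fun i _ ↦ by rw [hcp]
  have htor : ∀ i j, D.torsion p (b i) (b j) =
      D (chartField p (c j)) p (b i) - D (chartField p (c i)) p (b j) := fun i j ↦ by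
    have h := D.torsion_apply (hC (c i)) (hC (c j))
    rwa [mlieBracket_chartField, sub_zero, hcp, hcp] at h
  have hmet : ∀ i u, mvfderiv (𝓡 (k + m + 1))
        (fun q ↦ V.metric.inner q (chartField p (c i) q) (chartField p (c i) q)) p u =
      2 * V.metric.inner p (D (chartField p (c i)) p u) (b i) := fun i u ↦ by
    have h : mvfderiv (𝓡 (k + m + 1))
        (fun q ↦ V.metric.inner q (chartField p (c i) q) (chartField p (c i) q)) p u = _ :=
      hD p _ _ (hC (c i)) (hC (c i)) u
    rw [V.inner_comm p (chartField p (c i) p), ← two_mul, hcp] at h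
    exact h
  change ∑ i, (mvfderiv (𝓡 (k + m + 1)) (y i) p (b i) + 2⁻¹ * mvfderiv (𝓡 (k + m + 1))
    (fun q ↦ V.metric.inner q (chartField p (c i) q) (chartField p (c i) q)) p (Y p)) = _
  refine (Finset.sum_congr rfl fun i _ ↦ ?_).trans (b := ∑ i,
    (mvfderiv (𝓡 (k + m + 1)) (y i) p (b i) +
      ∑ j, y j p * V.metric.inner p (D (chartField p (c i)) p (b j)) (b i))) ?_
  · rw [hmet, hYp, map_sum, map_sum, sum_apply]
    simp only [map_smul, smul_apply, smul_eq_mul]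
    ring
  · have e1 : ∀ i, V.metric.inner p (D Y p (b i)) (b i) =
        (∑ j, y j p * V.metric.inner p (D (chartField p (c j)) p (b i)) (b i)) +
          mvfderiv (𝓡 (k + m + 1)) (y i) p (b i) := fun i ↦ by
      rw [hDY, map_sum, sum_apply]
      simp only [map_add, map_smul, add_apply, smul_apply, smul_eq_mul, Finset.sum_add_distrib, hb]
      simp
    have e2 : ∀ i, V.metric.inner p (D.torsion p (Y p) (b i)) (b i) =
        ∑ j, y j p * (V.metric.inner p (D (chartField p (c i)) p (b j)) (b i) -
          V.metric.inner p (D (chartField p (c j)) p (b i)) (b i)) := fun i ↦ by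
      have e3 : D.torsion p (Y p) (b i) = ∑ j, y j p • D.torsion p (b j) (b i) := by
        rw [hYp, map_sum, sum_apply]
        exact Finset.sum_congr rfl fun j _ ↦ by rw [map_smul]; rfl
      rw [e3, map_sum, sum_apply]
      refine Finset.sum_congr rfl fun j _ ↦ ?_
      rw [map_smul, htor, map_sub]
      rfl
    refine Finset.sum_congr rfl fun i _ ↦ ?_
    rw [e1, e2]
    simp only [mul_sub, Finset.sum_sub_distrib]
    ring
end VRStructure

namespace VRStructure

variable {k m : ℕ} {M : Type*} [TopologicalSpace M]
  [ChartedSpace (EuclideanSpace ℝ (Fin (k + m + 1))) M] [IsManifold (𝓡 (k + m + 1)) ∞ M]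
  {V : VRStructure k m M}
  {D : CovariantDerivative (𝓡 (k + m + 1)) (EuclideanSpace ℝ (Fin (k + m + 1)))
      (fun x : M ↦ TangentSpace (𝓡 (k + m + 1)) x)}

/-- Fields that agree on `S` have the same covariant derivatives along `S`. -/
theorem IsMetricConnection.inner_eq_of_eqOn (hD : V.IsMetricConnection D) {S : Set M} {p : M}
    {X Y : (q : M) → TangentSpace (𝓡 (k + m + 1)) q}
    (hX : MDifferentiableAt (𝓡 (k + m + 1)) (𝓡 (k + m + 1)).tangent
      (fun q ↦ (⟨q, X q⟩ : TangentBundle (𝓡 (k + m + 1)) M)) p)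
    (hY : MDifferentiableAt (𝓡 (k + m + 1)) (𝓡 (k + m + 1)).tangent
      (fun q ↦ (⟨q, Y q⟩ : TangentBundle (𝓡 (k + m + 1)) M)) p)
    (hXY : ∀ᶠ q in 𝓝 p, q ∈ S → X q = Y q) (hpS : p ∈ S)
    {u : TangentSpace (𝓡 (k + m + 1)) p} (hu : u ∈ tangentVectors S p)
    (w : TangentSpace (𝓡 (k + m + 1)) p) :
    V.metric.inner p (D X p u) w = V.metric.inner p (D Y p u) w := by
  let c : EuclideanSpace ℝ (Fin (k + m + 1)) := w
  have hcp : chartField p c p = w := chartField_self p c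
  have hC := mdifferentiableAt_chartField (mem_chart_source _ p) c
  have hfX := mdifferentiableAt_metric_inner V.metric hX hC
  have hfY := mdifferentiableAt_metric_inner V.metric hY hC
  have h0 : mvfderiv (𝓡 (k + m + 1)) (fun q ↦ V.metric.inner q (X q) (chartField p c q)) p u =
      mvfderiv (𝓡 (k + m + 1)) (fun q ↦ V.metric.inner q (Y q) (chartField p c q)) p u := by
    have h1 : mfderiv (𝓡 (k + m + 1)) 𝓘(ℝ, ℝ) ((fun q ↦ V.metric.inner q (X q) (chartField p c q)) -
        fun q ↦ V.metric.inner q (Y q) (chartField p c q)) p u = 0 := by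
      refine mfderiv_eq_zero_of_eventually_of_mem_tangentVectors (hfX.sub hfY) ?_ hu
      filter_upwards [hXY] with q hq hqS
      simp [hq hqS]
    rw [mfderiv_sub hfX hfY] at h1
    exact sub_eq_zero.1 h1
  have hx : mvfderiv (𝓡 (k + m + 1)) (fun q ↦ V.metric.inner q (X q) (chartField p c q)) p u = _ :=
    hD p X _ hX hC u
  have hy : mvfderiv (𝓡 (k + m + 1)) (fun q ↦ V.metric.inner q (Y q) (chartField p c q)) p u = _ :=
    hD p Y _ hY hC u
  rw [hx, hy, hXY.self_of_nhds hpS, hcp] at h0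
  exact add_right_cancel h0

/-- The horizontal mean curvature is the divergence of any horizontal unit field `Y` that extends
the horizontal normal of `S`. -/
theorem meanCurvature_eq_sum [T2Space M] (hD : V.IsAdapted D) {S : Set M} {p : M} (hpS : p ∈ S)
    {N Y : (q : M) → TangentSpace (𝓡 (k + m + 1)) q} {e : Fin k → TangentSpace (𝓡 (k + m + 1)) p}
    (hN : V.IsHorizontalNormalField S p N) (he : V.IsHorizontalTangentFrame S p e)
    (hY : ContMDiffAt (𝓡 (k + m + 1)) (𝓡 (k + m + 1)).tangent 1
      (fun q ↦ (⟨q, Y q⟩ : TangentBundle (𝓡 (k + m + 1)) M)) p)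
    (hY1 : ∀ᶠ q in 𝓝 p, V.metric.inner q (Y q) (Y q) = 1)
    (hYh : ∀ᶠ q in 𝓝 p, Y q ∈ V.horizontal q) (hYN : ∀ᶠ q in 𝓝 p, q ∈ S → Y q = N q)
    {b : Module.Basis (Unit ⊕ Fin (k + m)) ℝ (TangentSpace (𝓡 (k + m + 1)) p)}
    (hb0 : b (.inl ()) = N p) (hbe : ∀ i, b (.inr (Fin.castAdd m i)) = e i)
    (hbT : ∀ j, b (.inr (Fin.natAdd k j)) = V.T j p) :
    V.meanCurvature D p N e = ∑ i, (V.metric.inner p (D Y p (b i)) (b i) +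
      V.metric.inner p (D.torsion p (Y p) (b i)) (b i)) := by
  have hYd := hY.mdifferentiableAt one_ne_zero
  have hNd := hN.contMDiffAt.mdifferentiableAt one_ne_zero
  have hYp : Y p = N p := hYN.self_of_nhds hpS
  have hYhp := hYh.self_of_nhds
  have h0 : V.metric.inner p (D Y p (b (.inl ()))) (b (.inl ())) +
      V.metric.inner p (D.torsion p (Y p) (b (.inl ()))) (b (.inl ())) = 0 := by
    rw [hb0, ← hYp, D.torsion_self, map_zero, zero_apply, add_zero]
    have := hD.metric.inner_add_eq_zero hYd hYd hY1 (Y p)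
    rw [V.inner_comm p (Y p)] at this
    linarith
  have h1 : ∀ i : Fin k, V.metric.inner p (D Y p (b (.inr (Fin.castAdd m i))))
        (b (.inr (Fin.castAdd m i))) +
      V.metric.inner p (D.torsion p (Y p) (b (.inr (Fin.castAdd m i))))
        (b (.inr (Fin.castAdd m i))) = V.metric.inner p (D N p (e i)) (e i) := fun i ↦ by
    rw [hbe, V.inner_comm p (D.torsion p (Y p) (e i)), inner_of_mem_vertical V (he.mem_horizontal i)
      (hD.torsion p _ hYhp _ (he.mem_horizontal i)), add_zero]
    exact hD.metric.inner_eq_of_eqOn hYd hNd hYN hpS (he.mem_tangent i) _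
  have h2 : ∀ j : Fin m, V.metric.inner p (D Y p (b (.inr (Fin.natAdd k j))))
        (b (.inr (Fin.natAdd k j))) +
      V.metric.inner p (D.torsion p (Y p) (b (.inr (Fin.natAdd k j))))
        (b (.inr (Fin.natAdd k j))) = 0 := fun j ↦ by
    rw [hbT, hD.inner_torsion_T hYhp, add_zero]
    have := hD.metric.inner_add_eq_zero hYd (V.mdifferentiableAt_T j p)
      (hYh.mono fun q hq ↦ hq j) (V.T j p)
    rwa [hD.parallel_T, zero_apply, map_zero, add_zero] at this
  rw [Fintype.sum_sum_type, Fin.sum_univ_add]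
  simp only [Finset.univ_unique, Finset.sum_singleton]
  rw [Finset.sum_congr rfl fun i _ ↦ h1 i, Finset.sum_congr rfl fun j _ ↦ h2 j]
  rw [show (default : Unit) = () from rfl, h0, Finset.sum_const_zero, zero_add, add_zero]
  rfl

/-- Near a noncharacteristic point the horizontal unit normal extends to a `C¹` field that is
horizontal and of unit length off the hypersurface too. -/
theorem IsHorizontalNormalField.exists_unit_horizontal {S : Set M} {p : M} (hpS : p ∈ S)
    {N : (q : M) → TangentSpace (𝓡 (k + m + 1)) q} (hN : V.IsHorizontalNormalField S p N) :
    ∃ Y : (q : M) → TangentSpace (𝓡 (k + m + 1)) q,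
      (∀ᶠ q in 𝓝 p, ContMDiffAt (𝓡 (k + m + 1)) (𝓡 (k + m + 1)).tangent 1
        (fun q ↦ (⟨q, Y q⟩ : TangentBundle (𝓡 (k + m + 1)) M)) q) ∧
      (∀ᶠ q in 𝓝 p, V.metric.inner q (Y q) (Y q) = 1) ∧ (∀ᶠ q in 𝓝 p, Y q ∈ V.horizontal q) ∧
      ∀ᶠ q in 𝓝 p, q ∈ S → Y q = N q := by
  let N₀ : (q : M) → TangentSpace (𝓡 (k + m + 1)) q := fun q ↦ V.horizontalPart q (N q)
  let r : M → ℝ := fun q ↦ √(V.metric.inner q (N₀ q) (N₀ q))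
  have hN₀ := V.contMDiffAt_horizontalPart (by norm_num) hN.contMDiffAt
  have hin : ContMDiffAt (𝓡 (k + m + 1)) 𝓘(ℝ, ℝ) 1 (fun q ↦ V.metric.inner q (N₀ q) (N₀ q)) p :=
    contMDiffAt_metric_inner V.metric (by norm_num) hN₀ hN₀
  have hN₀S : ∀ᶠ q in 𝓝 p, q ∈ S → N₀ q = N q := hN.normal.mono fun q hq hqS ↦
    V.horizontalPart_of_mem (hq hqS).mem
  have hp1 : V.metric.inner p (N₀ p) (N₀ p) = 1 := by
    rw [hN₀S.self_of_nhds hpS]; exact (hN.normal.self_of_nhds hpS).unit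
  have hpos : ∀ᶠ q in 𝓝 p, 0 < V.metric.inner q (N₀ q) (N₀ q) :=
    hin.continuousAt.eventually (lt_mem_nhds (show 0 < V.metric.inner p (N₀ p) (N₀ p) by rw [hp1]; exact one_pos))
  have hr : ContMDiffAt (𝓡 (k + m + 1)) 𝓘(ℝ, ℝ) 1 (fun q ↦ (r q)⁻¹) p := by
    have h2 : ContDiffAt ℝ 1 (fun x : ℝ ↦ (√x)⁻¹) (V.metric.inner p (N₀ p) (N₀ p)) := by
      rw [hp1]
      exact (Real.contDiffAt_sqrt one_ne_zero).inv (by simp)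
    exact ContMDiffAt.comp (g := fun x : ℝ ↦ (√x)⁻¹) p h2.contMDiffAt hin
  refine ⟨fun q ↦ (r q)⁻¹ • N₀ q, ?_, ?_, ?_, ?_⟩
  · have : IsManifold (𝓡 (k + m + 1)) 1 M := IsManifold.of_le (n := ∞) (by norm_num)
    have : IsManifold (𝓡 (k + m + 1)) (1 + 1) M := IsManifold.of_le (n := ∞) (by
      rw [one_add_one_eq_two]; exact ENat.LEInfty.out)
    exact (contMDiffAt_iff_contMDiffAt_nhds (by simp)).1 (hr.smul_section hN₀)
  · filter_upwards [hpos] with q hq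
    have h3 : r q * r q = V.metric.inner q (N₀ q) (N₀ q) := Real.mul_self_sqrt hq.le
    have h4 : r q ≠ 0 := (Real.sqrt_pos.2 hq).ne'
    rw [map_smul, map_smul, smul_apply, ← h3]
    simp only [smul_eq_mul]
    field_simp
  · exact .of_forall fun q ↦ Submodule.smul_mem _ _ (V.horizontalPart_mem q (N q))
  · filter_upwards [hN₀S, hN.normal] with q hq hq2 hqS
    have h5 : r q = 1 := by
      change √(V.metric.inner q (N₀ q) (N₀ q)) = 1
      rw [hq hqS, (hq2 hqS).unit, Real.sqrt_one]
    rw [h5, inv_one, one_smul, hq hqS]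

end VRStructure

/-! ### The horizontal area density of a graph -/

namespace VRStructure

variable {k m : ℕ} {M : Type*} [TopologicalSpace M]
  [ChartedSpace (EuclideanSpace ℝ (Fin (k + m + 1))) M] [IsManifold (𝓡 (k + m + 1)) ∞ M]
  (V : VRStructure k m M)

/-- The Gram matrix of tangent vectors at `q`. -/
def gramMatrix (q : M) {ι : Type*} (v : ι → TangentSpace (𝓡 (k + m + 1)) q) : Matrix ι ι ℝ :=
  Matrix.of fun i j ↦ V.metric.inner q (v i) (v j)

/-- The density of the horizontal perimeter for the tangent frame `w` at `q`. -/
def areaAt (q : M) (w : Fin (k + m) → TangentSpace (𝓡 (k + m + 1)) q) : ℝ :=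
  √(V.gramMatrix q w).det *
    sSup {r : ℝ | ∃ ν : TangentSpace (𝓡 (k + m + 1)) q,
      V.metric.inner q ν ν = 1 ∧ (∀ i, V.metric.inner q ν (w i) = 0) ∧
      r = √(V.metric.inner q (V.horizontalPart q ν) (V.horizontalPart q ν))}

theorem perimeterDensity_eq_areaAt (ψ : EuclideanSpace ℝ (Fin (k + m)) → M)
    (y : EuclideanSpace ℝ (Fin (k + m))) :
    V.perimeterDensity ψ y = V.areaAt (ψ y) fun i ↦
      mfderiv (𝓡 (k + m)) (𝓡 (k + m + 1)) ψ y (EuclideanSpace.single i (1 : ℝ)) := rfl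

omit [IsManifold (𝓡 (k + m + 1)) ∞ M] in
theorem finrank_tangentSpace (q : M) :
    Module.finrank ℝ (TangentSpace (𝓡 (k + m + 1)) q) = k + m + 1 :=
  finrank_euclideanSpace_fin (𝕜 := ℝ) (n := k + m + 1)

omit [IsManifold (𝓡 (k + m + 1)) ∞ M] in
theorem finiteDimensional_tangentSpace (q : M) :
    FiniteDimensional ℝ (TangentSpace (𝓡 (k + m + 1)) q) :=
  inferInstanceAs (FiniteDimensional ℝ (EuclideanSpace ℝ (Fin (k + m + 1))))

variable {V} {q : M} {w : Fin (k + m) → TangentSpace (𝓡 (k + m + 1)) q}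

theorem areaAt_eq_sqrt (hw : LinearIndependent ℝ w) :
    V.areaAt q w = √((V.gramMatrix q w).det -
      ∑ j, (V.gramMatrix q (Sum.elim (fun _ : Unit ↦ V.T j q) w)).det) := by
  let : RiemannianBundle (fun x : M ↦ TangentSpace (𝓡 (k + m + 1)) x) :=
    ⟨V.metric.toRiemannianMetric⟩
  have := finiteDimensional_tangentSpace (k := k) (m := m) q
  exact horizontalArea_eq_sqrt (F := TangentSpace (𝓡 (k + m + 1)) q) (finrank_tangentSpace q) hw
    (orthonormal_iff_ite.2 (V.orthonormal_T q))

theorem sqrt_det_gramMatrix_le_areaAt (hw : LinearIndependent ℝ w)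
    {Y : TangentSpace (𝓡 (k + m + 1)) q} (hY : V.metric.inner q Y Y = 1)
    (hYh : Y ∈ V.horizontal q) :
    √(V.gramMatrix q (Sum.elim (fun _ : Unit ↦ Y) w)).det ≤ V.areaAt q w := by
  let : RiemannianBundle (fun x : M ↦ TangentSpace (𝓡 (k + m + 1)) x) :=
    ⟨V.metric.toRiemannianMetric⟩
  have := finiteDimensional_tangentSpace (k := k) (m := m) q
  have hY' : ‖Y‖ = 1 := by
    have h : inner ℝ Y Y = 1 := hY
    rw [real_inner_self_eq_norm_sq] at h
    exact (pow_eq_one_iff_of_nonneg (norm_nonneg Y) two_ne_zero).1 h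
  exact sqrt_det_gram_le_horizontalArea (F := TangentSpace (𝓡 (k + m + 1)) q)
    (T := fun j ↦ V.T j q) (finrank_tangentSpace q) hw hY' hYh

theorem areaAt_eq_sqrt_det_gramMatrix (hw : LinearIndependent ℝ w)
    {Y : TangentSpace (𝓡 (k + m + 1)) q} (hY : V.metric.inner q Y Y = 1)
    (hYh : Y ∈ V.horizontal q)
    (horth : ∀ c : Fin (k + m) → ℝ, ∑ i, c i • w i ∈ V.horizontal q →
      V.metric.inner q Y (∑ i, c i • w i) = 0) :
    V.areaAt q w = √(V.gramMatrix q (Sum.elim (fun _ : Unit ↦ Y) w)).det := by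
  let : RiemannianBundle (fun x : M ↦ TangentSpace (𝓡 (k + m + 1)) x) :=
    ⟨V.metric.toRiemannianMetric⟩
  have := finiteDimensional_tangentSpace (k := k) (m := m) q
  have hY' : ‖Y‖ = 1 := by
    have h : inner ℝ Y Y = 1 := hY
    rw [real_inner_self_eq_norm_sq] at h
    exact (pow_eq_one_iff_of_nonneg (norm_nonneg Y) two_ne_zero).1 h
  exact horizontalArea_eq_sqrt_det_gram (F := TangentSpace (𝓡 (k + m + 1)) q)
    (T := fun j ↦ V.T j q) (finrank_tangentSpace q) hw
    (orthonormal_iff_ite.2 (V.orthonormal_T q)) hY' hYh horth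

theorem det_gramMatrix_graph {n : ℕ} (b : Unit ⊕ Fin n → TangentSpace (𝓡 (k + m + 1)) q) (a : ℝ)
    (c p : Fin n → ℝ) :
    (V.gramMatrix q (Sum.elim (fun _ : Unit ↦ a • b (.inl ()) + ∑ i, c i • b (.inr i))
      fun i ↦ b (.inr i) + p i • b (.inl ()))).det =
      (a - ∑ i, c i * p i) ^ 2 * (V.gramMatrix q b).det := by
  let : RiemannianBundle (fun x : M ↦ TangentSpace (𝓡 (k + m + 1)) x) :=
    ⟨V.metric.toRiemannianMetric⟩
  exact det_gram_graph (F := TangentSpace (𝓡 (k + m + 1)) q) b a c p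

theorem det_gramMatrix_pos {ι : Type*} [Fintype ι] [DecidableEq ι]
    {b : ι → TangentSpace (𝓡 (k + m + 1)) q} (hb : LinearIndependent ℝ b) :
    0 < (V.gramMatrix q b).det := by
  let : RiemannianBundle (fun x : M ↦ TangentSpace (𝓡 (k + m + 1)) x) :=
    ⟨V.metric.toRiemannianMetric⟩
  exact (Matrix.posDef_gram_of_linearIndependent (E := TangentSpace (𝓡 (k + m + 1)) q) hb).det_pos

/-- The horizontal area density depends continuously on the frame. -/
theorem continuousOn_areaAt {G : Type*} [TopologicalSpace G] {K : Set G} {q : G → M}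
    {w : Fin (k + m) → (y : G) → TangentSpace (𝓡 (k + m + 1)) (q y)}
    (hw : ∀ y ∈ K, LinearIndependent ℝ fun i ↦ w i y)
    (hww : ∀ i j, ContinuousOn (fun y ↦ V.metric.inner (q y) (w i y) (w j y)) K)
    (hTw : ∀ i j, ContinuousOn (fun y ↦ V.metric.inner (q y) (V.T i (q y)) (w j y)) K) :
    ContinuousOn (fun y ↦ V.areaAt (q y) fun i ↦ w i y) K := by
  have hdet : ∀ {ι : Type} [Fintype ι] [DecidableEq ι] (A : G → Matrix ι ι ℝ),
      (∀ i j, ContinuousOn (fun y ↦ A y i j) K) → ContinuousOn (fun y ↦ (A y).det) K :=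
    fun A hA ↦ (Continuous.matrix_det continuous_id).comp_continuousOn
      (continuousOn_pi.2 fun i ↦ continuousOn_pi.2 fun j ↦ hA i j)
  refine ContinuousOn.congr (f := fun y ↦ √((V.gramMatrix (q y) fun i ↦ w i y).det -
      ∑ j, (V.gramMatrix (q y) (Sum.elim (fun _ : Unit ↦ V.T j (q y)) fun i ↦ w i y)).det)) ?_
    fun y hy ↦ areaAt_eq_sqrt (hw y hy)
  refine ContinuousOn.sqrt ((hdet _ hww).sub (continuousOn_finsetSum _ fun j _ ↦ hdet _ ?_))
  rintro (a | a) (b | b)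
  · exact (continuousOn_const (c := (1 : ℝ))).congr fun y _ ↦ by
      simp [gramMatrix, V.orthonormal_T]
  · exact hTw j b
  · exact (hTw j a).congr fun y _ ↦ V.inner_comm _ _ _
  · exact hww a b

theorem linearIndependent_graph {n : ℕ} {E : Type*} [AddCommGroup E] [Module ℝ E]
    {b : Unit ⊕ Fin n → E} (hb : LinearIndependent ℝ b) (p : Fin n → ℝ) :
    LinearIndependent ℝ fun i ↦ b (.inr i) + p i • b (.inl ()) := by
  rw [Fintype.linearIndependent_iff] at hb ⊢
  intro c hc i
  refine hb (Sum.elim (fun _ ↦ ∑ i, c i * p i) c) ?_ (.inr i)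
  rw [← hc]
  simp [Fintype.sum_sum_type, Finset.sum_smul, Finset.sum_add_distrib, mul_smul, add_comm]

/-- The flux of a horizontal unit vector through a graph is at most the horizontal area. -/
theorem flux_le_areaAt {b : Unit ⊕ Fin (k + m) → TangentSpace (𝓡 (k + m + 1)) q}
    (hb : LinearIndependent ℝ b) (a : ℝ) (c p : Fin (k + m) → ℝ)
    {Y : TangentSpace (𝓡 (k + m + 1)) q} (hYb : Y = a • b (.inl ()) + ∑ i, c i • b (.inr i))
    (hY : V.metric.inner q Y Y = 1) (hYh : Y ∈ V.horizontal q) :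
    √(V.gramMatrix q b).det * (a - ∑ i, c i * p i) ≤
      V.areaAt q fun i ↦ b (.inr i) + p i • b (.inl ()) := by
  refine le_trans ?_ (sqrt_det_gramMatrix_le_areaAt (linearIndependent_graph hb p) hY hYh)
  rw [hYb, det_gramMatrix_graph, Real.sqrt_mul (sq_nonneg _), Real.sqrt_sq_eq_abs, mul_comm]
  exact mul_le_mul_of_nonneg_right (le_abs_self _) (Real.sqrt_nonneg _)

/-- The flux of the horizontal unit normal of a graph is the horizontal area. -/
theorem flux_eq_areaAt {b : Unit ⊕ Fin (k + m) → TangentSpace (𝓡 (k + m + 1)) q}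
    (hb : LinearIndependent ℝ b) (a : ℝ) (c p : Fin (k + m) → ℝ)
    {Y : TangentSpace (𝓡 (k + m + 1)) q} (hYb : Y = a • b (.inl ()) + ∑ i, c i • b (.inr i))
    (hY : V.metric.inner q Y Y = 1) (hYh : Y ∈ V.horizontal q)
    (horth : ∀ x : Fin (k + m) → ℝ, ∑ i, x i • (b (.inr i) + p i • b (.inl ())) ∈ V.horizontal q →
      V.metric.inner q Y (∑ i, x i • (b (.inr i) + p i • b (.inl ()))) = 0)
    (hpos : 0 ≤ a - ∑ i, c i * p i) :
    √(V.gramMatrix q b).det * (a - ∑ i, c i * p i) =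
      V.areaAt q fun i ↦ b (.inr i) + p i • b (.inl ()) := by
  rw [areaAt_eq_sqrt_det_gramMatrix (linearIndependent_graph hb p) hY hYh horth, hYb,
    det_gramMatrix_graph, Real.sqrt_mul (sq_nonneg _), Real.sqrt_sq hpos, mul_comm]

end VRStructure

/-! ### Graphs in a chart, and calibration by a horizontal unit field -/

section Graph

variable {n : ℕ} {M : Type*} [TopologicalSpace M]
  [ChartedSpace (EuclideanSpace ℝ (Fin (n + 1))) M]

/-- The linear coordinates `(s, y) ↦ s c₀ + ∑ yᵢ cᵢ`. -/
def graphLin (c : Unit ⊕ Fin n → EuclideanSpace ℝ (Fin (n + 1))) :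
    ℝ × EuclideanSpace ℝ (Fin n) →L[ℝ] EuclideanSpace ℝ (Fin (n + 1)) :=
  (ContinuousLinearMap.fst ℝ ℝ _).smulRight (c (.inl ())) +
    ∑ i, ((EuclideanSpace.proj i).comp (ContinuousLinearMap.snd ℝ ℝ _)).smulRight (c (.inr i))

theorem graphLin_apply (c : Unit ⊕ Fin n → EuclideanSpace ℝ (Fin (n + 1)))
    (z : ℝ × EuclideanSpace ℝ (Fin n)) :
    graphLin c z = z.1 • c (.inl ()) + ∑ i, z.2 i • c (.inr i) := by
  simp [graphLin, sum_apply]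

theorem graphLin_fst (c : Unit ⊕ Fin n → EuclideanSpace ℝ (Fin (n + 1))) :
    graphLin c (1, 0) = c (.inl ()) := by simp [graphLin_apply]

theorem graphLin_single (c : Unit ⊕ Fin n → EuclideanSpace ℝ (Fin (n + 1))) (a : ℝ) (i : Fin n) :
    graphLin c (a, EuclideanSpace.single i 1) = c (.inr i) + a • c (.inl ()) := by
  rw [graphLin_apply, _root_.add_comm (c (.inr i))]
  congr 1
  rw [Finset.sum_eq_single i] <;> simp +contextual

theorem graphLin_injective {c : Unit ⊕ Fin n → EuclideanSpace ℝ (Fin (n + 1))}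
    (hc : LinearIndependent ℝ c) : Function.Injective (graphLin c) := by
  rw [injective_iff_map_eq_zero]
  rintro ⟨s, y⟩ h
  rw [graphLin_apply] at h
  have h2 := Fintype.linearIndependent_iff.1 hc (Sum.elim (fun _ ↦ s) y)
    (by simpa [Fintype.sum_sum_type] using h)
  refine Prod.ext (h2 (.inl ())) ?_
  ext i
  exact h2 (.inr i)

/-- The point with linear coordinates `z` in the chart at `p`. -/
def graphMap (p : M) (c : Unit ⊕ Fin n → EuclideanSpace ℝ (Fin (n + 1)))
    (z : ℝ × EuclideanSpace ℝ (Fin n)) : M :=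
  (extChartAt (𝓡 (n + 1)) p).symm (extChartAt (𝓡 (n + 1)) p p + graphLin c z)

/-- The linear coordinates of the points of the chart domain at `p` that lie in `O`. -/
def graphDomain (p : M) (c : Unit ⊕ Fin n → EuclideanSpace ℝ (Fin (n + 1))) (O : Set M) :
    Set (ℝ × EuclideanSpace ℝ (Fin n)) :=
  {z | extChartAt (𝓡 (n + 1)) p p + graphLin c z ∈ (extChartAt (𝓡 (n + 1)) p).target ∧
    graphMap p c z ∈ O}

variable {p : M} {c : Unit ⊕ Fin n → EuclideanSpace ℝ (Fin (n + 1))} {O : Set M}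

theorem graphMap_zero : graphMap p c 0 = p := by
  rw [graphMap, map_zero, add_zero, extChartAt_to_inv]

theorem zero_mem_graphDomain (hp : p ∈ O) : 0 ∈ graphDomain p c O := by
  refine ⟨?_, by rwa [graphMap_zero]⟩
  rw [map_zero, add_zero]; exact mem_extChartAt_target p

theorem isOpen_graphDomain (hO : IsOpen O) : IsOpen (graphDomain p c O) :=
  ((continuousOn_extChartAt_symm p).isOpen_inter_preimage (isOpen_extChartAt_target p) hO).preimage
    (f := fun z ↦ extChartAt (𝓡 (n + 1)) p p + graphLin c z) (by fun_prop)

theorem contDiff_graphLin (x : EuclideanSpace ℝ (Fin (n + 1))) {N : ℕ∞ω} :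
    ContDiff ℝ N fun z ↦ x + graphLin c z :=
  contDiff_const.add (graphLin c).contDiff

variable [IsManifold (𝓡 (n + 1)) ∞ M]

omit [IsManifold (𝓡 (n + 1)) ∞ M] in
theorem graphMap_mem_source {z : ℝ × EuclideanSpace ℝ (Fin n)} (hz : z ∈ graphDomain p c O) :
    graphMap p c z ∈ (chartAt (EuclideanSpace ℝ (Fin (n + 1))) p).source := by
  rw [← extChartAt_source (I := 𝓡 (n + 1))]
  exact (extChartAt (𝓡 (n + 1)) p).map_target hz.1

theorem contMDiffAt_graphMap {z : ℝ × EuclideanSpace ℝ (Fin n)} (hz : z ∈ graphDomain p c O) :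
    ContMDiffAt 𝓘(ℝ, ℝ × EuclideanSpace ℝ (Fin n)) (𝓡 (n + 1)) ∞ (graphMap p c) z :=
  ((contMDiffOn_extChartAt_symm (n := ∞) (I := 𝓡 (n + 1)) p).contMDiffAt
    ((isOpen_extChartAt_target p).mem_nhds hz.1)).comp z
    (contDiff_graphLin (extChartAt (𝓡 (n + 1)) p p)).contMDiff.contMDiffAt

theorem contDiffAt_comp_graphMap {N : ℕ∞ω} (hN : N ≤ ∞) {h : M → ℝ}
    {z : ℝ × EuclideanSpace ℝ (Fin n)} (hz : z ∈ graphDomain p c O)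
    (hh : ContMDiffAt (𝓡 (n + 1)) 𝓘(ℝ, ℝ) N h (graphMap p c z)) :
    ContDiffAt ℝ N (fun z ↦ h (graphMap p c z)) z :=
  (hh.comp z ((contMDiffAt_graphMap hz).of_le hN)).contDiffAt

theorem fderiv_comp_graphMap_zero {h : M → ℝ} (hh : MDifferentiableAt (𝓡 (n + 1)) 𝓘(ℝ, ℝ) h p)
    (v : ℝ × EuclideanSpace ℝ (Fin n)) :
    fderiv ℝ (fun z ↦ h (graphMap p c z)) 0 v = mvfderiv (𝓡 (n + 1)) h p (graphLin c v) := by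
  have h0 : extChartAt (𝓡 (n + 1)) p p + graphLin c 0 = extChartAt (𝓡 (n + 1)) p p := by simp
  have hd : DifferentiableAt ℝ (h ∘ (extChartAt (𝓡 (n + 1)) p).symm)
      (extChartAt (𝓡 (n + 1)) p p + graphLin c 0) := by
    rw [h0]
    have h1 : MDifferentiableAt (𝓡 (n + 1)) 𝓘(ℝ, ℝ) h
      ((extChartAt (𝓡 (n + 1)) p).symm (extChartAt (𝓡 (n + 1)) p p)) := by
      rwa [extChartAt_to_inv]
    exact (h1.comp _ (hasMFDerivAt_extChartAt_symm
      (mem_extChartAt_target p)).mdifferentiableAt).differentiableAt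
  have h2 := hd.hasFDerivAt.comp (0 : ℝ × EuclideanSpace ℝ (Fin n))
    ((graphLin c).hasFDerivAt.const_add (extChartAt (𝓡 (n + 1)) p p))
  have h3 : fderiv ℝ (fun z ↦ h (graphMap p c z)) 0 = _ := h2.fderiv
  rw [h3, h0]
  exact fderiv_comp_extChartAt_symm_self hh (graphLin c v)

theorem hasFDerivAt_graph {ψ : EuclideanSpace ℝ (Fin n) → ℝ} {y : EuclideanSpace ℝ (Fin n)}
    (hψ : DifferentiableAt ℝ ψ y) (x : EuclideanSpace ℝ (Fin (n + 1))) :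
    HasFDerivAt (fun y ↦ x + graphLin c (ψ y, y))
      ((graphLin c).comp ((fderiv ℝ ψ y).prod (ContinuousLinearMap.id ℝ _))) y :=
  ((graphLin c).hasFDerivAt.comp y (hψ.hasFDerivAt.prodMk (hasFDerivAt_id y))).const_add x

theorem mfderiv_graphMap_graph {ψ : EuclideanSpace ℝ (Fin n) → ℝ} {y : EuclideanSpace ℝ (Fin n)}
    (hψ : DifferentiableAt ℝ ψ y) (hy : (ψ y, y) ∈ graphDomain p c O)
    (v : EuclideanSpace ℝ (Fin n)) :
    mfderiv (𝓡 n) (𝓡 (n + 1)) (fun y ↦ graphMap p c (ψ y, y)) y v =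
      chartField p (graphLin c (fderiv ℝ ψ y v, v)) (graphMap p c (ψ y, y)) :=
  mfderiv_extChartAt_symm_comp_apply (hasFDerivAt_graph hψ _) hy.1 v

theorem mfderiv_graphMap_graph_single {ψ : EuclideanSpace ℝ (Fin n) → ℝ}
    {y : EuclideanSpace ℝ (Fin n)} (hψ : DifferentiableAt ℝ ψ y)
    (hy : (ψ y, y) ∈ graphDomain p c O) (i : Fin n) :
    mfderiv (𝓡 n) (𝓡 (n + 1)) (fun y ↦ graphMap p c (ψ y, y)) y (EuclideanSpace.single i (1 : ℝ)) =
      chartField p (c (.inr i)) (graphMap p c (ψ y, y)) +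
        fderiv ℝ ψ y (EuclideanSpace.single i 1) •
          chartField p (c (.inl ())) (graphMap p c (ψ y, y)) := by
  rw [mfderiv_graphMap_graph hψ hy, graphLin_single, chartField_add, chartField_smul]

theorem linearIndependent_chartField {ι : Type*} {c : ι → EuclideanSpace ℝ (Fin (n + 1))}
    (hc : LinearIndependent ℝ c) {q : M}
    (hq : q ∈ (chartAt (EuclideanSpace ℝ (Fin (n + 1))) p).source) :
    LinearIndependent ℝ fun i ↦ chartField p (c i) q := by
  refine LinearIndependent.of_comp (chartCoord p q).toLinearMap ?_
  have : (chartCoord p q).toLinearMap ∘ (fun i ↦ chartField p (c i) q) = c := by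
    funext i; exact chartCoord_chartField hq (c i)
  rwa [this]

/-- A graph that lies in `S` is a patch of `S`. -/
theorem isC2Patch_graph (hc : LinearIndependent ℝ c) {S : Set M} {W : Set (EuclideanSpace ℝ (Fin n))}
    (hW : IsOpen W) {φ : EuclideanSpace ℝ (Fin n) → ℝ} (hφ : ContDiffOn ℝ 2 φ W)
    (hgraph : ∀ y ∈ W, (φ y, y) ∈ graphDomain p c O) (hS : ∀ y ∈ W, graphMap p c (φ y, y) ∈ S) :
    IsC2Patch S W fun y ↦ graphMap p c (φ y, y) where
  isOpen := hW
  contMDiffOn := fun y hy ↦ by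
    have h1 := (contMDiffAt_graphMap (hgraph y hy)).of_le (show (2 : ℕ∞ω) ≤ ∞ from ENat.LEInfty.out)
    have h2 : ContMDiffAt (𝓡 n) 𝓘(ℝ, ℝ × EuclideanSpace ℝ (Fin n)) 2
        (fun y : EuclideanSpace ℝ (Fin n) ↦ (φ y, y)) y :=
      ((hφ.contDiffAt (hW.mem_nhds hy)).prodMk contDiffAt_id).contMDiffAt
    exact (ContMDiffAt.comp (g := graphMap p c) (f := fun y ↦ (φ y, y)) y h1 h2).contMDiffWithinAt
  injOn := fun y hy y' hy' h ↦ by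
    have h1 := (extChartAt (𝓡 (n + 1)) p).symm.injOn (hgraph y hy).1 (hgraph y' hy').1 h
    exact congrArg Prod.snd (graphLin_injective hc (add_left_cancel h1))
  immersion := fun y hy ↦ by
    have hd := (hφ.contDiffAt (hW.mem_nhds hy)).differentiableAt two_ne_zero
    intro v v' h
    have h1 := congrArg (chartCoord p _) (((mfderiv_graphMap_graph hd (hgraph y hy) v).symm.trans
      h).trans (mfderiv_graphMap_graph hd (hgraph y hy) v'))
    rw [chartCoord_chartField (graphMap_mem_source (hgraph y hy)),
      chartCoord_chartField (graphMap_mem_source (hgraph y hy))] at h1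
    exact congrArg Prod.snd (graphLin_injective hc h1)
  mapsTo := hS

theorem isC2Variation_graph {W : Set (EuclideanSpace ℝ (Fin n))}
    (hW : IsOpen W) {φ η : EuclideanSpace ℝ (Fin n) → ℝ} (hφ : ContDiffOn ℝ 2 φ W)
    (hη : ContDiff ℝ ∞ η) (hηc : HasCompactSupport η) (hηW : tsupport η ⊆ W) {δ : ℝ} (hδ : 0 < δ)
    (hgraph : ∀ t ∈ Icc (-δ) δ, ∀ y ∈ W, (φ y + t * η y, y) ∈ graphDomain p c O) :
    IsC2Variation W (fun y ↦ graphMap p c (φ y, y)) (tsupport η) δ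
      fun t y ↦ graphMap p c (φ y + t * η y, y) where
  delta_pos := hδ
  isCompact := hηc
  subset := hηW
  contMDiffOn := by
    rintro ⟨t, y⟩ ⟨ht, hy⟩
    have h1 := (contMDiffAt_graphMap (hgraph t (Ioo_subset_Icc_self ht) y hy)).of_le
      (show (2 : ℕ∞ω) ≤ ∞ from ENat.LEInfty.out)
    have h3 : ContDiffAt ℝ 2 (fun z : ℝ × EuclideanSpace ℝ (Fin n) ↦ φ z.2) (t, y) :=
      ContDiffAt.comp (g := φ) (f := Prod.snd) (t, y) (hφ.contDiffAt (hW.mem_nhds hy)) contDiffAt_snd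
    have h4 : ContDiffAt ℝ 2 (fun z : ℝ × EuclideanSpace ℝ (Fin n) ↦ η z.2) (t, y) :=
      ContDiffAt.comp (g := η) (f := Prod.snd) (t, y)
        (hη.contDiffAt.of_le ENat.LEInfty.out) contDiffAt_snd
    have h2 : ContMDiffAt 𝓘(ℝ, ℝ × EuclideanSpace ℝ (Fin n)) 𝓘(ℝ, ℝ × EuclideanSpace ℝ (Fin n)) 2
        (fun z : ℝ × EuclideanSpace ℝ (Fin n) ↦ (φ z.2 + z.1 * η z.2, z.2)) (t, y) :=
      ((h3.add (contDiffAt_fst.mul h4)).prodMk contDiffAt_snd).contMDiffAt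
    exact (h1.comp (t, y) h2).contMDiffWithinAt
  initial := fun y _ ↦ by simp
  fixed := fun t _ y hy ↦ by simp [image_eq_zero_of_notMem_tsupport hy.2]

end Graph

namespace VRStructure

variable {k m : ℕ} {M : Type*} [TopologicalSpace M]
  [ChartedSpace (EuclideanSpace ℝ (Fin (k + m + 1))) M] [IsManifold (𝓡 (k + m + 1)) ∞ M]
  {V : VRStructure k m M}

/-- The Riemannian volume density in the linear coordinates `c` of the chart at `p`. -/
def volumeDensity (V : VRStructure k m M) (p : M)
    (c : Unit ⊕ Fin (k + m) → EuclideanSpace ℝ (Fin (k + m + 1))) (q : M) : ℝ :=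
  √(V.gramMatrix q fun i ↦ chartField p (c i) q).det

variable {p : M} {c : Unit ⊕ Fin (k + m) → EuclideanSpace ℝ (Fin (k + m + 1))} {O : Set M}

theorem contMDiffAt_det_gramMatrix_chartField {q : M}
    (hq : q ∈ (chartAt (EuclideanSpace ℝ (Fin (k + m + 1))) p).source) :
    ContMDiffAt (𝓡 (k + m + 1)) 𝓘(ℝ, ℝ) ∞
      (fun q ↦ (V.gramMatrix q fun i ↦ chartField p (c i) q).det) q := by
  simp only [Matrix.det_apply']
  refine ContMDiffAt.sum fun σ _ ↦ contMDiffAt_const.mul (ContMDiffAt.prod fun i _ ↦ ?_)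
  exact contMDiffAt_metric_inner V.metric le_rfl (contMDiffAt_chartField hq _)
    (contMDiffAt_chartField hq _)

theorem contMDiffAt_volumeDensity (hc : LinearIndependent ℝ c) {q : M}
    (hq : q ∈ (chartAt (EuclideanSpace ℝ (Fin (k + m + 1))) p).source) :
    ContMDiffAt (𝓡 (k + m + 1)) 𝓘(ℝ, ℝ) ∞ (V.volumeDensity p c) q := by
  have hpos := det_gramMatrix_pos (V := V) (linearIndependent_chartField hc hq)
  exact ContMDiffAt.comp (g := Real.sqrt) q (Real.contDiffAt_sqrt hpos.ne').contMDiffAt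
    (contMDiffAt_det_gramMatrix_chartField hq)

/-- Where the coordinate basis is orthonormal, `dρ = ½ ∑ dg_AA`. -/
theorem mvfderiv_volumeDensity (h1 : (V.gramMatrix p fun i ↦ chartField p (c i) p) = 1)
    (u : EuclideanSpace ℝ (Fin (k + m + 1))) :
    mvfderiv (𝓡 (k + m + 1)) (V.volumeDensity p c) p u =
      ∑ i, 2⁻¹ * mvfderiv (𝓡 (k + m + 1))
        (fun q ↦ V.metric.inner q (chartField p (c i) q) (chartField p (c i) q)) p u := by
  let sy := (extChartAt (𝓡 (k + m + 1)) p).symm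
  let x := extChartAt (𝓡 (k + m + 1)) p p
  have hx : sy x = p := extChartAt_to_inv p
  have hG : ∀ i j, MDifferentiableAt (𝓡 (k + m + 1)) 𝓘(ℝ, ℝ)
      (fun q ↦ V.metric.inner q (chartField p (c i) q) (chartField p (c j) q)) p := fun i j ↦
    mdifferentiableAt_metric_inner V.metric (mdifferentiableAt_chartField (mem_chart_source _ p) _)
      (mdifferentiableAt_chartField (mem_chart_source _ p) _)
  have hd : ∀ i j, DifferentiableAt ℝ
      ((fun q ↦ V.metric.inner q (chartField p (c i) q) (chartField p (c j) q)) ∘ sy) x := fun i j ↦ by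
    have h2 : MDifferentiableAt (𝓡 (k + m + 1)) 𝓘(ℝ, ℝ)
      (fun q ↦ V.metric.inner q (chartField p (c i) q) (chartField p (c j) q)) (sy x) := by
      rw [hx]; exact hG i j
    exact (h2.comp x (hasMFDerivAt_extChartAt_symm
      (mem_extChartAt_target p)).mdifferentiableAt).differentiableAt
  have hA1 : (V.gramMatrix (sy x) fun i ↦ chartField p (c i) (sy x)) = 1 := by rw [hx, h1]
  have hdet := hasFDerivAt_det_of_eq_one
    (A := fun x ↦ V.gramMatrix (sy x) fun i ↦ chartField p (c i) (sy x))
    (fun i j ↦ (hd i j).hasFDerivAt) hA1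
  have hsq := hdet.sqrt (by rw [hA1]; simp)
  have hρd : MDifferentiableAt (𝓡 (k + m + 1)) 𝓘(ℝ, ℝ) (V.volumeDensity p c) p := by
    exact (ContMDiffAt.comp (g := Real.sqrt) p (Real.contDiffAt_sqrt
      (by rw [h1]; simp)).contMDiffAt
      (contMDiffAt_det_gramMatrix_chartField (mem_chart_source _ p))).mdifferentiableAt (by simp)
  have e := fderiv_comp_extChartAt_symm_self hρd u
  have e2 : fderiv ℝ (V.volumeDensity p c ∘ sy) x = _ := hsq.fderiv
  rw [e2, hA1] at e
  refine Eq.trans e.symm ?_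
  simp only [Matrix.det_one, Real.sqrt_one, mul_one, smul_apply, sum_apply, Finset.smul_sum,
    one_div, smul_eq_mul]
  refine Finset.sum_congr rfl fun i _ ↦ ?_
  congr 1
  exact fderiv_comp_extChartAt_symm_self (hG i i) u

theorem perimeterDensity_graph {ψ : EuclideanSpace ℝ (Fin (k + m)) → ℝ}
    {y : EuclideanSpace ℝ (Fin (k + m))} (hψ : DifferentiableAt ℝ ψ y)
    (hy : (ψ y, y) ∈ graphDomain p c O) :
    V.perimeterDensity (fun y ↦ graphMap p c (ψ y, y)) y =
      V.areaAt (graphMap p c (ψ y, y)) fun i ↦ chartField p (c (.inr i)) (graphMap p c (ψ y, y)) +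
        fderiv ℝ ψ y (EuclideanSpace.single i 1) •
          chartField p (c (.inl ())) (graphMap p c (ψ y, y)) := by
  rw [perimeterDensity_eq_areaAt]
  congr 1
  funext i
  exact mfderiv_graphMap_graph_single hψ hy i

theorem continuousOn_perimeterDensity_graph (hc : LinearIndependent ℝ c)
    {W : Set (EuclideanSpace ℝ (Fin (k + m)))} (hW : IsOpen W)
    {ψ : EuclideanSpace ℝ (Fin (k + m)) → ℝ} (hψ : ContDiffOn ℝ 2 ψ W)
    (hgraph : ∀ y ∈ W, (ψ y, y) ∈ graphDomain p c O) :
    ContinuousOn (V.perimeterDensity fun y ↦ graphMap p c (ψ y, y)) W := by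
  have hd : ∀ y ∈ W, DifferentiableAt ℝ ψ y := fun y hy ↦
    (hψ.contDiffAt (hW.mem_nhds hy)).differentiableAt two_ne_zero
  have hQ : ContinuousOn (fun y ↦ graphMap p c (ψ y, y)) W := fun y hy ↦
    (ContinuousAt.comp (g := graphMap p c) (f := fun y ↦ (ψ y, y))
      (contMDiffAt_graphMap (hgraph y hy)).continuousAt
      ((hd y hy).continuousAt.prodMk continuousAt_id)).continuousWithinAt
  have hp : ∀ i, ContinuousOn (fun y ↦ fderiv ℝ ψ y (EuclideanSpace.single i 1)) W := fun i ↦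
    (hψ.continuousOn_fderiv_of_isOpen hW (by norm_num)).clm_apply continuousOn_const
  have hin : ∀ {X Y : (q : M) → TangentSpace (𝓡 (k + m + 1)) q},
      (∀ q ∈ (chartAt (EuclideanSpace ℝ (Fin (k + m + 1))) p).source,
        ContMDiffAt (𝓡 (k + m + 1)) (𝓡 (k + m + 1)).tangent ∞
        (fun q ↦ (⟨q, X q⟩ : TangentBundle (𝓡 (k + m + 1)) M)) q) →
      (∀ q ∈ (chartAt (EuclideanSpace ℝ (Fin (k + m + 1))) p).source,
        ContMDiffAt (𝓡 (k + m + 1)) (𝓡 (k + m + 1)).tangent ∞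
        (fun q ↦ (⟨q, Y q⟩ : TangentBundle (𝓡 (k + m + 1)) M)) q) →
      ContinuousOn (fun y ↦ V.metric.inner (graphMap p c (ψ y, y)) (X (graphMap p c (ψ y, y)))
        (Y (graphMap p c (ψ y, y)))) W := fun hX hY y hy ↦ by
    have hs := graphMap_mem_source (hgraph y hy)
    exact ContinuousAt.comp_continuousWithinAt (f := fun y ↦ graphMap p c (ψ y, y))
      (contMDiffAt_metric_inner V.metric le_rfl (hX _ hs) (hY _ hs)).continuousAt (hQ y hy)
  have hC : ∀ A, ∀ q ∈ (chartAt (EuclideanSpace ℝ (Fin (k + m + 1))) p).source,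
        ContMDiffAt (𝓡 (k + m + 1)) (𝓡 (k + m + 1)).tangent ∞
        (fun q ↦ (⟨q, chartField p (c A) q⟩ : TangentBundle (𝓡 (k + m + 1)) M)) q := fun A q hq ↦
    contMDiffAt_chartField hq _
  refine ContinuousOn.congr ?_ fun y hy ↦ perimeterDensity_graph (hd y hy) (hgraph y hy)
  refine continuousOn_areaAt (w := fun i y ↦ chartField p (c (.inr i)) (graphMap p c (ψ y, y)) +
        fderiv ℝ ψ y (EuclideanSpace.single i 1) •
          chartField p (c (.inl ())) (graphMap p c (ψ y, y))) (fun y hy ↦ ?_) (fun i j ↦ ?_)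
    fun i j ↦ ?_
  · exact linearIndependent_graph
      (linearIndependent_chartField hc (graphMap_mem_source (hgraph y hy))) _
  · simp only [map_add, map_smul, add_apply, smul_apply, smul_eq_mul]
    exact ((hin (hC _) (hC _)).add ((hp i).mul (hin (hC _) (hC _)))).add
      ((hp j).mul ((hin (hC _) (hC _)).add ((hp i).mul (hin (hC _) (hC _)))))
  · simp only [map_add, map_smul, smul_eq_mul]
    exact (hin (fun q _ ↦ (V.contMDiff_T i).contMDiffAt) (hC _)).add
      ((hp j).mul (hin (fun q _ ↦ (V.contMDiff_T i).contMDiffAt) (hC _)))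

end VRStructure

namespace VRStructure

variable {k m : ℕ} {M : Type*} [TopologicalSpace M]
  [ChartedSpace (EuclideanSpace ℝ (Fin (k + m + 1))) M] [IsManifold (𝓡 (k + m + 1)) ∞ M]
  {V : VRStructure k m M}

/-- The horizontal unit field that extends the normal of a minimal hypersurface calibrates it, so
that its divergence vanishes on the hypersurface. -/
theorem IsMinimal.sum_eq_zero {S : Set M} (hmin : V.IsMinimal S)
    (hS : IsC2Hypersurface (k + m + 1) S) {p : M} (hpS : p ∈ S)
    {Y : (q : M) → TangentSpace (𝓡 (k + m + 1)) q}
    (hY : ∀ᶠ q in 𝓝 p, ContMDiffAt (𝓡 (k + m + 1)) (𝓡 (k + m + 1)).tangent 1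
        (fun q ↦ (⟨q, Y q⟩ : TangentBundle (𝓡 (k + m + 1)) M)) q)
    (hY1 : ∀ᶠ q in 𝓝 p, V.metric.inner q (Y q) (Y q) = 1)
    (hYh : ∀ᶠ q in 𝓝 p, Y q ∈ V.horizontal q)
    (hYS : ∀ᶠ q in 𝓝 p, q ∈ S → V.IsUnitHorizontalNormal S q (Y q))
    (b : Module.Basis (Unit ⊕ Fin (k + m)) ℝ (TangentSpace (𝓡 (k + m + 1)) p))
    (hb : ∀ i j, V.metric.inner p (b i) (b j) = if i = j then 1 else 0)
    (hb0 : b (.inl ()) = Y p) :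
    ∑ i, (mvfderiv (𝓡 (k + m + 1)) (fun q ↦ b.repr (chartCoord p q (Y q)) i) p (b i) +
      2⁻¹ * mvfderiv (𝓡 (k + m + 1))
        (fun q ↦ V.metric.inner q (chartField p (b i) q) (chartField p (b i) q)) p (Y p)) = 0 := by
  obtain ⟨U, f, hUo, hpU, hf, hdf, hSU⟩ := hS p hpS
  have hfU : ∀ q ∈ U, ContMDiffAt (𝓡 (k + m + 1)) 𝓘(ℝ, ℝ) 2 f q := fun q hq ↦
    hf.contMDiffAt (hUo.mem_nhds hq)
  -- the basis vectors, as coordinate vectors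
  let c : Unit ⊕ Fin (k + m) → EuclideanSpace ℝ (Fin (k + m + 1)) := fun i ↦ b i
  have hc : LinearIndependent ℝ c := b.linearIndependent
  have hcp : ∀ i, chartField p (c i) p = b i := fun i ↦ chartField_self p (c i)
  -- a neighbourhood on which everything is defined
  obtain ⟨O, hO, hOo, hpO⟩ := eventually_nhds_iff.1 ((((hY.and hY1).and hYh).and hYS).and
    ((hUo.eventually_mem hpU).and ((chartAt (EuclideanSpace ℝ (Fin (k + m + 1)))
      p).open_source.eventually_mem (mem_chart_source _ p))))
  let Ω := graphDomain p c O
  have hΩ : IsOpen Ω := isOpen_graphDomain hOo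
  have hΩ0 : (0 : ℝ × EuclideanSpace ℝ (Fin (k + m))) ∈ Ω := zero_mem_graphDomain hpO
  have hyA : ∀ A q, q ∈ O → ContMDiffAt (𝓡 (k + m + 1)) 𝓘(ℝ, ℝ) 1
      (fun q ↦ b.repr (chartCoord p q (Y q)) A) q := fun A q hq ↦ by
    have := finiteDimensional_tangentSpace (k := k) (m := m) p
    let ℓ : EuclideanSpace ℝ (Fin (k + m + 1)) →L[ℝ] ℝ := LinearMap.toContinuousLinearMap (b.coord A)
    exact (ℓ.contMDiff (n := 1)).contMDiffAt.comp q
      (contMDiffAt_chartCoord_of_mem (by norm_num) (hO q hq).2.2 (hO q hq).1.1.1.1)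
  let y : Unit ⊕ Fin (k + m) → M → ℝ := fun A q ↦ b.repr (chartCoord p q (Y q)) A
  let X : Unit ⊕ Fin (k + m) → ℝ × EuclideanSpace ℝ (Fin (k + m)) → ℝ := fun A z ↦
    V.volumeDensity p c (graphMap p c z) * y A (graphMap p c z)
  have hX : ∀ A, ContDiffOn ℝ 1 (X A) Ω := fun A z hz ↦
    (contDiffAt_comp_graphMap (h := fun q ↦ V.volumeDensity p c q * y A q) (by norm_num) hz
      (((contMDiffAt_volumeDensity hc (hO _ hz.2).2.2).of_le (by norm_num)).mul
        (hyA A _ hz.2))).contDiffWithinAt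
  have hYC : ∀ q ∈ O, Y q = y (.inl ()) q • chartField p (c (.inl ())) q +
      ∑ i, y (.inr i) q • chartField p (c (.inr i)) q := fun q hq ↦ by
    have h1 : chartCoord p q (Y q) = ∑ i, y i q • c i :=
      (b.sum_repr (chartCoord p q (Y q))).symm
    rw [← chartField_chartCoord (hO q hq).2.2 (Y q), h1, chartField_sum]
    simp only [chartField_smul, Fintype.sum_sum_type, Finset.univ_unique, Finset.sum_singleton]
  -- the hypersurface is a graph over the coordinates transverse to its normal
  have hfp : f p = 0 := (hSU.subset ⟨hpS, hpU⟩ : p ∈ {q ∈ U | f q = 0}).2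
  have hdf0 : mvfderiv (𝓡 (k + m + 1)) f p (Y p) ≠ 0 := fun h ↦ by
    have hn := hYS.self_of_nhds hpS
    have h2 := hn.orthogonal _ (mem_tangentVectors_of_mfderiv_eq_zero hUo hSU hpU hpS (hfU p hpU)
      (hdf p hpU) h) hn.mem
    rw [hn.unit] at h2
    exact one_ne_zero h2
  have hFd : ContDiffAt ℝ 2 (fun z : ℝ × EuclideanSpace ℝ (Fin (k + m)) ↦ f (graphMap p c z)) 0 :=
    contDiffAt_comp_graphMap ENat.LEInfty.out hΩ0 (by rw [graphMap_zero]; exact hfU p hpU)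
  let sw := (ContinuousLinearMap.snd ℝ (EuclideanSpace ℝ (Fin (k + m))) ℝ).prod
    (ContinuousLinearMap.fst ℝ (EuclideanSpace ℝ (Fin (k + m))) ℝ)
  obtain ⟨φ, hφ, hφ0, hφF⟩ := exists_implicit_scalar
    (F := fun z : EuclideanSpace ℝ (Fin (k + m)) × ℝ ↦ f (graphMap p c (sw z))) (y₀ := 0) (s₀ := 0)
    (ContDiffAt.comp (g := fun z ↦ f (graphMap p c z)) (0, 0) hFd sw.contDiff.contDiffAt)
    (by
      change f (graphMap p c 0) = 0
      rw [graphMap_zero, hfp])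
    (by
      have h1 := (hFd.differentiableAt two_ne_zero).hasFDerivAt.comp
        ((0 : EuclideanSpace ℝ (Fin (k + m))), (0 : ℝ)) (sw.hasFDerivAt)
      have h2 : fderiv ℝ (fun z ↦ f (graphMap p c (sw z)))
        ((0 : EuclideanSpace ℝ (Fin (k + m))), (0 : ℝ)) = _ := h1.fderiv
      rw [h2]
      change fderiv ℝ (fun z : ℝ × EuclideanSpace ℝ (Fin (k + m)) ↦ f (graphMap p c z)) 0 (1, 0) ≠ 0
      rw [fderiv_comp_graphMap_zero ((hfU p hpU).mdifferentiableAt two_ne_zero), graphLin_fst]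
      change mvfderiv (𝓡 (k + m + 1)) f p (b (.inl ())) ≠ 0
      rwa [hb0])
  have hyp : ∀ A, y A p = if A = .inl () then 1 else 0 := fun A ↦ by
    have h1 : y A p = b.repr (b (.inl ())) A := by
      rw [hb0]; exact congrArg (fun v ↦ b.repr v A) (chartCoord_self p (Y p))
    rw [h1, b.repr_self, Finsupp.single_apply]
    simp [eq_comm]
  have hφc : ContinuousAt (fun y : EuclideanSpace ℝ (Fin (k + m)) ↦ (φ y, y)) 0 :=
    hφ.continuousAt.prodMk continuousAt_id
  have hφc0 : (φ 0, (0 : EuclideanSpace ℝ (Fin (k + m)))) = 0 := by rw [hφ0]; rfl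
  have hflux0 : ∀ᶠ z in 𝓝 (0 : EuclideanSpace ℝ (Fin (k + m))),
      0 < y (.inl ()) (graphMap p c (φ z, z)) -
        ∑ i, y (.inr i) (graphMap p c (φ z, z)) * fderiv ℝ φ z (EuclideanSpace.single i 1) := by
    have hyc : ∀ A, ContinuousAt (fun z ↦ y A (graphMap p c (φ z, z))) 0 := fun A ↦ by
      have h1 : ContinuousAt (fun z ↦ y A (graphMap p c z)) (φ 0, 0) := by
        rw [hφc0]
        exact (contDiffAt_comp_graphMap (by norm_num) hΩ0 (hyA A _ hΩ0.2)).continuousAt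
      exact ContinuousAt.comp (g := fun z ↦ y A (graphMap p c z)) (f := fun z ↦ (φ z, z)) h1 hφc
    have hpc : ∀ i, ContinuousAt (fun z ↦ fderiv ℝ φ z (EuclideanSpace.single i (1 : ℝ))) 0 :=
      fun i ↦ (hφ.continuousAt_fderiv two_ne_zero).clm_apply continuousAt_const
    have hcont : ContinuousAt (fun z ↦ y (.inl ()) (graphMap p c (φ z, z)) -
        ∑ i, y (.inr i) (graphMap p c (φ z, z)) * fderiv ℝ φ z (EuclideanSpace.single i 1)) 0 :=
      (hyc _).sub (tendsto_finsetSum _ fun i _ ↦ (hyc _).mul (hpc i))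
    refine hcont.eventually (lt_mem_nhds ?_)
    simp [hφ0, show ((0 : ℝ), (0 : EuclideanSpace ℝ (Fin (k + m)))) = 0 from rfl, graphMap_zero, hyp]
  have hφΩ : ∀ᶠ z in 𝓝 (0 : EuclideanSpace ℝ (Fin (k + m))), (φ z, z) ∈ Ω :=
    hφc.eventually (hΩ.eventually_mem (by change (φ 0, _) ∈ Ω; rw [hφc0]; exact hΩ0))
  obtain ⟨W, hW, hWo, hW0⟩ := eventually_nhds_iff.1
    (((hφ.eventually (by simp)).and hφF).and (hφΩ.and hflux0))
  have hφW : ContDiffOn ℝ 2 φ W := fun z hz ↦ (hW z hz).1.1.contDiffWithinAt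
  have hgraph : ∀ z ∈ W, (φ z, z) ∈ Ω := fun z hz ↦ (hW z hz).2.1
  have hgS : ∀ z ∈ W, graphMap p c (φ z, z) ∈ S := fun z hz ↦
    (hSU.superset ⟨(hO _ (hgraph z hz).2).2.1, (hW z hz).1.2⟩ : _ ∈ S ∩ U).1
  -- comparison of flux and area
  have hflux : ∀ ψ : EuclideanSpace ℝ (Fin (k + m)) → ℝ, ∀ z,
      fluxDensity (X (.inl ())) (fun i ↦ X (.inr i)) ψ z =
        V.volumeDensity p c (graphMap p c (ψ z, z)) * (y (.inl ()) (graphMap p c (ψ z, z)) -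
        ∑ i, y (.inr i) (graphMap p c (ψ z, z)) * fderiv ℝ ψ z (EuclideanSpace.single i 1)) :=
    fun ψ z ↦ by
      simp only [fluxDensity, X, mul_sub, Finset.mul_sum, mul_assoc]
  have hle : ∀ ψ : EuclideanSpace ℝ (Fin (k + m)) → ℝ, ∀ z, DifferentiableAt ℝ ψ z →
      (ψ z, z) ∈ Ω → fluxDensity (X (.inl ())) (fun i ↦ X (.inr i)) ψ z ≤
        V.perimeterDensity (fun z ↦ graphMap p c (ψ z, z)) z := fun ψ z hψ hz ↦ by
    rw [hflux, perimeterDensity_graph hψ hz]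
    have hq := hO _ hz.2
    exact flux_le_areaAt (linearIndependent_chartField hc hq.2.2) _ _ _ (hYC _ hz.2) hq.1.1.1.2
      hq.1.1.2
  have heq : ∀ z ∈ W, fluxDensity (X (.inl ())) (fun i ↦ X (.inr i)) φ z =
      V.perimeterDensity (fun z ↦ graphMap p c (φ z, z)) z := fun z hz ↦ by
    have hd := (hW z hz).1.1.differentiableAt two_ne_zero
    have hzΩ := hgraph z hz
    rw [hflux, perimeterDensity_graph hd hzΩ]
    have hq := hO _ hzΩ.2
    refine flux_eq_areaAt (linearIndependent_chartField hc hq.2.2) _ _ _ (hYC _ hzΩ.2) hq.1.1.1.2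
      hq.1.1.2 (fun x hx ↦ (hq.1.2 (hgS z hz)).orthogonal _ ?_ hx) (hW z hz).2.2.le
    -- combinations of the coordinate tangent vectors are velocities of curves in the graph
    let v : EuclideanSpace ℝ (Fin (k + m)) := WithLp.toLp 2 x
    have hline : ContDiff ℝ 1 fun t : ℝ ↦ z + t • v := by fun_prop
    have hz0 : z + (0 : ℝ) • v = z := by simp
    have hmd : MDifferentiableAt (𝓡 (k + m)) (𝓡 (k + m + 1)) (fun z ↦ graphMap p c (φ z, z)) z :=
      ((isC2Patch_graph hc hWo hφW hgraph hgS).contMDiffOn.contMDiffAt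
        (hWo.mem_nhds hz)).mdifferentiableAt two_ne_zero
    refine mem_tangentVectors_of_eventually (γ := fun t : ℝ ↦ graphMap p c (φ (z + t • v), z + t • v))
      ?_ ?_ (by simp) ?_
    · have h1 : ContMDiffAt (𝓡 (k + m)) (𝓡 (k + m + 1)) 1 (fun z ↦ graphMap p c (φ z, z))
          (z + (0 : ℝ) • v) := by
        rw [hz0]
        exact ((isC2Patch_graph hc hWo hφW hgraph hgS).contMDiffOn.contMDiffAt
          (hWo.mem_nhds hz)).of_le (by norm_num)
      exact ContMDiffAt.comp (g := fun z ↦ graphMap p c (φ z, z)) (0 : ℝ) h1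
        hline.contMDiff.contMDiffAt
    · have h1 := (hline.continuous.continuousAt (x := 0)).eventually (hWo.eventually_mem (by
        change z + (0 : ℝ) • v ∈ W
        rw [hz0]; exact hz))
      exact h1.mono fun t ht ↦ hgS _ ht
    · have h1 : HasFDerivAt (fun t : ℝ ↦ z + t • v)
          (ContinuousLinearMap.toSpanSingleton ℝ v) 0 := by
        have := ((hasDerivAt_id (0 : ℝ)).smul_const v).const_add z
        simpa using this.hasFDerivAt
      rw [← hz0] at hmd
      have h2 := HasMFDerivAt.comp (0 : ℝ) hmd.hasMFDerivAt h1.hasMFDerivAt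
      have h3 : curveVelocity (fun t : ℝ ↦ graphMap p c (φ (z + t • v), z + t • v)) 0 =
          mfderiv (𝓡 (k + m)) (𝓡 (k + m + 1)) (fun z ↦ graphMap p c (φ z, z)) (z + (0 : ℝ) • v)
            ((1 : ℝ) • v) := by
        rw [curveVelocity]
        exact congrArg (fun L : ℝ →L[ℝ] EuclideanSpace ℝ (Fin (k + m + 1)) ↦ L 1) h2.mfderiv
      rw [hz0, one_smul, mfderiv_graphMap_graph hd hzΩ, graphLin_apply] at h3
      have e1 : fderiv ℝ φ z v = ∑ i, x i * fderiv ℝ φ z (EuclideanSpace.single i 1) := by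
        have : v = ∑ i, x i • EuclideanSpace.single i (1 : ℝ) := by
          ext j
          simp [v, Pi.single_apply, Finset.sum_apply]
        rw [this, map_sum]
        simp
      have e2 : fderiv ℝ φ z v • c (.inl ()) + ∑ i, v i • c (.inr i) =
          ∑ i, x i • (c (.inr i) + fderiv ℝ φ z (EuclideanSpace.single i 1) • c (.inl ())) := by
        rw [e1, Finset.sum_smul, ← Finset.sum_add_distrib]
        refine Finset.sum_congr rfl fun i _ ↦ ?_
        rw [smul_add, smul_smul, _root_.add_comm (_ • c (.inl ()))]
      refine h3.trans ?_
      change chartField p (fderiv ℝ φ z v • c (.inl ()) + ∑ i, v i • c (.inr i)) _ = _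
      rw [e2, chartField_sum]
      refine Finset.sum_congr rfl fun i _ ↦ ?_
      rw [chartField_smul, chartField_add, chartField_smul]
  have hcal : prodDivergence (X (.inl ())) (fun i ↦ X (.inr i)) (φ 0, 0) = 0 := by
    refine prodDivergence_eq_zero_of_calibration hWo hφW hΩ (hX _) (fun i ↦ hX _) hgraph
      (fun η hη hηc hηW ↦ ?_) hW0
    obtain ⟨δ, hδ, hδΩ⟩ := exists_forall_graph_variation_mem hWo hφW.continuousOn hη.continuous
      hηc hηW hΩ hgraph
    refine ⟨_, hmin W _ _ δ _ (isC2Patch_graph hc hWo hφW hgraph hgS)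
      (isC2Variation_graph hWo hφW hη hηc hηW hδ hδΩ), ?_, ?_⟩
    · refine setIntegral_congr_fun hηc.measurableSet fun z hz ↦ ?_
      simp only [zero_mul, add_zero]
      exact (heq z (hηW hz)).symm
    · filter_upwards [Icc_mem_nhds (neg_lt_zero.2 hδ) hδ] with t ht
      have hψ : ContDiffOn ℝ 2 (fun z ↦ φ z + t * η z) W :=
        hφW.add (contDiffOn_const.mul (hη.of_le ENat.LEInfty.out).contDiffOn)
      have hψd : ∀ z ∈ W, DifferentiableAt ℝ (fun z ↦ φ z + t * η z) z := fun z hz ↦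
        (hψ.contDiffAt (hWo.mem_nhds hz)).differentiableAt two_ne_zero
      have hc1 : ContinuousOn (fluxDensity (X (.inl ())) (fun i ↦ X (.inr i))
          fun z ↦ φ z + t * η z) W := by
        have hXc : ∀ A, ContinuousOn (fun z ↦ X A (φ z + t * η z, z)) W := fun A ↦
          (hX A).continuousOn.comp (hψ.continuousOn.prodMk continuousOn_id) (hδΩ t ht)
        exact (hXc _).sub (continuousOn_finsetSum _ fun i _ ↦ (hXc _).mul
          ((hψ.continuousOn_fderiv_of_isOpen hWo (by norm_num)).clm_apply continuousOn_const))
      have hc2 : ContinuousOn (V.perimeterDensity fun z ↦ graphMap p c (φ z + t * η z, z)) W :=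
        continuousOn_perimeterDensity_graph hc hWo hψ (hδΩ t ht)
      exact setIntegral_mono_on ((hc1.mono hηW).integrableOn_compact hηc)
        ((hc2.mono hηW).integrableOn_compact hηc) hηc.measurableSet fun z hz ↦
        hle _ z (hψd z (hηW hz)) (hδΩ t ht z (hηW hz))
  -- the divergence in terms of derivatives at `p`
  have hgram1 : (V.gramMatrix p fun i ↦ chartField p (c i) p) = 1 := by
    ext i j
    simp only [gramMatrix, Matrix.of_apply, hcp, hb, Matrix.one_apply]
  have hρp : V.volumeDensity p c p = 1 := by
    rw [volumeDensity, hgram1, Matrix.det_one, Real.sqrt_one]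
  have hρd : MDifferentiableAt (𝓡 (k + m + 1)) 𝓘(ℝ, ℝ) (V.volumeDensity p c) p :=
    (contMDiffAt_volumeDensity hc (mem_chart_source _ p)).mdifferentiableAt (by simp)
  have hyd : ∀ A, MDifferentiableAt (𝓡 (k + m + 1)) 𝓘(ℝ, ℝ) (y A) p := fun A ↦
    (hyA A p hpO).mdifferentiableAt one_ne_zero
  have hXd : ∀ A v, fderiv ℝ (X A) 0 v = mvfderiv (𝓡 (k + m + 1)) (y A) p (graphLin c v) +
      y A p * mvfderiv (𝓡 (k + m + 1)) (V.volumeDensity p c) p (graphLin c v) := fun A v ↦ by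
    have h1 := fderiv_comp_graphMap_zero (c := c) (hρd.mul (hyd A)) v
    have h2 : fderiv ℝ (X A) 0 v = _ := h1
    rw [h2]
    have h3 : mvfderiv (𝓡 (k + m + 1)) (V.volumeDensity p c * y A) p (graphLin c v) = _ :=
      congrArg (fun L : EuclideanSpace ℝ (Fin (k + m + 1)) →L[ℝ] ℝ ↦ L (graphLin c v))
        (hρd.hasMFDerivAt.mul (hyd A).hasMFDerivAt).mfderiv
    rw [h3, hρp]
    change (1 : ℝ) * mvfderiv (𝓡 (k + m + 1)) (y A) p (graphLin c v) + _ = _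
    rw [one_mul]
    rfl
  rw [hφc0, prodDivergence, hXd] at hcal
  simp only [hXd, graphLin_fst, graphLin_single, zero_smul, add_zero, hyp] at hcal
  simp only [if_true, reduceCtorEq, if_false, one_mul, zero_mul, add_zero,
    mvfderiv_volumeDensity hgram1] at hcal
  rw [Finset.sum_add_distrib, Fintype.sum_sum_type]
  simp only [Finset.univ_unique, Finset.sum_singleton]
  rw [← hb0, ← hcal]
  exact add_right_comm _ _ _

end VRStructure

/-! ### Vanishing of the mean curvature -/

namespace VRStructure

variable {k m : ℕ} {M : Type*} [TopologicalSpace M]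
  [ChartedSpace (EuclideanSpace ℝ (Fin (k + m + 1))) M] [IsManifold (𝓡 (k + m + 1)) ∞ M]
  {V : VRStructure k m M}
  {D : CovariantDerivative (𝓡 (k + m + 1)) (EuclideanSpace ℝ (Fin (k + m + 1)))
      (fun x : M ↦ TangentSpace (𝓡 (k + m + 1)) x)}

/-- The normal, a horizontal tangent frame and the vertical frame form an orthonormal basis. -/
theorem exists_adapted_basis {S : Set M} {p : M} {ν : TangentSpace (𝓡 (k + m + 1)) p}
    (hν : V.IsUnitHorizontalNormal S p ν) {e : Fin k → TangentSpace (𝓡 (k + m + 1)) p}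
    (he : V.IsHorizontalTangentFrame S p e) :
    ∃ b : Module.Basis (Unit ⊕ Fin (k + m)) ℝ (TangentSpace (𝓡 (k + m + 1)) p),
      (∀ i j, V.metric.inner p (b i) (b j) = if i = j then 1 else 0) ∧ b (.inl ()) = ν ∧
      (∀ i, b (.inr (Fin.castAdd m i)) = e i) ∧ ∀ j, b (.inr (Fin.natAdd k j)) = V.T j p := by
  let v : Unit ⊕ Fin (k + m) → TangentSpace (𝓡 (k + m + 1)) p :=
    Sum.elim (fun _ ↦ ν) (Fin.append e fun j ↦ V.T j p)
  have hve : ∀ i, V.metric.inner p ν (Fin.append e (fun j ↦ V.T j p) i) = 0 := fun i ↦ by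
    refine Fin.addCases (fun i ↦ ?_) (fun j ↦ ?_) i
    · rw [Fin.append_left]; exact hν.orthogonal _ (he.mem_tangent i) (he.mem_horizontal i)
    · rw [Fin.append_right]; exact hν.mem j
  have hee : ∀ i j, V.metric.inner p (Fin.append e (fun j ↦ V.T j p) i)
      (Fin.append e (fun j ↦ V.T j p) j) = if i = j then 1 else 0 := fun i j ↦ by
    refine Fin.addCases (fun i ↦ ?_) (fun i ↦ ?_) i <;>
      refine Fin.addCases (fun j ↦ ?_) (fun j ↦ ?_) j
    · simp only [Fin.append_left, he.orthonormal, Fin.castAdd_inj]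
    · have h0 : Fin.castAdd m i ≠ Fin.natAdd k j := fun h ↦ by
        have := congrArg Fin.val h; simp at this; omega
      rw [Fin.append_left, Fin.append_right, if_neg h0]
      exact he.mem_horizontal i j
    · have h0 : Fin.natAdd k i ≠ Fin.castAdd m j := fun h ↦ by
        have := congrArg Fin.val h; simp at this; omega
      rw [Fin.append_left, Fin.append_right, if_neg h0, V.inner_comm]
      exact he.mem_horizontal j i
    · simp only [Fin.append_right, V.orthonormal_T, Fin.natAdd_inj]
  obtain ⟨b, hb, hbv⟩ := exists_metric_orthonormal_extension V.metric (ι := Unit ⊕ Fin (k + m))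
    (by simp [add_comm]) p v univ (by
      rintro (⟨⟩ | i) - (⟨⟩ | j) -
      · simpa [v] using hν.unit
      · simpa [v] using hve j
      · simpa [v, V.inner_comm p _ ν] using hve i
      · simpa [v] using hee i j)
  refine ⟨b, hb, hbv _ (mem_univ _), fun i ↦ ?_, fun j ↦ ?_⟩
  · rw [hbv _ (mem_univ _)]; simp [v]
  · rw [hbv _ (mem_univ _)]; simp [v]

theorem IsMinimal.meanCurvature_eq_zero [T2Space M] {S : Set M} (hmin : V.IsMinimal S)
    (hS : IsC2Hypersurface (k + m + 1) S) (hD : V.IsAdapted D) {p : M} (hpS : p ∈ S)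
    {N : (q : M) → TangentSpace (𝓡 (k + m + 1)) q} {e : Fin k → TangentSpace (𝓡 (k + m + 1)) p}
    (hN : V.IsHorizontalNormalField S p N) (he : V.IsHorizontalTangentFrame S p e) :
    V.meanCurvature D p N e = 0 := by
  obtain ⟨Y, hY, hY1, hYh, hYN⟩ := hN.exists_unit_horizontal hpS
  obtain ⟨b, hb, hb0, hbe, hbT⟩ := exists_adapted_basis (hN.normal.self_of_nhds hpS) he
  have hYp : Y p = N p := hYN.self_of_nhds hpS
  rw [meanCurvature_eq_sum hD hpS hN he hY.self_of_nhds hY1 hYh hYN hb0 hbe hbT,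
    ← hD.metric.divergence_eq b hb hY.self_of_nhds]
  refine hmin.sum_eq_zero hS hpS hY hY1 hYh ?_ b hb (by rw [hb0, hYp])
  filter_upwards [hYN, hN.normal] with q hq hq2 hqS
  rw [hq hqS]
  exact hq2 hqS

theorem IsMinimal.not_isHorizontallyPositivelyCurvedAt [T2Space M] (hk : 1 ≤ k) {S : Set M}
    (hmin : V.IsMinimal S) (hS : IsC2Hypersurface (k + m + 1) S) (hD : V.IsAdapted D) {p : M}
    (hpS : p ∈ S) : ¬ V.IsHorizontallyPositivelyCurvedAt D S p := by
  rintro ⟨N, e, hN, he, h⟩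
  have h0 : ∑ i, V.secondFundamentalForm D p N e i i = 0 :=
    hmin.meanCurvature_eq_zero hS hD hpS hN he
  have hii : ∀ i, V.secondFundamentalForm D p N e i i = (Pi.single i (1 : ℝ) : Fin k → ℝ) ⬝ᵥ
      (V.secondFundamentalForm D p N e).mulVec (Pi.single i 1) := fun i ↦ by simp
  have hne : ∀ i : Fin k, (Pi.single i (1 : ℝ) : Fin k → ℝ) ≠ 0 := fun i ↦ by simp
  have hnon : (Finset.univ : Finset (Fin k)).Nonempty := ⟨⟨0, hk⟩, Finset.mem_univ _⟩
  rcases h with h | h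
  · exact (Finset.sum_pos (fun i _ ↦ by rw [hii]; exact h _ (hne i)) hnon).ne' h0
  · exact (Finset.sum_neg (fun i _ ↦ by rw [hii]; exact h _ (hne i)) hnon).ne h0

end VRStructure

/-! ### Flows near a point where the linearized field is nilpotent -/

section ODE

variable {Z : Type*} [NormedAddCommGroup Z] [NormedSpace ℝ Z]

/-- If the linearization `P` of `z' = G z` at `z₀` satisfies `P² = 0`, then the time-one flow near
`z₀` is, to first order, `1 + P`. -/
theorem exists_ball_flow_sub_le {G : Z → Z} {P : Z →L[ℝ] Z} {z₀ : Z} (hG : HasStrictFDerivAt G P z₀)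
    (hP : P.comp P = 0) {κ : ℝ} (hκ : 0 < κ) :
    ∃ ε > 0, ∀ z₁ z₂ : ℝ → Z, (∀ t ∈ Icc (0 : ℝ) 1, HasDerivAt z₁ (G (z₁ t)) t) →
      (∀ t ∈ Icc (0 : ℝ) 1, HasDerivAt z₂ (G (z₂ t)) t) →
      (∀ t ∈ Icc (0 : ℝ) 1, z₁ t ∈ Metric.ball z₀ ε) →
      (∀ t ∈ Icc (0 : ℝ) 1, z₂ t ∈ Metric.ball z₀ ε) →
      ‖z₁ 1 - z₂ 1 - (z₁ 0 - z₂ 0) - P (z₁ 0 - z₂ 0)‖ ≤ κ * ‖z₁ 0 - z₂ 0‖ := by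
  set C := 1 + ‖P‖ with hC
  have hC0 : 0 < C := by positivity
  set K := Real.exp C with hK
  have hK0 : 0 < K := Real.exp_pos _
  obtain ⟨η, hη0, hη1, hηκ⟩ : ∃ η > 0, η ≤ 1 ∧ C * (C * (η * K)) ≤ κ := by
    refine ⟨min 1 (κ / (C * C * K)), lt_min one_pos (by positivity), min_le_left _ _, ?_⟩
    calc C * (C * (min 1 (κ / (C * C * K)) * K)) = C * C * K * min 1 (κ / (C * C * K)) := by ring
      _ ≤ C * C * K * (κ / (C * C * K)) := by gcongr; exact min_le_right _ _
      _ = κ := by field_simp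
  have hlip := hG.isLittleO.def hη0
  obtain ⟨ε, hε, hlip⟩ := Metric.eventually_nhds_iff_ball.1 hlip
  refine ⟨ε, hε, fun z₁ z₂ h₁ h₂ hb₁ hb₂ ↦ ?_⟩
  set ζ : ℝ → Z := fun t ↦ z₁ t - z₂ t with hζ
  set e : ℝ → Z := fun t ↦ G (z₁ t) - G (z₂ t) - P (ζ t) with he
  have hζd : ∀ t ∈ Icc (0 : ℝ) 1, HasDerivAt ζ (P (ζ t) + e t) t := fun t ht ↦ by
    have := (h₁ t ht).fun_sub (h₂ t ht)
    exact this.congr_deriv (by simp [he])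
  have hee : ∀ t ∈ Icc (0 : ℝ) 1, ‖e t‖ ≤ η * ‖ζ t‖ := fun t ht ↦
      hlip (z₁ t, z₂ t) (by rw [← ball_prod_same]; exact ⟨hb₁ t ht, hb₂ t ht⟩)
  have hζb : ∀ t ∈ Icc (0 : ℝ) 1, ‖ζ t‖ ≤ K * ‖ζ 0‖ := fun t ht ↦ by
    have hg := norm_le_gronwallBound_of_norm_deriv_right_le (f := ζ) (f' := fun t ↦ P (ζ t) + e t)
      (δ := ‖ζ 0‖) (K := C) (ε := 0) (a := 0) (b := 1)
      (fun t ht ↦ (hζd t ht).continuousAt.continuousWithinAt)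
      (fun t ht ↦ (hζd t (Ico_subset_Icc_self ht)).hasDerivWithinAt) le_rfl
      (fun t ht ↦ by
        have h1 := hee t (Ico_subset_Icc_self ht)
        calc ‖P (ζ t) + e t‖ ≤ ‖P‖ * ‖ζ t‖ + η * ‖ζ t‖ :=
              (norm_add_le _ _).trans (add_le_add (P.le_opNorm _) h1)
          _ ≤ ‖P‖ * ‖ζ t‖ + 1 * ‖ζ t‖ := by gcongr
          _ = C * ‖ζ t‖ + 0 := by rw [hC]; ring) t ht
    rw [gronwallBound_ε0, sub_zero] at hg
    refine hg.trans ?_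
    rw [mul_comm]
    gcongr
    rw [hK]
    exact Real.exp_le_exp.2 (by nlinarith [ht.2])
  -- `ζ - t P ζ` is constant up to the error, because `P² = 0`
  have hPP : ∀ v, P (P v) = 0 := fun v ↦ congrArg (fun L : Z →L[ℝ] Z ↦ L v) hP
  have hd : ∀ t ∈ Icc (0 : ℝ) 1, HasDerivWithinAt (fun t ↦ ζ t - t • P (ζ t))
      (e t - t • P (e t)) (Icc 0 1) t := fun t ht ↦ by
    have h1 := (hζd t ht).sub ((hasDerivAt_id t).smul (P.hasFDerivAt.comp_hasDerivAt t (hζd t ht)))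
    refine HasDerivAt.hasDerivWithinAt ?_
    convert! h1 using 1
    simp only [map_add, hPP, zero_add, id_eq, one_smul, Function.comp_apply]
    abel
  have hbd : ∀ t ∈ Icc (0 : ℝ) 1, ‖e t - t • P (e t)‖ ≤ C * (η * K) * ‖ζ 0‖ := fun t ht ↦ by
    have h1 : ‖e t‖ ≤ η * (K * ‖ζ 0‖) := (hee t ht).trans (by gcongr; exact hζb t ht)
    calc ‖e t - t • P (e t)‖ ≤ ‖e t‖ + 1 * (‖P‖ * ‖e t‖) := by
          refine (norm_sub_le _ _).trans ?_
          rw [norm_smul, Real.norm_of_nonneg ht.1]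
          gcongr
          · exact ht.2
          · exact P.le_opNorm _
      _ = C * ‖e t‖ := by rw [hC]; ring
      _ ≤ C * (η * (K * ‖ζ 0‖)) := by gcongr
      _ = C * (η * K) * ‖ζ 0‖ := by ring
  have hmv := (convex_Icc (0 : ℝ) 1).norm_image_sub_le_of_norm_hasDerivWithin_le hd hbd
    (left_mem_Icc.2 zero_le_one) (right_mem_Icc.2 zero_le_one)
  simp only [one_smul, zero_smul, sub_zero, norm_one, mul_one] at hmv
  have hfin : ζ 1 - ζ 0 - P (ζ 0) = (ζ 1 - P (ζ 1) - ζ 0) + P (ζ 1 - P (ζ 1) - ζ 0) := by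
    simp only [map_sub, hPP]; abel
  change ‖ζ 1 - ζ 0 - P (ζ 0)‖ ≤ κ * ‖ζ 0‖
  rw [hfin]
  calc ‖(ζ 1 - P (ζ 1) - ζ 0) + P (ζ 1 - P (ζ 1) - ζ 0)‖
      ≤ C * ‖ζ 1 - P (ζ 1) - ζ 0‖ := by
        refine (norm_add_le _ _).trans ?_
        rw [hC, add_mul, one_mul]
        gcongr
        exact P.le_opNorm _
    _ ≤ C * (C * (η * K) * ‖ζ 0‖) := by gcongr
    _ = C * (C * (η * K)) * ‖ζ 0‖ := by ring
    _ ≤ κ * ‖ζ 0‖ := by gcongr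

/-- Second order Taylor expansion at a critical point. -/
theorem eventually_norm_sub_sq_smul_le {r r' : ℝ → Z} {v : Z}
    (hr : ∀ᶠ t in 𝓝 (0 : ℝ), HasDerivAt r (r' t) t) (h0 : r 0 = 0) (h0' : r' 0 = 0)
    (hr' : HasDerivAt r' v 0) {κ : ℝ} (hκ : 0 < κ) :
    ∀ᶠ t in 𝓝[>] (0 : ℝ), ‖r t - (t ^ 2 / 2) • v‖ ≤ κ * t ^ 2 := by
  have h1 := (hasDerivAt_iff_isLittleO.1 hr').def hκ
  simp only [h0', sub_zero] at h1
  obtain ⟨δ, hδ, hb⟩ := Metric.eventually_nhds_iff_ball.1 (hr.and h1)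
  filter_upwards [Ioo_mem_nhdsGT hδ] with t ht
  have hmem : ∀ s ∈ Icc 0 t, s ∈ Metric.ball (0 : ℝ) δ := fun s hs ↦ by
    rw [Metric.mem_ball, dist_zero_right, Real.norm_of_nonneg hs.1]; exact hs.2.trans_lt ht.2
  have hd : ∀ s ∈ Icc 0 t, HasDerivWithinAt (fun s ↦ r s - (s ^ 2 / 2) • v) (r' s - s • v)
      (Icc 0 t) s := fun s hs ↦ by
    have h2 : HasDerivAt (fun s : ℝ ↦ (s ^ 2 / 2) • v) (s • v) s := by
      have := (((hasDerivAt_id s).pow 2).div_const 2).smul_const v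
      simpa using this
    exact ((hb s (hmem s hs)).1.sub h2).hasDerivWithinAt
  have hbd : ∀ s ∈ Icc 0 t, ‖r' s - s • v‖ ≤ κ * t := fun s hs ↦
    (hb s (hmem s hs)).2.trans (by rw [Real.norm_of_nonneg hs.1]; gcongr; exact hs.2)
  have hmv := (convex_Icc 0 t).norm_image_sub_le_of_norm_hasDerivWithin_le hd hbd
    (left_mem_Icc.2 ht.1.le) (right_mem_Icc.2 ht.1.le)
  simp only [h0, ne_eq, OfNat.ofNat_ne_zero, not_false_eq_true, zero_pow, zero_div, zero_smul,
    sub_zero, Real.norm_of_nonneg ht.1.le] at hmv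
  rw [pow_two, ← mul_assoc] at *
  exact hmv

end ODE

/-! ### Left-invariant frames on a Carnot group -/

section LeftInvariant

variable {d : ℕ} {M : Type*} [TopologicalSpace M] [ChartedSpace (EuclideanSpace ℝ (Fin d)) M]

theorem mvfderiv_fun_sum {ι : Type*} (s : Finset ι) {f : ι → M → ℝ} {p : M}
    (hf : ∀ i ∈ s, MDifferentiableAt (𝓡 d) 𝓘(ℝ, ℝ) (f i) p) (u : TangentSpace (𝓡 d) p) :
    MDifferentiableAt (𝓡 d) 𝓘(ℝ, ℝ) (fun q ↦ ∑ i ∈ s, f i q) p ∧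
    mvfderiv (𝓡 d) (fun q ↦ ∑ i ∈ s, f i q) p u = ∑ i ∈ s, mvfderiv (𝓡 d) (f i) p u := by
  classical
  induction s using Finset.induction_on with
  | empty =>
    simp only [Finset.sum_empty]
    exact ⟨mdifferentiableAt_const, by rw [mvfderiv_const]; rfl⟩
  | insert a s ha ih =>
    have ih := ih fun i hi ↦ hf i (Finset.mem_insert_of_mem hi)
    have h1 := hf a (Finset.mem_insert_self a s)
    simp only [Finset.sum_insert ha]
    refine ⟨h1.add ih.1, ?_⟩
    rw [mvfderiv_fun_add h1 ih.1, add_apply, ih.2]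

variable [Group M]

theorem mulInvariantVectorField_one (v : GroupLieAlgebra (𝓡 d) M) :
    mulInvariantVectorField v (1 : M) = v := by
  have h : (fun x : M ↦ 1 * x) = id := by ext x; simp
  have h2 : HasMFDerivAt (𝓡 d) (𝓡 d) (fun x : M ↦ 1 * x) 1
      (ContinuousLinearMap.id ℝ (EuclideanSpace ℝ (Fin d))) := by
    rw [h]; exact hasMFDerivAt_id 1
  exact congrArg (fun L : EuclideanSpace ℝ (Fin d) →L[ℝ] EuclideanSpace ℝ (Fin d) ↦ L v) h2.mfderiv

theorem mulInvariantVectorField_sum {ι : Type*} [Fintype ι] (c : ι → ℝ)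
    (v : ι → GroupLieAlgebra (𝓡 d) M) (p : M) :
    mulInvariantVectorField (∑ i, c i • v i) p = ∑ i, c i • mulInvariantVectorField (v i) p := by
  let L : GroupLieAlgebra (𝓡 d) M →ₗ[ℝ] TangentSpace (𝓡 d) p :=
    { toFun := fun v ↦ mulInvariantVectorField v p
      map_add' := fun v w ↦ congrFun (mulInvariantVectorField_add v w) p
      map_smul' := fun c v ↦ congrFun (mulInvariantVectorField_smul c v) p }
  change L _ = ∑ i, c i • L (v i)
  simp [map_sum]

variable [LieGroup (𝓡 d) ∞ M]

instance lieGroup_minSmoothness : LieGroup (𝓡 d) (minSmoothness ℝ 3) M := by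
  rw [minSmoothness_of_isRCLikeNormedField]
  exact LieGroup.of_le (n := ∞) ENat.LEInfty.out

theorem contMDiff_mulInvariantVectorField_two (v : GroupLieAlgebra (𝓡 d) M) :
    ContMDiff (𝓡 d) (𝓡 d).tangent 2
      (fun q ↦ (⟨q, mulInvariantVectorField v q⟩ : TangentBundle (𝓡 d) M)) := by
  exact (contMDiff_mulInvariantVectorField (I := 𝓡 d) v).of_le
    minSmoothness_of_isRCLikeNormedField.ge

theorem mdifferentiableAt_mulInvariant (v : GroupLieAlgebra (𝓡 d) M) (p : M) :
    MDifferentiableAt (𝓡 d) (𝓡 d).tangent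
      (fun q ↦ (⟨q, mulInvariantVectorField v q⟩ : TangentBundle (𝓡 d) M)) p :=
  mdifferentiableAt_mulInvariantVectorField v

end LeftInvariant

-- both the manifold structure of `M` and the Lie group structure are given
set_option linter.overlappingInstances false

namespace VRStructure

variable {k m : ℕ} {M : Type*} [TopologicalSpace M]
  [ChartedSpace (EuclideanSpace ℝ (Fin (k + m + 1))) M] [IsManifold (𝓡 (k + m + 1)) ∞ M]
  {V : VRStructure k m M} [Group M]

/-- An orthonormal basis of the Lie algebra, the last vectors of which are the generators of the
`T_j`. -/
structure IsLeftInvariantFrame (V : VRStructure k m M)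
    (E : Fin (k + 1) ⊕ Fin m → GroupLieAlgebra (𝓡 (k + m + 1)) M) : Prop where
  orthonormal : ∀ A B, V.metric.inner 1 (E A) (E B) = if A = B then 1 else 0
  sum_inner_smul : ∀ v, ∑ A, V.metric.inner 1 v (E A) • E A = v
  inr_eq : ∀ j, mulInvariantVectorField (E (.inr j)) = V.T j

theorem IsCarnot.exists_T_eq (hC : V.IsCarnot) (j : Fin m) :
    mulInvariantVectorField (V.T j 1) = V.T j := by
  obtain ⟨𝔳, -, -, -, layer, τ, hτ, -⟩ := hC.exists_grading
  have h1 : V.T j 1 = τ j := by rw [(hτ j).2.2]; exact mulInvariantVectorField_one _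
  rw [h1, (hτ j).2.2]

theorem IsCarnot.exists_frame (hC : V.IsCarnot) : ∃ E, V.IsLeftInvariantFrame E := by
  obtain ⟨b, hb, hbs⟩ := exists_metric_orthonormal_extension V.metric
    (ι := Fin (k + 1) ⊕ Fin m) (by simp; omega) (1 : M)
    (Sum.elim (fun _ ↦ 0) fun j ↦ V.T j 1) (range Sum.inr) (by
      rintro _ ⟨i, rfl⟩ _ ⟨j, rfl⟩
      simpa using V.orthonormal_T 1 i j)
  refine ⟨b, hb, fun v ↦ b.ext_elem fun A ↦ ?_, fun j ↦ ?_⟩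
  · have h : ∀ B, V.metric.inner 1 v (b B) = b.repr v B := fun B ↦ by
      conv_lhs => rw [← b.sum_repr v]
      simp only [map_sum, sum_apply, map_smul, smul_apply, hb, smul_eq_mul, mul_ite, mul_one,
        mul_zero, Finset.sum_ite_eq', Finset.mem_univ, if_true]
    simp [h]
  · rw [hbs _ ⟨j, rfl⟩]
    exact hC.exists_T_eq j

theorem IsCarnot.mulInvariant_mem_horizontal (hC : V.IsCarnot)
    {u : GroupLieAlgebra (𝓡 (k + m + 1)) M} (hu : u ∈ V.horizontal 1) (p : M) :
    mulInvariantVectorField u p ∈ V.horizontal p := fun j ↦ by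
  rw [← hC.exists_T_eq j, hC.leftInvariant]
  exact hu j

theorem IsCarnot.exists_mulInvariant_eq (hC : V.IsCarnot) (p : M)
    (w : TangentSpace (𝓡 (k + m + 1)) p) :
    ∃ u : GroupLieAlgebra (𝓡 (k + m + 1)) M, mulInvariantVectorField u p = w := by
  let L : GroupLieAlgebra (𝓡 (k + m + 1)) M →ₗ[ℝ] TangentSpace (𝓡 (k + m + 1)) p :=
    { toFun := fun v ↦ mulInvariantVectorField v p
      map_add' := fun v w ↦ congrFun (mulInvariantVectorField_add v w) p
      map_smul' := fun c v ↦ congrFun (mulInvariantVectorField_smul c v) p }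
  have hinj : Function.Injective L := by
    rw [injective_iff_map_eq_zero]
    intro v hv
    by_contra hv0
    have h1 := V.metric.pos 1 v hv0
    rw [← hC.leftInvariant p v v] at h1
    change 0 < V.metric.inner p (L v) (L v) at h1
    rw [hv, map_zero] at h1
    exact lt_irrefl _ h1
  have h1 := finiteDimensional_tangentSpace (k := k) (m := m) p
  have h2 := finiteDimensional_tangentSpace (k := k) (m := m) (1 : M)
  exact (LinearMap.injective_iff_surjective_of_finrank_eq_finrank
    (by rw [finrank_tangentSpace, finrank_tangentSpace])).1 hinj w

theorem IsCarnot.sum_inner_smul (hC : V.IsCarnot)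
    {E : Fin (k + 1) ⊕ Fin m → GroupLieAlgebra (𝓡 (k + m + 1)) M} (hE : V.IsLeftInvariantFrame E)
    (p : M) (w : TangentSpace (𝓡 (k + m + 1)) p) :
    ∑ A, V.metric.inner p w (mulInvariantVectorField (E A) p) • mulInvariantVectorField (E A) p =
      w := by
  obtain ⟨u, rfl⟩ := hC.exists_mulInvariant_eq p w
  simp only [hC.leftInvariant]
  rw [← mulInvariantVectorField_sum, hE.sum_inner_smul]

theorem IsCarnot.inner_eq_sum (hC : V.IsCarnot)
    {E : Fin (k + 1) ⊕ Fin m → GroupLieAlgebra (𝓡 (k + m + 1)) M} (hE : V.IsLeftInvariantFrame E)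
    (p : M) (v w : TangentSpace (𝓡 (k + m + 1)) p) :
    V.metric.inner p v w = ∑ A, V.metric.inner p v (mulInvariantVectorField (E A) p) *
      V.metric.inner p w (mulInvariantVectorField (E A) p) := by
  conv_lhs => rw [← hC.sum_inner_smul hE p w]
  rw [map_sum]
  exact Finset.sum_congr rfl fun A _ ↦ by rw [map_smul, smul_eq_mul, mul_comm]

/-- A vector orthogonal to all horizontal left-invariant fields is vertical. -/
theorem IsCarnot.mem_vertical (hC : V.IsCarnot) {p : M} {v : TangentSpace (𝓡 (k + m + 1)) p}
    (hv : ∀ u ∈ V.horizontal 1, V.metric.inner p v (mulInvariantVectorField u p) = 0) :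
    v ∈ V.vertical p := by
  have h0 : V.horizontalPart p v = 0 := by
    by_contra hne
    have h1 := V.metric.pos p _ hne
    obtain ⟨u, hu⟩ := hC.exists_mulInvariant_eq p (V.horizontalPart p v)
    have hu1 : u ∈ V.horizontal 1 := fun j ↦ by
      rw [← hC.leftInvariant p, hu, hC.exists_T_eq j]
      exact V.horizontalPart_mem p v j
    have h2 := hv u hu1
    rw [hu] at h2
    have h3 : V.metric.inner p (V.horizontalPart p v) (V.horizontalPart p v) =
        V.metric.inner p v (V.horizontalPart p v) := by
      conv_lhs => arg 1; rw [horizontalPart]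
      rw [map_sub, sub_apply, map_sum, sum_apply, sub_eq_self]
      refine Finset.sum_eq_zero fun j _ ↦ ?_
      rw [map_smul, smul_apply, V.inner_comm p (V.T j p) (V.horizontalPart p v),
        V.horizontalPart_mem p v j, smul_zero]
    linarith
  have h1 : v = ∑ j, V.metric.inner p v (V.T j p) • V.T j p := by
    rw [horizontalPart, sub_eq_zero] at h0
    exact h0
  rw [h1]
  exact Submodule.sum_mem _ fun j _ ↦ Submodule.smul_mem _ _ (Submodule.subset_span ⟨j, rfl⟩)

/-- Bracketing with a horizontal vector raises the layer, so the result is vertical. -/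
theorem IsCarnot.inner_bracket_eq_zero [LieGroup (𝓡 (k + m + 1)) ∞ M] (hC : V.IsCarnot)
    {h z : GroupLieAlgebra (𝓡 (k + m + 1)) M} (hh : h ∈ V.horizontal 1) (hz : z ∈ V.horizontal 1)
    (x : GroupLieAlgebra (𝓡 (k + m + 1)) M) : V.metric.inner 1 ⁅h, x⁆ z = 0 := by
  obtain ⟨𝔳, hint, hgen, hhor, layer, τ, hτ, -⟩ := hC.exists_grading
  have hT : ∀ j, V.T j 1 = τ j := fun j ↦ by
    rw [(hτ j).2.2]; exact mulInvariantVectorField_one _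
  -- the positive layers are vertical
  have hver : ∀ j, ∀ y ∈ 𝔳 (j + 1), V.metric.inner 1 y z = 0 := fun j y hy ↦ by
    have h0 : V.horizontalPart 1 y ∈ 𝔳 0 := hhor ▸ V.horizontalPart_mem 1 y
    have h1 : V.horizontalPart 1 y ∈ ⨆ i ≠ 0, 𝔳 i := by
      refine Submodule.sub_mem _ (Submodule.mem_iSup_of_mem (j + 1)
        (Submodule.mem_iSup_of_mem (Nat.succ_ne_zero j) hy)) (Submodule.sum_mem _ fun i _ ↦
        Submodule.smul_mem _ _ ?_)
      rw [hT]
      exact Submodule.mem_iSup_of_mem (layer i)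
        (Submodule.mem_iSup_of_mem (hτ i).1.ne' (hτ i).2.1)
    have h2 := (Submodule.disjoint_def.1 (hint.submodule_iSupIndep 0)) _ h0 h1
    rw [horizontalPart, sub_eq_zero] at h2
    rw [h2, map_sum, sum_apply]
    refine Finset.sum_eq_zero fun i _ ↦ ?_
    rw [map_smul, smul_apply, V.inner_comm 1 (V.T i 1) z, hz i, smul_zero]
  have hx : x ∈ ⨆ j, 𝔳 j := by rw [hint.submodule_iSup_eq_top]; trivial
  refine Submodule.iSup_induction 𝔳 (motive := fun x ↦ V.metric.inner 1 ⁅h, x⁆ z = 0) hx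
    (fun j y hy ↦ hver j _ ?_) ?_ fun a b ha hb ↦ ?_
  · rw [hgen]
    exact Submodule.subset_span ⟨h, hhor ▸ hh, y, hy, rfl⟩
  · rw [lie_zero, map_zero]; rfl
  · rw [lie_add, map_add, add_apply, ha, hb, add_zero]

/-- The flat connection of the left-invariant fields is adapted. -/
theorem IsCarnot.exists_flat_connection [LieGroup (𝓡 (k + m + 1)) ∞ M] (hC : V.IsCarnot) :
    ∃ D : CovariantDerivative (𝓡 (k + m + 1)) (EuclideanSpace ℝ (Fin (k + m + 1)))
      (fun x : M ↦ TangentSpace (𝓡 (k + m + 1)) x), V.IsAdapted D ∧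
      ∀ (u : GroupLieAlgebra (𝓡 (k + m + 1)) M) (p : M), D (mulInvariantVectorField u) p = 0 := by
  obtain ⟨E, hE⟩ := hC.exists_frame
  have hinn : ∀ {X : (q : M) → TangentSpace (𝓡 (k + m + 1)) q} {p : M},
      MDifferentiableAt (𝓡 (k + m + 1)) (𝓡 (k + m + 1)).tangent
      (fun q ↦ (⟨q, X q⟩ : TangentBundle (𝓡 (k + m + 1)) M)) p → ∀ A,
      MDifferentiableAt (𝓡 (k + m + 1)) 𝓘(ℝ, ℝ)
        (fun q ↦ V.metric.inner q (X q) (mulInvariantVectorField (E A) q)) p := fun hX A ↦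
    mdifferentiableAt_metric_inner V.metric hX (mdifferentiableAt_mulInvariant (E A) _)
  let D : CovariantDerivative (𝓡 (k + m + 1)) (EuclideanSpace ℝ (Fin (k + m + 1)))
      (fun x : M ↦ TangentSpace (𝓡 (k + m + 1)) x) :=
    { toFun := fun X p ↦ ∑ A, (mvfderiv (𝓡 (k + m + 1))
        (fun q ↦ V.metric.inner q (X q) (mulInvariantVectorField (E A) q)) p).smulRight
          (mulInvariantVectorField (E A) p)
      isCovariantDerivativeOnUniv :=
        { add := fun {X Y p} hX hY _ ↦ by
            rw [← Finset.sum_add_distrib]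
            refine Finset.sum_congr rfl fun A _ ↦ ?_
            have e : (fun q ↦ V.metric.inner q ((X + Y) q) (mulInvariantVectorField (E A) q)) =
                fun q ↦ V.metric.inner q (X q) (mulInvariantVectorField (E A) q) +
                  V.metric.inner q (Y q) (mulInvariantVectorField (E A) q) := by
              ext q; simp
            rw [e, mvfderiv_fun_add (hinn hX A) (hinn hY A)]
            ext u
            simp [add_smul]
          leibniz := fun {X f p} hX hf _ ↦ by
            have e : ∀ A, mvfderiv (𝓡 (k + m + 1))
                (fun q ↦ V.metric.inner q ((f • X) q) (mulInvariantVectorField (E A) q)) p =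
                f p • mvfderiv (𝓡 (k + m + 1))
                  (fun q ↦ V.metric.inner q (X q) (mulInvariantVectorField (E A) q)) p +
                V.metric.inner p (X p) (mulInvariantVectorField (E A) p) •
                  mvfderiv (𝓡 (k + m + 1)) f p := fun A ↦ by
              rw [← mvfderiv_fun_mul hf (hinn hX A)]
              congr 1
              ext q; simp
            simp only [e]
            refine ContinuousLinearMap.ext fun u ↦ ?_
            have h1 := hC.sum_inner_smul hE p (X p)
            conv_rhs => rw [add_apply, ContinuousLinearMap.smulRight_apply, ← h1]
            simp only [sum_apply, smul_apply, ContinuousLinearMap.smulRight_apply, add_apply,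
              Finset.smul_sum, ← Finset.sum_add_distrib, smul_eq_mul, add_smul, mul_smul]
            refine Finset.sum_congr rfl fun A _ ↦ ?_
            congr 1
            rw [smul_smul, smul_smul, mul_comm] } }
  have hDapp : ∀ X p u, D X p u = ∑ A, mvfderiv (𝓡 (k + m + 1))
        (fun q ↦ V.metric.inner q (X q) (mulInvariantVectorField (E A) q)) p u •
          mulInvariantVectorField (E A) p := fun X p u ↦ by
    change (∑ A, (mvfderiv (𝓡 (k + m + 1))
        (fun q ↦ V.metric.inner q (X q) (mulInvariantVectorField (E A) q)) p).smulRight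
          (mulInvariantVectorField (E A) p)) u = _
    rw [sum_apply]
    rfl
  have hDE : ∀ X p u B, V.metric.inner p (D X p u) (mulInvariantVectorField (E B) p) =
      mvfderiv (𝓡 (k + m + 1))
        (fun q ↦ V.metric.inner q (X q) (mulInvariantVectorField (E B) q)) p u := fun X p u B ↦ by
    rw [hDapp, map_sum, sum_apply]
    simp [hC.leftInvariant, hE.orthonormal]
  have hflat : ∀ (u : GroupLieAlgebra (𝓡 (k + m + 1)) M) (p : M),
      D (mulInvariantVectorField u) p = 0 := fun u p ↦ by
    refine ContinuousLinearMap.ext fun w ↦ ?_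
    rw [hDapp]
    refine Finset.sum_eq_zero fun A _ ↦ ?_
    simp only [hC.leftInvariant]
    rw [mvfderiv_const, zero_apply, zero_smul]
  refine ⟨D, ⟨fun p X Y hX hY u ↦ ?_, fun j p ↦ ?_, fun p u hu v hv ↦ ?_⟩, hflat⟩
  · change mvfderiv (𝓡 (k + m + 1)) (fun q ↦ V.metric.inner q (X q) (Y q)) p u = _
    have e : (fun q ↦ V.metric.inner q (X q) (Y q)) = fun q ↦ ∑ A,
        V.metric.inner q (X q) (mulInvariantVectorField (E A) q) *
        V.metric.inner q (Y q) (mulInvariantVectorField (E A) q) := by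
      ext q; exact hC.inner_eq_sum hE q _ _
    rw [e]
    refine (mvfderiv_fun_sum Finset.univ
      (f := fun A q ↦ V.metric.inner q (X q) (mulInvariantVectorField (E A) q) *
        V.metric.inner q (Y q) (mulInvariantVectorField (E A) q))
      (fun A _ ↦ (hinn hX A).mul (hinn hY A)) u).2.trans ?_
    rw [hC.inner_eq_sum hE p (D X p u), hC.inner_eq_sum hE p (X p), ← Finset.sum_add_distrib]
    refine Finset.sum_congr rfl fun A _ ↦ ?_
    rw [mvfderiv_fun_mul (hinn hX A) (hinn hY A), hDE, hDE]
    simp only [add_apply, smul_apply, smul_eq_mul]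
    ring
  · rw [← hE.inr_eq]; exact hflat _ p
  · obtain ⟨a, rfl⟩ := hC.exists_mulInvariant_eq p u
    obtain ⟨b, rfl⟩ := hC.exists_mulInvariant_eq p v
    have ha : a ∈ V.horizontal 1 := fun j ↦ by
      rw [← hC.leftInvariant p, hC.exists_T_eq j]; exact hu j
    refine hC.mem_vertical fun z hz ↦ ?_
    rw [D.torsion_apply (mdifferentiableAt_mulInvariant a p) (mdifferentiableAt_mulInvariant b p),
      hflat, hflat, zero_apply, zero_apply, sub_zero, zero_sub,
      ← mulInvariantVector_mlieBracket, ← GroupLieAlgebra.bracket_def, map_neg, neg_apply,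
      hC.leftInvariant, hC.inner_bracket_eq_zero ha hz, neg_zero]

end VRStructure

/-! ### Geodesics of a left-invariant metric -/

namespace VRStructure

variable {k m : ℕ} {M : Type*} [TopologicalSpace M]
  [ChartedSpace (EuclideanSpace ℝ (Fin (k + m + 1))) M] [IsManifold (𝓡 (k + m + 1)) ∞ M]
  {V : VRStructure k m M} [Group M]

/-- The quadratic field `Q(a)_A = g(a, [a, E_A])` of the Euler–Arnold equation `a' = Q(a)`, in the
coordinates of the frame `E`. -/
def eulerField (V : VRStructure k m M)
    (E : Fin (k + 1) ⊕ Fin m → GroupLieAlgebra (𝓡 (k + m + 1)) M)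
    (a : Fin (k + 1) ⊕ Fin m → ℝ) (A : Fin (k + 1) ⊕ Fin m) : ℝ :=
  ∑ B, ∑ C, a B * a C * V.metric.inner 1 (E B) ⁅E C, E A⁆

/-- `γ` is, on `[0, 1]`, a curve with left-trivialized velocity `∑ a_A E_A`, where `a` solves the
Euler–Arnold equation. -/
structure IsEulerCurve (V : VRStructure k m M)
    (E : Fin (k + 1) ⊕ Fin m → GroupLieAlgebra (𝓡 (k + m + 1)) M) (γ : ℝ → M)
    (a : ℝ → Fin (k + 1) ⊕ Fin m → ℝ) : Prop where
  mdifferentiableAt : ∀ t ∈ Icc (0 : ℝ) 1, MDifferentiableAt 𝓘(ℝ, ℝ) (𝓡 (k + m + 1)) γ t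
  velocity : ∀ t ∈ Icc (0 : ℝ) 1,
    curveVelocity γ t = ∑ A, a t A • mulInvariantVectorField (E A) (γ t)
  hasDerivAt : ∀ t ∈ Icc (0 : ℝ) 1, HasDerivAt a (V.eulerField E (a t)) t

variable {E : Fin (k + 1) ⊕ Fin m → GroupLieAlgebra (𝓡 (k + m + 1)) M}

theorem IsCarnot.initial_eq (hC : V.IsCarnot) (hE : V.IsLeftInvariantFrame E) {γ : ℝ → M}
    {a : ℝ → Fin (k + 1) ⊕ Fin m → ℝ} (hγ : V.IsEulerCurve E γ a) {x : M}
    {w : TangentSpace (𝓡 (k + m + 1)) x}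
    (h0 : (⟨γ 0, curveVelocity γ 0⟩ : TangentBundle (𝓡 (k + m + 1)) M) = ⟨x, w⟩) :
    γ 0 = x ∧ ∀ A, a 0 A = V.metric.inner x w (mulInvariantVectorField (E A) x) := by
  rw [TotalSpace.mk.injEq] at h0
  obtain ⟨rfl, hw⟩ := h0
  obtain rfl := eq_of_heq hw
  refine ⟨rfl, fun A ↦ ?_⟩
  rw [hγ.velocity 0 (left_mem_Icc.2 zero_le_one), map_sum, sum_apply]
  simp [hC.leftInvariant, hE.orthonormal]

variable [LieGroup (𝓡 (k + m + 1)) ∞ M]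

theorem eulerField_eq (a : Fin (k + 1) ⊕ Fin m → ℝ) (A : Fin (k + 1) ⊕ Fin m) :
    V.eulerField E a A = V.metric.inner 1 (∑ B, a B • E B) ⁅∑ C, a C • E C, E A⁆ := by
  simp only [eulerField, map_sum, sum_apply, sum_lie, smul_lie, map_smul, smul_apply,
    smul_eq_mul]
  rw [Finset.sum_comm]
  refine Finset.sum_congr rfl fun B _ ↦ ?_
  rw [Finset.mul_sum]
  exact Finset.sum_congr rfl fun C _ ↦ by ring

theorem sum_mul_eulerField (a : Fin (k + 1) ⊕ Fin m → ℝ) :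
    ∑ A, a A * V.eulerField E a A = 0 := by
  have h : V.metric.inner 1 (∑ B, a B • E B) ⁅∑ C, a C • E C, ∑ A, a A • E A⁆ = 0 := by
    rw [lie_self, map_zero]
  rw [← h]
  conv_rhs => arg 2; rw [lie_sum]
  rw [map_sum]
  refine Finset.sum_congr rfl fun A _ ↦ ?_
  rw [eulerField_eq, lie_smul, map_smul, smul_eq_mul]

/-- The energy is conserved. -/
theorem IsEulerCurve.sum_sq_eq {γ : ℝ → M} {a : ℝ → Fin (k + 1) ⊕ Fin m → ℝ}
    (hγ : V.IsEulerCurve E γ a) {t : ℝ} (ht : t ∈ Icc (0 : ℝ) 1) :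
    ∑ A, a t A ^ 2 = ∑ A, a 0 A ^ 2 := by
  have hd : ∀ s ∈ Icc (0 : ℝ) 1, HasDerivWithinAt (fun s ↦ ∑ A, a s A ^ 2) 0 (Icc 0 1) s :=
    fun s hs ↦ by
      have h1 := HasDerivAt.fun_sum (u := Finset.univ) fun A _ ↦
        ((hasDerivAt_pi.1 (hγ.hasDerivAt s hs)) A).pow 2
      refine (h1.congr_deriv ?_).hasDerivWithinAt
      have h2 := sum_mul_eulerField (V := V) (E := E) (a s)
      calc _ = 2 * ∑ A, a s A * V.eulerField E (a s) A := by
            rw [Finset.mul_sum]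
            refine Finset.sum_congr rfl fun A _ ↦ by push_cast; ring
        _ = 0 := by rw [h2, mul_zero]
  have h := (convex_Icc (0 : ℝ) 1).norm_image_sub_le_of_norm_hasDerivWithin_le (C := 0) hd
    (fun _ _ ↦ by simp) (left_mem_Icc.2 zero_le_one) ht
  rw [zero_mul, norm_le_zero_iff, sub_eq_zero] at h
  exact h

theorem IsEulerCurve.norm_le {γ : ℝ → M} {a : ℝ → Fin (k + 1) ⊕ Fin m → ℝ}
    (hγ : V.IsEulerCurve E γ a) {t : ℝ} (ht : t ∈ Icc (0 : ℝ) 1) :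
    ‖a t‖ ≤ (k + m + 1) * ‖a 0‖ := by
  rw [pi_norm_le_iff_of_nonneg (by positivity)]
  intro A
  refine abs_le_of_sq_le_sq (b := (k + m + 1) * ‖a 0‖) ?_ (by positivity)
  calc a t A ^ 2 ≤ ∑ B, a t B ^ 2 :=
        Finset.single_le_sum (f := fun B ↦ a t B ^ 2) (fun B _ ↦ sq_nonneg _) (Finset.mem_univ A)
    _ = ∑ B, a 0 B ^ 2 := hγ.sum_sq_eq ht
    _ ≤ ∑ B : Fin (k + 1) ⊕ Fin m, ‖a 0‖ ^ 2 := Finset.sum_le_sum fun B _ ↦ by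
        rw [← sq_abs]; gcongr; exact norm_le_pi_norm (a 0) B
    _ = (k + m + 1) * ‖a 0‖ ^ 2 := by
        simp only [Finset.sum_const, Finset.card_univ, Fintype.card_sum, Fintype.card_fin,
          nsmul_eq_mul]
        push_cast; ring
    _ ≤ ((k + m + 1) * ‖a 0‖) ^ 2 := by
        rw [mul_pow]; gcongr
        have : (1 : ℝ) ≤ k + m + 1 := by
          have h1 : (0 : ℝ) ≤ k := by positivity
          have h2 : (0 : ℝ) ≤ m := by positivity
          linarith
        nlinarith

/-- Geodesics of a left-invariant metric solve the Euler–Arnold equation. -/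
theorem IsCarnot.isEulerCurve_of_isGeodesicOn (hC : V.IsCarnot) (hE : V.IsLeftInvariantFrame E)
    {γ : ℝ → M} (hγ : V.IsGeodesicOn γ (Icc 0 1)) :
    V.IsEulerCurve E γ fun t A ↦
      V.metric.inner (γ t) (curveVelocity γ t) (mulInvariantVectorField (E A) (γ t)) := by
  obtain ⟨D, hD, hγ⟩ := hγ
  refine ⟨fun t ht ↦ ?_, fun t _ ↦ (hC.sum_inner_smul hE _ _).symm, fun t ht ↦ ?_⟩
  · obtain ⟨X, -, hX, -⟩ := hγ t ht
    exact hX.self_of_nhds.mdifferentiableAt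
  obtain ⟨X, hXc, hX, hDX⟩ := hγ t ht
  have hvel : ∀ᶠ s in 𝓝 t, curveVelocity γ s = X (γ s) := by
    filter_upwards [hX] with s hs
    have := congrArg (fun L : ℝ →L[ℝ] TangentSpace (𝓡 (k + m + 1)) (γ s) ↦ L 1) hs.mfderiv
    refine this.trans ?_
    exact one_smul ℝ (X (γ s))
  have hXd := hXc.mdifferentiableAt one_ne_zero
  rw [hasDerivAt_pi]
  intro A
  have hEd := mdifferentiableAt_mulInvariant (E A) (γ t)
  have h1 := hasDerivAt_comp_curve (mdifferentiableAt_metric_inner V.metric hXd hEd)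
    hX.self_of_nhds.mdifferentiableAt
  rw [hvel.self_of_nhds] at h1
  have h2 : HasDerivAt (fun s ↦ V.metric.inner (γ s) (curveVelocity γ s)
      (mulInvariantVectorField (E A) (γ s))) _ t := h1.congr_of_eventuallyEq (by
    filter_upwards [hvel] with s hs
    rw [hs])
  refine h2.congr_deriv ?_
  refine (hD.metric (γ t) X _ hXd hEd (X (γ t))).trans ?_
  rw [hDX, map_zero, zero_apply, zero_add]
  set v : GroupLieAlgebra (𝓡 (k + m + 1)) M :=
    ∑ B, V.metric.inner (γ t) (X (γ t)) (mulInvariantVectorField (E B) (γ t)) • E B with hv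
  have hvX : mulInvariantVectorField v (γ t) = X (γ t) := by
    rw [hv, mulInvariantVectorField_sum, hC.sum_inner_smul hE]
  have hvd := mdifferentiableAt_mulInvariant v (γ t)
  have h3 := D.torsion_apply hvd hEd
  rw [hD.torsion, zero_apply, zero_apply, hvX, ← mulInvariantVector_mlieBracket,
    ← GroupLieAlgebra.bracket_def, sub_sub, eq_comm, sub_eq_zero] at h3
  have h4 := hD.metric.inner_add_eq_zero hvd hvd (.of_forall fun q ↦ hC.leftInvariant q v v)
    (mulInvariantVectorField (E A) (γ t))
  rw [V.inner_comm (γ t) (mulInvariantVectorField v (γ t)), ← two_mul, mul_eq_zero,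
    or_iff_right two_ne_zero, hvX, V.inner_comm] at h4
  rw [h3, map_add, h4, zero_add, eulerField_eq]
  simp only [hvel.self_of_nhds]
  change _ = V.metric.inner 1 v ⁅v, E A⁆
  rw [← hC.leftInvariant (γ t) v, hvX]

/-- Integral curves of horizontal left-invariant fields solve the Euler–Arnold equation. -/
theorem IsCarnot.isEulerCurve_of_horizontal (hC : V.IsCarnot) (hE : V.IsLeftInvariantFrame E)
    {γ : ℝ → M} {u : GroupLieAlgebra (𝓡 (k + m + 1)) M} (hu : u ∈ V.horizontal 1)
    (hγ : ∀ t ∈ Icc (0 : ℝ) 1, MDifferentiableAt 𝓘(ℝ, ℝ) (𝓡 (k + m + 1)) γ t)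
    (hγu : ∀ t ∈ Icc (0 : ℝ) 1, curveVelocity γ t = mulInvariantVectorField u (γ t)) :
    V.IsEulerCurve E γ fun _ A ↦ V.metric.inner 1 u (E A) := by
  refine ⟨hγ, fun t ht ↦ ?_, fun t _ ↦ ?_⟩
  · rw [hγu t ht, ← mulInvariantVectorField_sum, hE.sum_inner_smul]
  · refine (hasDerivAt_const t _).congr_deriv ?_
    ext A
    rw [eulerField_eq, hE.sum_inner_smul, V.inner_comm, hC.inner_bracket_eq_zero hu hu]
    rfl

end VRStructure

namespace VRStructure

variable {k m : ℕ} {M : Type*} [TopologicalSpace M]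
  [ChartedSpace (EuclideanSpace ℝ (Fin (k + m + 1))) M] [IsManifold (𝓡 (k + m + 1)) ∞ M]
  {V : VRStructure k m M} [Group M]
  {E : Fin (k + 1) ⊕ Fin m → GroupLieAlgebra (𝓡 (k + m + 1)) M}

omit [Group M] in
theorem chartCoord_congr {x p q : M} (h : p = q)
    (X : (q : M) → TangentSpace (𝓡 (k + m + 1)) q) :
    chartCoord x p (X p) = chartCoord x q (X q) := by
  subst h; rfl

/-- The Euler–Arnold system in the chart at `x`, for the position and the left-trivialized
velocity. -/
def eulerSystem (V : VRStructure k m M)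
    (E : Fin (k + 1) ⊕ Fin m → GroupLieAlgebra (𝓡 (k + m + 1)) M) (x : M)
    (z : EuclideanSpace ℝ (Fin (k + m + 1)) × (Fin (k + 1) ⊕ Fin m → ℝ)) :
    EuclideanSpace ℝ (Fin (k + m + 1)) × (Fin (k + 1) ⊕ Fin m → ℝ) :=
  (∑ A, z.2 A • chartCoord x ((extChartAt (𝓡 (k + m + 1)) x).symm z.1)
    (mulInvariantVectorField (E A) ((extChartAt (𝓡 (k + m + 1)) x).symm z.1)), V.eulerField E z.2)

theorem IsEulerCurve.hasDerivAt_eulerSystem {γ : ℝ → M} {a : ℝ → Fin (k + 1) ⊕ Fin m → ℝ}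
    (hγ : V.IsEulerCurve E γ a) {x : M} {t : ℝ} (ht : t ∈ Icc (0 : ℝ) 1)
    (hx : γ t ∈ (chartAt (EuclideanSpace ℝ (Fin (k + m + 1))) x).source) :
    HasDerivAt (fun t ↦ (extChartAt (𝓡 (k + m + 1)) x (γ t), a t))
      (V.eulerSystem E x (extChartAt (𝓡 (k + m + 1)) x (γ t), a t)) t := by
  refine HasDerivAt.prodMk ?_ (hγ.hasDerivAt t ht)
  refine (hasDerivAt_extChartAt_curve hx (hγ.mdifferentiableAt t ht)).congr_deriv ?_
  rw [hγ.velocity t ht, map_sum]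
  have hs : (extChartAt (𝓡 (k + m + 1)) x).symm (extChartAt (𝓡 (k + m + 1)) x (γ t)) = γ t :=
    (extChartAt (𝓡 (k + m + 1)) x).left_inv (by rwa [extChartAt_source])
  refine Finset.sum_congr rfl fun A _ ↦ (map_smul _ _ _).trans ?_
  exact congrArg (fun v ↦ a t A • v) (chartCoord_congr hs (mulInvariantVectorField (E A))).symm

variable [LieGroup (𝓡 (k + m + 1)) ∞ M]

/-- The linearization of the Euler–Arnold system at rest. -/
theorem hasStrictFDerivAt_eulerSystem (V : VRStructure k m M)
    (E : Fin (k + 1) ⊕ Fin m → GroupLieAlgebra (𝓡 (k + m + 1)) M) (x : M) :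
    ∃ P : (EuclideanSpace ℝ (Fin (k + m + 1)) × (Fin (k + 1) ⊕ Fin m → ℝ)) →L[ℝ]
      (EuclideanSpace ℝ (Fin (k + m + 1)) × (Fin (k + 1) ⊕ Fin m → ℝ)),
      HasStrictFDerivAt (V.eulerSystem E x) P (extChartAt (𝓡 (k + m + 1)) x x, 0) ∧
      ∀ y b, P (y, b) = (∑ A, b A • chartCoord x x (mulInvariantVectorField (E A) x), 0) := by
  set c : Fin (k + 1) ⊕ Fin m → EuclideanSpace ℝ (Fin (k + m + 1)) →
    EuclideanSpace ℝ (Fin (k + m + 1)) := fun A y ↦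
      chartCoord x ((extChartAt (𝓡 (k + m + 1)) x).symm y)
        (mulInvariantVectorField (E A) ((extChartAt (𝓡 (k + m + 1)) x).symm y)) with hc
  have hcx : ∀ A, c A (extChartAt (𝓡 (k + m + 1)) x x) =
      chartCoord x x (mulInvariantVectorField (E A) x) := fun A ↦
    chartCoord_congr (extChartAt_to_inv x) (mulInvariantVectorField (E A))
  have hcd : ∀ A, HasStrictFDerivAt (c A) (fderiv ℝ (c A) (extChartAt (𝓡 (k + m + 1)) x x))
      (extChartAt (𝓡 (k + m + 1)) x x) := fun A ↦
    (contDiffAt_chartCoord (n := 2) ENat.LEInfty.out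
      (contMDiff_mulInvariantVectorField_two (E A)).contMDiffAt).hasStrictFDerivAt (by simp)
  have hz2 : ∀ A, HasStrictFDerivAt
      (fun z : EuclideanSpace ℝ (Fin (k + m + 1)) × (Fin (k + 1) ⊕ Fin m → ℝ) ↦ z.2 A)
      ((ContinuousLinearMap.proj A).comp (ContinuousLinearMap.snd ℝ _ _))
      (extChartAt (𝓡 (k + m + 1)) x x, 0) := fun A ↦
    ((ContinuousLinearMap.proj (R := ℝ) (φ := fun _ : Fin (k + 1) ⊕ Fin m ↦ ℝ) A).comp
      (ContinuousLinearMap.snd ℝ (EuclideanSpace ℝ (Fin (k + m + 1)))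
        (Fin (k + 1) ⊕ Fin m → ℝ))).hasStrictFDerivAt
  have h1 := HasStrictFDerivAt.fun_sum (u := Finset.univ) fun A _ ↦
    (hz2 A).smul ((hcd A).comp (extChartAt (𝓡 (k + m + 1)) x x,
      (0 : Fin (k + 1) ⊕ Fin m → ℝ)) hasStrictFDerivAt_fst)
  have h2 : ∀ A, HasStrictFDerivAt
      (fun z : EuclideanSpace ℝ (Fin (k + m + 1)) × (Fin (k + 1) ⊕ Fin m → ℝ) ↦
        V.eulerField E z.2 A) 0 (extChartAt (𝓡 (k + m + 1)) x x, 0) := fun A ↦ by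
    have h := HasStrictFDerivAt.fun_sum (u := Finset.univ) fun B _ ↦
      HasStrictFDerivAt.fun_sum (u := Finset.univ) fun C _ ↦
        (((hz2 B).mul (hz2 C)).mul_const (V.metric.inner 1 (E B) ⁅E C, E A⁆))
    refine h.congr_fderiv ?_
    simp
  refine ⟨_, h1.prodMk (hasStrictFDerivAt_pi.2 h2), fun y b ↦ ?_⟩
  refine Prod.ext ?_ ?_
  · simp only [ContinuousLinearMap.prod_apply, sum_apply,
      ContinuousLinearMap.smulRight_apply, Pi.zero_apply, zero_smul, zero_add, hcx,
      ContinuousLinearMap.comp_apply, ContinuousLinearMap.proj_apply, ContinuousLinearMap.coe_snd']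
  · ext A; simp

/-- Slow curves stay near their initial point up to time one: the energy is conserved, so the speed
in the chart is bounded, and there is no first exit time. -/
theorem exists_isEulerCurve_mem_ball [T2Space M] (V : VRStructure k m M)
    (E : Fin (k + 1) ⊕ Fin m → GroupLieAlgebra (𝓡 (k + m + 1)) M) (x : M) {ε : ℝ} (hε : 0 < ε) :
    ∃ δ > 0, ∀ γ a, V.IsEulerCurve E γ a → γ 0 = x → ‖a 0‖ < δ → ∀ t ∈ Icc (0 : ℝ) 1,
      γ t ∈ (chartAt (EuclideanSpace ℝ (Fin (k + m + 1))) x).source ∧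
      (extChartAt (𝓡 (k + m + 1)) x (γ t), a t) ∈
        Metric.ball (extChartAt (𝓡 (k + m + 1)) x x, (0 : Fin (k + 1) ⊕ Fin m → ℝ)) ε := by
  set c : Fin (k + 1) ⊕ Fin m → EuclideanSpace ℝ (Fin (k + m + 1)) →
    EuclideanSpace ℝ (Fin (k + m + 1)) := fun A y ↦
      chartCoord x ((extChartAt (𝓡 (k + m + 1)) x).symm y)
        (mulInvariantVectorField (E A) ((extChartAt (𝓡 (k + m + 1)) x).symm y)) with hc
  set x₀ := extChartAt (𝓡 (k + m + 1)) x x with hx₀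
  have hcc : ∀ A, ContinuousAt (c A) x₀ := fun A ↦
    (contDiffAt_chartCoord (n := 2) ENat.LEInfty.out
      (contMDiff_mulInvariantVectorField_two (E A)).contMDiffAt).continuousAt
  have hbd : ∀ᶠ y in 𝓝 x₀, ∀ A, ‖c A y‖ < ‖c A x₀‖ + 1 := by
    rw [eventually_all]
    exact fun A ↦ (hcc A).norm.eventually_lt continuousAt_const (lt_add_one _)
  obtain ⟨r, hr, hrb⟩ := Metric.eventually_nhds_iff_ball.1
    (hbd.and (extChartAt_target_mem_nhds (I := 𝓡 (k + m + 1)) x))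
  -- a bound for the speed in the chart
  set C := (∑ A, (‖c A x₀‖ + 1)) * (k + m + 1) with hC
  have hC0 : 0 ≤ C := by positivity
  set R := min r ε with hR
  have hR0 : 0 < R := lt_min hr hε
  refine ⟨R / (C + (k + m + 1)) / 2, by positivity, fun γ a hγ h0 ha ↦ ?_⟩
  have hpos : 0 < C + (k + m + 1) := by positivity
  have hCa : C * ‖a 0‖ ≤ R / 2 ∧ (k + m + 1) * ‖a 0‖ ≤ R / 2 := by
    have h1 : (C + (k + m + 1)) * ‖a 0‖ ≤ R / 2 := by
      calc (C + (k + m + 1)) * ‖a 0‖ ≤ (C + (k + m + 1)) * (R / (C + (k + m + 1)) / 2) := by gcongr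
        _ = R / 2 := by field_simp
    have h2 : (0 : ℝ) ≤ (k + m + 1) * ‖a 0‖ := by positivity
    have h3 : 0 ≤ C * ‖a 0‖ := by positivity
    constructor <;> nlinarith
  set U : Set M := (extChartAt (𝓡 (k + m + 1)) x).source ∩
    extChartAt (𝓡 (k + m + 1)) x ⁻¹' Metric.ball x₀ R with hU
  have hUo : IsOpen U := isOpen_extChartAt_preimage' x Metric.isOpen_ball
  have hγc : ContinuousOn γ (Icc 0 1) := fun t ht ↦
    (hγ.mdifferentiableAt t ht).continuousAt.continuousWithinAt
  -- as long as the curve stays in `U`, it moves slowly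
  have hslow : ∀ t ∈ Icc (0 : ℝ) 1, (∀ s ∈ Icc 0 t, γ s ∈ U) →
      ‖extChartAt (𝓡 (k + m + 1)) x (γ t) - x₀‖ ≤ R / 2 := fun t ht hs ↦ by
    have hd : ∀ s ∈ Icc 0 t, HasDerivWithinAt (fun s ↦ extChartAt (𝓡 (k + m + 1)) x (γ s))
        (∑ A, a s A • c A (extChartAt (𝓡 (k + m + 1)) x (γ s))) (Icc 0 t) s := fun s hs' ↦ by
      have h1 := hγ.hasDerivAt_eulerSystem (x := x) (t := s) ⟨hs'.1, hs'.2.trans ht.2⟩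
        (by rw [← extChartAt_source (I := 𝓡 (k + m + 1))]; exact (hs s hs').1)
      exact (hasFDerivAt_fst.comp_hasDerivAt s h1).hasDerivWithinAt
    have hb : ∀ s ∈ Icc 0 t, ‖∑ A, a s A • c A (extChartAt (𝓡 (k + m + 1)) x (γ s))‖ ≤ R / 2 :=
      fun s hs' ↦ by
        have hs1 : s ∈ Icc (0 : ℝ) 1 := ⟨hs'.1, hs'.2.trans ht.2⟩
        have hy := (hrb _ (Metric.ball_subset_ball (min_le_left _ _) (hs s hs').2)).1
        calc _ ≤ ∑ A, ‖a s‖ * (‖c A x₀‖ + 1) := by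
              refine (norm_sum_le _ _).trans (Finset.sum_le_sum fun A _ ↦ ?_)
              rw [norm_smul]
              gcongr
              · exact norm_le_pi_norm (a s) A
              · exact (hy A).le
          _ = (∑ A, (‖c A x₀‖ + 1)) * ‖a s‖ := by rw [← Finset.mul_sum, mul_comm]
          _ ≤ (∑ A, (‖c A x₀‖ + 1)) * ((k + m + 1) * ‖a 0‖) := by
              gcongr; exact hγ.norm_le hs1
          _ = C * ‖a 0‖ := by rw [hC]; ring
          _ ≤ R / 2 := hCa.1
    have h := (convex_Icc 0 t).norm_image_sub_le_of_norm_hasDerivWithin_le hd hb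
      (left_mem_Icc.2 ht.1) (right_mem_Icc.2 ht.1)
    rw [h0, sub_zero, Real.norm_of_nonneg ht.1] at h
    exact h.trans (mul_le_of_le_one_right (by positivity) ht.2)
  -- so there is no first exit time
  have hstay : ∀ t ∈ Icc (0 : ℝ) 1, γ t ∈ U := by
    by_contra! hex
    obtain ⟨t₁, ht₁, ht₁U⟩ := hex
    have hcomp : IsCompact (Icc (0 : ℝ) 1 ∩ γ ⁻¹' Uᶜ) :=
      isCompact_Icc.of_isClosed_subset
        (hγc.preimage_isClosed_of_isClosed isClosed_Icc hUo.isClosed_compl) inter_subset_left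
    obtain ⟨t₀, ⟨ht₀, ht₀U⟩, hmin⟩ := hcomp.exists_isLeast ⟨t₁, ht₁, ht₁U⟩
    have hbefore : ∀ s ∈ Ico 0 t₀, γ s ∈ U := fun s hs ↦ by
      by_contra hsU
      exact absurd (hmin ⟨⟨hs.1, hs.2.le.trans ht₀.2⟩, hsU⟩) (not_le.2 hs.2)
    have h0U : γ 0 ∈ U := by
      rw [h0]; exact ⟨mem_extChartAt_source x, Metric.mem_ball_self hR0⟩
    have ht₀pos : 0 < t₀ := ht₀.1.lt_of_ne fun h ↦ ht₀U (h ▸ h0U)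
    have hsub : Metric.closedBall x₀ (R / 2) ⊆ (extChartAt (𝓡 (k + m + 1)) x).target := fun y hy ↦
      (hrb y (Metric.closedBall_subset_ball (by linarith [min_le_left r ε]) hy)).2
    have hK : IsCompact ((extChartAt (𝓡 (k + m + 1)) x).symm '' Metric.closedBall x₀ (R / 2)) :=
      (isCompact_closedBall x₀ (R / 2)).image_of_continuousOn
        ((continuousOn_extChartAt_symm x).mono hsub)
    have hmem : ∀ s ∈ Ico 0 t₀, γ s ∈
        (extChartAt (𝓡 (k + m + 1)) x).symm '' Metric.closedBall x₀ (R / 2) := fun s hs ↦ by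
      have h1 := hslow s ⟨hs.1, hs.2.le.trans ht₀.2⟩ fun s' hs' ↦
        hbefore s' ⟨hs'.1, hs'.2.trans_lt hs.2⟩
      exact ⟨_, by rwa [mem_closedBall_iff_norm],
        (extChartAt (𝓡 (k + m + 1)) x).left_inv (hbefore s hs).1⟩
    have hlim : γ t₀ ∈ (extChartAt (𝓡 (k + m + 1)) x).symm '' Metric.closedBall x₀ (R / 2) := by
      have hcont : Tendsto γ (𝓝[<] t₀) (𝓝 (γ t₀)) :=
        (hγ.mdifferentiableAt t₀ ht₀).continuousAt.tendsto.mono_left nhdsWithin_le_nhds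
      refine hK.isClosed.mem_of_tendsto hcont ?_
      filter_upwards [Ioo_mem_nhdsLT ht₀pos] with s hs using hmem s ⟨hs.1.le, hs.2⟩
    obtain ⟨y, hy, hyt⟩ := hlim
    refine ht₀U ⟨?_, ?_⟩
    · rw [← hyt]; exact (extChartAt (𝓡 (k + m + 1)) x).map_target (hsub hy)
    · rw [mem_preimage, ← hyt, (extChartAt (𝓡 (k + m + 1)) x).right_inv (hsub hy)]
      exact Metric.closedBall_subset_ball (by linarith) hy
  intro t ht
  refine ⟨by rw [← extChartAt_source (I := 𝓡 (k + m + 1))]; exact (hstay t ht).1, ?_⟩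
  rw [← ball_prod_same]
  refine ⟨Metric.ball_subset_ball (min_le_right _ _) (hstay t ht).2, ?_⟩
  rw [mem_ball_zero_iff]
  calc ‖a t‖ ≤ (k + m + 1) * ‖a 0‖ := hγ.norm_le ht
    _ ≤ R / 2 := hCa.2
    _ < R := by linarith
    _ ≤ ε := min_le_right _ _

/-- The exponential map at `x` is, in the chart at `x`, the identity to first order; also for
differences. -/
theorem IsCarnot.exists_isEulerCurve_sub_le [T2Space M] (hC : V.IsCarnot)
    (hE : V.IsLeftInvariantFrame E) (x : M) {κ : ℝ} (hκ : 0 < κ) :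
    ∃ δ > 0, ∀ (w₁ w₂ : EuclideanSpace ℝ (Fin (k + m + 1))) (γ₁ γ₂ : ℝ → M)
      (a₁ a₂ : ℝ → Fin (k + 1) ⊕ Fin m → ℝ), ‖w₁‖ < δ → ‖w₂‖ < δ →
      V.IsEulerCurve E γ₁ a₁ → V.IsEulerCurve E γ₂ a₂ →
      (⟨γ₁ 0, curveVelocity γ₁ 0⟩ : TangentBundle (𝓡 (k + m + 1)) M) = ⟨x, w₁⟩ →
      (⟨γ₂ 0, curveVelocity γ₂ 0⟩ : TangentBundle (𝓡 (k + m + 1)) M) = ⟨x, w₂⟩ →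
      ‖extChartAt (𝓡 (k + m + 1)) x (γ₁ 1) - extChartAt (𝓡 (k + m + 1)) x (γ₂ 1) - (w₁ - w₂)‖ ≤
        κ * ‖w₁ - w₂‖ := by
  obtain ⟨P, hP, hPapp⟩ := hasStrictFDerivAt_eulerSystem V E x
  -- the coordinates of a vector in the frame
  let ℓ : (Fin (k + 1) ⊕ Fin m) → EuclideanSpace ℝ (Fin (k + m + 1)) →L[ℝ] ℝ := fun A ↦
    V.metric.inner x (mulInvariantVectorField (E A) x)
  let L : EuclideanSpace ℝ (Fin (k + m + 1)) →L[ℝ] (Fin (k + 1) ⊕ Fin m → ℝ) :=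
    ContinuousLinearMap.pi ℓ
  have hL : ∀ w : EuclideanSpace ℝ (Fin (k + m + 1)), ∑ A, L w A •
      chartCoord x x (mulInvariantVectorField (E A) x) = w := fun w ↦ by
    have h := hC.sum_inner_smul hE x w
    refine Eq.trans (Finset.sum_congr rfl fun A _ ↦ ?_) h
    rw [V.inner_comm x w]
    exact congrArg (fun v : EuclideanSpace ℝ (Fin (k + m + 1)) ↦ L w A • v) (chartCoord_self x _)
  have hPP : P.comp P = 0 := by
    refine ContinuousLinearMap.ext fun z ↦ ?_
    obtain ⟨y, b⟩ := z
    rw [ContinuousLinearMap.comp_apply, hPapp, hPapp]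
    simp
  obtain ⟨ε, hε, hflow⟩ := exists_ball_flow_sub_le hP hPP
    (κ := κ / (‖L‖ + 1)) (by positivity)
  obtain ⟨δ, hδ, hstay⟩ := exists_isEulerCurve_mem_ball V E x hε
  refine ⟨δ / (‖L‖ + 1), by positivity, fun w₁ w₂ γ₁ γ₂ a₁ a₂ hw₁ hw₂ h₁ h₂ h₁0 h₂0 ↦ ?_⟩
  have hLlt : ∀ w : EuclideanSpace ℝ (Fin (k + m + 1)), ‖w‖ < δ / (‖L‖ + 1) → ‖L w‖ < δ :=
    fun w hw ↦ by
      rw [lt_div_iff₀ (by positivity)] at hw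
      refine (L.le_opNorm w).trans_lt (lt_of_le_of_lt ?_ hw)
      nlinarith [norm_nonneg w]
  have hinit : ∀ {w : EuclideanSpace ℝ (Fin (k + m + 1))} {γ : ℝ → M}
      {a : ℝ → Fin (k + 1) ⊕ Fin m → ℝ}, V.IsEulerCurve E γ a →
      (⟨γ 0, curveVelocity γ 0⟩ : TangentBundle (𝓡 (k + m + 1)) M) = ⟨x, w⟩ →
      γ 0 = x ∧ a 0 = L w := fun {w γ a} hγ h0 ↦ by
    have h := hC.initial_eq hE hγ h0
    exact ⟨h.1, funext fun A ↦ (h.2 A).trans (V.inner_comm x _ _)⟩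
  obtain ⟨hx₁, ha₁⟩ := hinit h₁ h₁0
  obtain ⟨hx₂, ha₂⟩ := hinit h₂ h₂0
  have hs₁ := hstay γ₁ a₁ h₁ hx₁ (by rw [ha₁]; exact hLlt w₁ hw₁)
  have hs₂ := hstay γ₂ a₂ h₂ hx₂ (by rw [ha₂]; exact hLlt w₂ hw₂)
  have h := hflow _ _ (fun t ht ↦ h₁.hasDerivAt_eulerSystem ht (hs₁ t ht).1)
    (fun t ht ↦ h₂.hasDerivAt_eulerSystem ht (hs₂ t ht).1)
    (fun t ht ↦ (hs₁ t ht).2) (fun t ht ↦ (hs₂ t ht).2)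
  simp only [hx₁, hx₂, ha₁, ha₂, Prod.mk_sub_mk, sub_self, ← map_sub, hPapp, hL] at h
  have h3 := (norm_fst_le _).trans h
  simp only [sub_zero, Prod.norm_mk, norm_zero] at h3
  rw [max_eq_right (norm_nonneg _)] at h3
  refine h3.trans ?_
  calc κ / (‖L‖ + 1) * ‖L (w₁ - w₂)‖ ≤ κ / (‖L‖ + 1) * ((‖L‖ + 1) * ‖w₁ - w₂‖) := by
        gcongr
        refine (L.le_opNorm _).trans ?_
        gcongr
        linarith
    _ = κ * ‖w₁ - w₂‖ := by field_simp

end VRStructure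

/-! ### The horizontal normal field of a hypersurface in a Carnot group -/

section Chart

variable {d : ℕ} {M : Type*} [TopologicalSpace M] [ChartedSpace (EuclideanSpace ℝ (Fin d)) M]
  [IsManifold (𝓡 d) ∞ M]

theorem contMDiffAt_mvfderiv_apply {f : M → ℝ} {X : (q : M) → TangentSpace (𝓡 d) q} {p : M}
    (hf : ContMDiffAt (𝓡 d) 𝓘(ℝ, ℝ) 2 f p)
    (hX : ContMDiffAt (𝓡 d) (𝓡 d).tangent 1 (fun q ↦ (⟨q, X q⟩ : TangentBundle (𝓡 d) M)) p) :
    ContMDiffAt (𝓡 d) 𝓘(ℝ, ℝ) 1 (fun q ↦ mvfderiv (𝓡 d) f q (X q)) p := by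
  set F := f ∘ (extChartAt (𝓡 d) p).symm with hFdef
  have hF : ContDiffAt ℝ 2 F (extChartAt (𝓡 d) p p) :=
    contDiffAt_comp_extChartAt_symm ENat.LEInfty.out (mem_extChartAt_target p)
      (by rw [extChartAt_to_inv]; exact hf)
  have hF' : ContDiffAt ℝ 1 (fderiv ℝ F) (extChartAt (𝓡 d) p p) :=
    hF.fderiv_right (by norm_num)
  have h1 : ContMDiffAt (𝓡 d) 𝓘(ℝ, EuclideanSpace ℝ (Fin d) →L[ℝ] ℝ) 1
      (fun q ↦ fderiv ℝ F (extChartAt (𝓡 d) p q)) p :=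
    ContMDiffAt.comp (g := fderiv ℝ F) p hF'.contMDiffAt
      ((contMDiffAt_extChartAt (I := 𝓡 d) (n := ∞) (x := p)).of_le (by norm_num))
  have h2 := contMDiffAt_chartCoord (by norm_num) hX
  refine (h1.clm_apply h2).congr_of_eventuallyEq ?_
  filter_upwards [(chartAt (EuclideanSpace ℝ (Fin d)) p).open_source.mem_nhds (mem_chart_source _ p),
    (continuousAt_extChartAt (I := 𝓡 d) p).eventually (hF.eventually (by simp))] with q hq hFq
  have h3 := HasMFDerivAt.comp (I' := 𝓘(ℝ, EuclideanSpace ℝ (Fin d))) (I'' := 𝓘(ℝ, ℝ)) q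
    (hFq.differentiableAt (by simp)).hasFDerivAt.hasMFDerivAt
    (hasMFDerivAt_extChartAt_chartCoord hq)
  have h4 : f =ᶠ[𝓝 q] F ∘ extChartAt (𝓡 d) p := by
    filter_upwards [(chartAt (EuclideanSpace ℝ (Fin d)) p).open_source.mem_nhds hq] with y hy
    have : (extChartAt (𝓡 d) p).symm (extChartAt (𝓡 d) p y) = y :=
      (extChartAt (𝓡 d) p).left_inv (by rwa [extChartAt_source])
    simp only [hFdef, Function.comp_apply, this]
  exact congrArg (fun L : TangentSpace (𝓡 d) q →L[ℝ] ℝ ↦ L (X q))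
    (h3.congr_of_eventuallyEq h4).mfderiv

end Chart

namespace VRStructure

variable {k m : ℕ} {M : Type*} [TopologicalSpace M]
  [ChartedSpace (EuclideanSpace ℝ (Fin (k + m + 1))) M] [IsManifold (𝓡 (k + m + 1)) ∞ M]
  {V : VRStructure k m M}

theorem inner_horizontalPart_of_mem (V : VRStructure k m M) {p : M}
    {u : TangentSpace (𝓡 (k + m + 1)) p} (hu : u ∈ V.horizontal p)
    (w : TangentSpace (𝓡 (k + m + 1)) p) :
    V.metric.inner p u (V.horizontalPart p w) = V.metric.inner p u w := by
  rw [horizontalPart, map_sub, map_sum, Finset.sum_eq_zero, sub_zero]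
  intro j _
  rw [map_smul, hu j, smul_zero]

/-- `f` is a defining function of the hypersurface `S` on the open set `U`, and the horizontal unit
field `N` has the direction of the horizontal gradient of `f`. -/
structure IsDefiningPair (V : VRStructure k m M) (S U : Set M) (f : M → ℝ)
    (N : (q : M) → TangentSpace (𝓡 (k + m + 1)) q) : Prop where
  isOpen : IsOpen U
  inter_eq : S ∩ U = {q ∈ U | f q = 0}
  contMDiffAt : ∀ q ∈ U, ContMDiffAt (𝓡 (k + m + 1)) 𝓘(ℝ, ℝ) 2 f q
  contMDiffAt_normal : ∀ q ∈ U, ContMDiffAt (𝓡 (k + m + 1)) (𝓡 (k + m + 1)).tangent 1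
    (fun q ↦ (⟨q, N q⟩ : TangentBundle (𝓡 (k + m + 1)) M)) q
  mem : ∀ q ∈ U, N q ∈ V.horizontal q
  unit : ∀ q ∈ U, V.metric.inner q (N q) (N q) = 1
  deriv : ∀ q ∈ U, ∃ c : ℝ, c ≠ 0 ∧ ∀ u ∈ V.horizontal q,
    mvfderiv (𝓡 (k + m + 1)) f q u = c * V.metric.inner q u (N q)

theorem IsCarnot.exists_isDefiningPair [Group M] [LieGroup (𝓡 (k + m + 1)) ∞ M] (hC : V.IsCarnot)
    {S : Set M} (hS : IsC2Hypersurface (k + m + 1) S) {p : M} (hp : p ∈ S)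
    (hnc : V.IsNoncharacteristicAt S p) : ∃ U f N, p ∈ U ∧ V.IsDefiningPair S U f N := by
  obtain ⟨E, hE⟩ := hC.exists_frame
  obtain ⟨W, f, hW, hpW, hf, hdf, hSW⟩ := hS p hp
  have hfq : ∀ q ∈ W, ContMDiffAt (𝓡 (k + m + 1)) 𝓘(ℝ, ℝ) 2 f q := fun q hq ↦
    hf.contMDiffAt (hW.mem_nhds hq)
  -- the horizontal gradient
  let N₀ : (q : M) → TangentSpace (𝓡 (k + m + 1)) q := fun q ↦ V.horizontalPart q
    (∑ A, mvfderiv (𝓡 (k + m + 1)) f q (mulInvariantVectorField (E A) q) •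
      mulInvariantVectorField (E A) q)
  have hN₀ : ∀ q, ∀ u ∈ V.horizontal q,
      mvfderiv (𝓡 (k + m + 1)) f q u = V.metric.inner q u (N₀ q) := fun q u hu ↦ by
    conv_lhs => rw [← hC.sum_inner_smul hE q u]
    rw [V.inner_horizontalPart_of_mem hu, map_sum, map_sum]
    exact Finset.sum_congr rfl fun A _ ↦ by
      rw [map_smul, map_smul, smul_eq_mul, smul_eq_mul, mul_comm]
  have hN₀c : ∀ q ∈ W, ContMDiffAt (𝓡 (k + m + 1)) (𝓡 (k + m + 1)).tangent 1
      (fun q ↦ (⟨q, N₀ q⟩ : TangentBundle (𝓡 (k + m + 1)) M)) q := fun q hq ↦ by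
    refine V.contMDiffAt_horizontalPart (by norm_num) (ContMDiffAt.sum_section fun A _ ↦ ?_)
    have hEA : ContMDiffAt (𝓡 (k + m + 1)) (𝓡 (k + m + 1)).tangent 1
        (fun q ↦ (⟨q, mulInvariantVectorField (E A) q⟩ : TangentBundle (𝓡 (k + m + 1)) M)) q :=
      (contMDiff_mulInvariantVectorField_two (E A)).contMDiffAt.of_le one_le_two
    exact (contMDiffAt_mvfderiv_apply (hfq q hq) hEA).smul_section hEA
  let r : M → ℝ := fun q ↦ V.metric.inner q (N₀ q) (N₀ q)
  have hr : ∀ q ∈ W, ContMDiffAt (𝓡 (k + m + 1)) 𝓘(ℝ, ℝ) 1 r q := fun q hq ↦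
    contMDiffAt_metric_inner V.metric (by norm_num) (hN₀c q hq) (hN₀c q hq)
  have hrp : N₀ p ≠ 0 := fun h0 ↦ hnc fun u hu ↦ by
    refine mem_tangentVectors_of_mfderiv_eq_zero hW hSW hpW hp (hfq p hpW) (hdf p hpW) ?_
    refine (hN₀ p u hu).trans ?_
    rw [h0, map_zero]
    rfl
  have hrc : ContinuousOn r W := fun q hq ↦ (hr q hq).continuousAt.continuousWithinAt
  have hin : ∀ q ∈ W ∩ r ⁻¹' Ioi 0, ContMDiffAt (𝓡 (k + m + 1)) 𝓘(ℝ, ℝ) 1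
      (fun q ↦ (√(r q))⁻¹) q := fun q hq ↦ by
    have h0 : 0 < r q := hq.2
    have h2 : ContDiffAt ℝ 1 (fun x : ℝ ↦ (√x)⁻¹) (r q) :=
      (Real.contDiffAt_sqrt h0.ne').inv (Real.sqrt_pos.2 h0).ne'
    exact ContMDiffAt.comp (g := fun x : ℝ ↦ (√x)⁻¹) q h2.contMDiffAt (hr q hq.1)
  refine ⟨W ∩ r ⁻¹' Ioi 0, f, fun q ↦ (√(r q))⁻¹ • N₀ q, ⟨hpW, V.metric.pos p _ hrp⟩,
    ⟨hrc.isOpen_inter_preimage hW isOpen_Ioi, ?_, fun q hq ↦ hfq q hq.1, fun q hq ↦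
    (hin q hq).smul_section (hN₀c q hq.1), fun q _ ↦
    Submodule.smul_mem _ _ (V.horizontalPart_mem q _), fun q hq ↦ ?_, fun q hq ↦ ?_⟩⟩
  · rw [← inter_assoc, hSW]
    ext q
    simp only [mem_inter_iff, mem_ofPred_eq]
    tauto
  · have h0 : 0 < r q := hq.2
    have h3 : √(r q) * √(r q) = V.metric.inner q (N₀ q) (N₀ q) := Real.mul_self_sqrt h0.le
    have h4 : √(r q) ≠ 0 := (Real.sqrt_pos.2 h0).ne'
    simp only [map_smul, smul_apply, smul_eq_mul]
    rw [← h3]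
    field_simp
  · have h4 : √(r q) ≠ 0 := (Real.sqrt_pos.2 hq.2).ne'
    refine ⟨√(r q), h4, fun u hu ↦ ?_⟩
    rw [hN₀ q u hu, map_smul, smul_eq_mul, mul_inv_cancel_left₀ h4]

section DefiningPair

variable {S U : Set M} {f : M → ℝ} {N : (q : M) → TangentSpace (𝓡 (k + m + 1)) q}

/-- The horizontal tangent vectors of `S` are the horizontal vectors orthogonal to `N`. -/
theorem IsDefiningPair.mem_tangentVectors_iff (hf : V.IsDefiningPair S U f N) {q : M} (hqS : q ∈ S)
    (hqU : q ∈ U) {u : TangentSpace (𝓡 (k + m + 1)) q} (hu : u ∈ V.horizontal q) :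
    u ∈ tangentVectors S q ↔ V.metric.inner q u (N q) = 0 := by
  obtain ⟨c, hc0, hc⟩ := hf.deriv q hqU
  constructor
  · intro h
    have h1 : mvfderiv (𝓡 (k + m + 1)) f q u = 0 := mfderiv_eq_zero_of_mem_tangentVectors hf.isOpen
      hf.inter_eq hqU ((hf.contMDiffAt q hqU).mdifferentiableAt two_ne_zero) h
    rw [hc u hu] at h1
    exact (mul_eq_zero.1 h1).resolve_left hc0
  · intro h
    refine mem_tangentVectors_of_mfderiv_eq_zero hf.isOpen hf.inter_eq hqU hqS
      (hf.contMDiffAt q hqU) (fun h0 ↦ ?_) (v := u) ?_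
    · have h1 : mvfderiv (𝓡 (k + m + 1)) f q (N q) = 0 :=
        congrArg (fun L : TangentSpace (𝓡 (k + m + 1)) q →L[ℝ] ℝ ↦ L (N q)) h0
      rw [hc _ (hf.mem q hqU), hf.unit q hqU, mul_one] at h1
      exact hc0 h1
    · refine (hc u hu).trans ?_
      rw [h, mul_zero]
      rfl

theorem IsDefiningPair.isUnitHorizontalNormal (hf : V.IsDefiningPair S U f N) {q : M} (hqS : q ∈ S)
    (hqU : q ∈ U) : V.IsUnitHorizontalNormal S q (N q) :=
  ⟨hf.mem q hqU, hf.unit q hqU, fun w hw hwh ↦ by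
    rw [V.inner_comm]; exact (hf.mem_tangentVectors_iff hqS hqU hwh).1 hw⟩

theorem IsDefiningPair.isHorizontalNormalField (hf : V.IsDefiningPair S U f N) {q : M}
    (hqU : q ∈ U) : V.IsHorizontalNormalField S q N :=
  ⟨hf.contMDiffAt_normal q hqU, by
    filter_upwards [hf.isOpen.mem_nhds hqU] with y hy hyS using hf.isUnitHorizontalNormal hyS hy⟩

/-- The unit horizontal normal is unique up to sign. -/
theorem IsDefiningPair.exists_eq_smul (hf : V.IsDefiningPair S U f N) {q : M} (hqS : q ∈ S)
    (hqU : q ∈ U) {ν : TangentSpace (𝓡 (k + m + 1)) q} (hν : V.IsUnitHorizontalNormal S q ν) :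
    ∃ σ : ℝ, σ ≠ 0 ∧ ν = σ • N q := by
  set σ := V.metric.inner q ν (N q) with hσ
  have hh : ν - σ • N q ∈ V.horizontal q :=
    Submodule.sub_mem _ hν.mem (Submodule.smul_mem _ _ (hf.mem q hqU))
  have h1 : V.metric.inner q (ν - σ • N q) (N q) = 0 := by
    rw [map_sub, sub_apply, map_smul, smul_apply, hf.unit q hqU, ← hσ, smul_eq_mul, mul_one,
      sub_self]
  have h2 := hν.orthogonal _ ((hf.mem_tangentVectors_iff hqS hqU hh).2 h1) hh
  have h3 : ν - σ • N q = 0 := by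
    by_contra hne
    have h4 := V.metric.pos q _ hne
    have h5 : ∀ w, V.metric.inner q (ν - σ • N q) w =
        V.metric.inner q ν w - σ * V.metric.inner q (N q) w := fun w ↦ by
      rw [map_sub, sub_apply, map_smul, smul_apply, smul_eq_mul]
    rw [h5, h2, V.inner_comm q (N q), h1] at h4
    simp at h4
  rw [sub_eq_zero] at h3
  refine ⟨σ, fun h0 ↦ ?_, h3⟩
  have h4 := hν.unit
  rw [h3, h0, zero_smul, map_zero] at h4
  simp at h4

/-- Orthonormal horizontal vectors orthogonal to `N` extend to a horizontal tangent frame. -/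
theorem IsDefiningPair.exists_frame (hf : V.IsDefiningPair S U f N) {q : M} (hqS : q ∈ S)
    (hqU : q ∈ U) (v : Fin k → TangentSpace (𝓡 (k + m + 1)) q) (s : Set (Fin k))
    (hv : ∀ i ∈ s, ∀ j ∈ s, V.metric.inner q (v i) (v j) = if i = j then 1 else 0)
    (hvh : ∀ i ∈ s, v i ∈ V.horizontal q) (hvN : ∀ i ∈ s, V.metric.inner q (v i) (N q) = 0) :
    ∃ e, V.IsHorizontalTangentFrame S q e ∧ ∀ i ∈ s, e i = v i := by
  have hN := hf.isUnitHorizontalNormal hqS hqU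
  obtain ⟨b, hb, hbs⟩ := exists_metric_orthonormal_extension V.metric
    (ι := Fin k ⊕ (Unit ⊕ Fin m)) (by simp; omega) q
    (Sum.elim v (Sum.elim (fun _ ↦ N q) fun j ↦ V.T j q)) (Sum.inl '' s ∪ range Sum.inr) (by
      have hvN' : ∀ i ∈ s, V.metric.inner q (N q) (v i) = 0 := fun i hi ↦ by
        rw [V.inner_comm]; exact hvN i hi
      have hvT : ∀ i ∈ s, ∀ j, V.metric.inner q (v i) (V.T j q) = 0 := fun i hi j ↦ hvh i hi j
      have hvT' : ∀ i ∈ s, ∀ j, V.metric.inner q (V.T j q) (v i) = 0 := fun i hi j ↦ by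
        rw [V.inner_comm]; exact hvh i hi j
      have hNT : ∀ j, V.metric.inner q (N q) (V.T j q) = 0 := fun j ↦ hN.mem j
      have hNT' : ∀ j, V.metric.inner q (V.T j q) (N q) = 0 := fun j ↦ by
        rw [V.inner_comm]; exact hN.mem j
      rintro _ (⟨i, hi, rfl⟩ | ⟨i | i, rfl⟩) _ (⟨j, hj, rfl⟩ | ⟨j | j, rfl⟩)
      · simpa using hv i hi j hj
      · simpa using hvN i hi
      · simpa using hvT i hi j
      · simpa using hvN' j hj
      · simpa using hN.unit
      · simpa using hNT j
      · simpa using hvT' j hj i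
      · simpa using hNT' i
      · simpa using V.orthonormal_T q i j)
  have hbN : b (.inr (.inl ())) = N q := hbs _ (Or.inr ⟨_, rfl⟩)
  have hbT : ∀ j, b (.inr (.inr j)) = V.T j q := fun j ↦ hbs _ (Or.inr ⟨_, rfl⟩)
  have hmem : ∀ i, b (.inl i) ∈ V.horizontal q := fun i j ↦ by
    rw [← hbT, hb]; simp
  refine ⟨fun i ↦ b (.inl i), ⟨fun i ↦ ?_, hmem, fun i j ↦ by simp [hb]⟩, fun i hi ↦
    hbs _ (Or.inl ⟨i, hi, rfl⟩)⟩
  refine (hf.mem_tangentVectors_iff hqS hqU (hmem i)).2 ?_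
  rw [← hbN, hb]; simp

/-- On a minimal hypersurface the quadratic form of `II₀` vanishes wherever it is semidefinite. -/
theorem IsDefiningPair.inner_eq_zero_of_semidefinite [T2Space M] (hk : 1 ≤ k)
    (hf : V.IsDefiningPair S U f N) (hmin : V.IsMinimal S) (hS : IsC2Hypersurface (k + m + 1) S)
    {D : CovariantDerivative (𝓡 (k + m + 1)) (EuclideanSpace ℝ (Fin (k + m + 1)))
      (fun x : M ↦ TangentSpace (𝓡 (k + m + 1)) x)} (hD : V.IsAdapted D) {q : M} (hqS : q ∈ S)
    (hqU : q ∈ U) {σ : ℝ} (hσ : σ ≠ 0)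
    (hle : ∀ u ∈ V.horizontal q, V.metric.inner q u (N q) = 0 → V.metric.inner q u u = 1 →
      σ * V.metric.inner q (D N q u) u ≤ 0) {u : TangentSpace (𝓡 (k + m + 1)) q}
    (hu : u ∈ V.horizontal q) (huN : V.metric.inner q u (N q) = 0) :
    V.metric.inner q (D N q u) u = 0 := by
  -- it suffices to treat unit vectors
  suffices hunit : ∀ u ∈ V.horizontal q, V.metric.inner q u (N q) = 0 →
      V.metric.inner q u u = 1 → V.metric.inner q (D N q u) u = 0 by
    by_cases hu0 : u = 0
    · rw [hu0, map_zero]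
    have hpos := V.metric.pos q u hu0
    set r := √(V.metric.inner q u u) with hr
    have hr0 : r ≠ 0 := (Real.sqrt_pos.2 hpos).ne'
    have hrr : r * r = V.metric.inner q u u := Real.mul_self_sqrt hpos.le
    have h := hunit (r⁻¹ • u) (Submodule.smul_mem _ _ hu)
      (by rw [map_smul, smul_apply, huN, smul_zero])
      (by
        rw [map_smul, map_smul, smul_apply, ← hrr]
        simp only [smul_eq_mul]
        field_simp)
    rw [map_smul, map_smul, map_smul, smul_apply, smul_smul, smul_eq_mul] at h
    exact (mul_eq_zero.1 h).resolve_left (mul_ne_zero (inv_ne_zero hr0) (inv_ne_zero hr0))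
  intro u hu huN hu1
  let i₀ : Fin k := ⟨0, hk⟩
  obtain ⟨e, he, hei⟩ := hf.exists_frame hqS hqU (fun _ ↦ u) {i₀}
    (by rintro _ rfl _ rfl; simpa using hu1) (fun _ _ ↦ hu) (fun _ _ ↦ huN)
  have hH : ∑ i, V.metric.inner q (D N q (e i)) (e i) = 0 :=
    hmin.meanCurvature_eq_zero hS hD hqS (hf.isHorizontalNormalField hqU) he
  have hi : ∀ i, σ * V.metric.inner q (D N q (e i)) (e i) ≤ 0 := fun i ↦
    hle (e i) (he.mem_horizontal i)
      ((hf.mem_tangentVectors_iff hqS hqU (he.mem_horizontal i)).1 (he.mem_tangent i))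
      (by simpa using he.orthonormal i i)
  have h0 := (Finset.sum_eq_zero_iff_of_nonpos fun i _ ↦ hi i).1
    (by rw [← Finset.mul_sum, hH, mul_zero]) i₀ (Finset.mem_univ _)
  rw [hei i₀ rfl] at h0
  exact (mul_eq_zero.1 h0).resolve_left hσ

end DefiningPair

end VRStructure

/-! ### Integral curves -/

section Arc

variable {d : ℕ} {M : Type*} [TopologicalSpace M] [ChartedSpace (EuclideanSpace ℝ (Fin d)) M]

/-- `c` is an integral curve of `X` in `U` on the time interval `(-ε, ε)`, starting at `x`. -/
structure IsIntegralArc (X : (q : M) → TangentSpace (𝓡 d) q) (U : Set M) (x : M) (c : ℝ → M)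
    (ε : ℝ) : Prop where
  pos : 0 < ε
  zero : c 0 = x
  mem : ∀ t ∈ Ioo (-ε) ε, c t ∈ U
  mdifferentiableAt : ∀ t ∈ Ioo (-ε) ε, MDifferentiableAt 𝓘(ℝ, ℝ) (𝓡 d) c t
  velocity : ∀ t ∈ Ioo (-ε) ε, curveVelocity c t = X (c t)

theorem curveVelocity_comp {c : ℝ → M} {φ : ℝ → ℝ} {s φ' : ℝ} (hφ : HasDerivAt φ φ' s)
    (hc : MDifferentiableAt 𝓘(ℝ, ℝ) (𝓡 d) c (φ s)) :
    MDifferentiableAt 𝓘(ℝ, ℝ) (𝓡 d) (fun s ↦ c (φ s)) s ∧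
      curveVelocity (d := d) (fun s ↦ c (φ s)) s = φ' • curveVelocity (d := d) c (φ s) := by
  have h := HasMFDerivAt.comp s hc.hasMFDerivAt hφ.hasFDerivAt.hasMFDerivAt
  refine ⟨h.mdifferentiableAt, ?_⟩
  have h1 : curveVelocity (d := d) (fun s ↦ c (φ s)) s =
      mfderiv 𝓘(ℝ, ℝ) (𝓡 d) c (φ s) ((1 : ℝ) • φ') :=
    congrArg (fun L : ℝ →L[ℝ] EuclideanSpace ℝ (Fin d) ↦ L 1) h.mfderiv
  have h2 : (1 : ℝ) • φ' = φ' • (1 : ℝ) := by simp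
  rw [h1, h2]
  exact map_smul (mfderiv 𝓘(ℝ, ℝ) (𝓡 d) c (φ s)) φ' (1 : ℝ)

theorem IsIntegralArc.zero_mem {X : (q : M) → TangentSpace (𝓡 d) q} {U : Set M} {x : M} {c : ℝ → M}
    {ε : ℝ} (hc : IsIntegralArc X U x c ε) : (0 : ℝ) ∈ Ioo (-ε) ε :=
  ⟨neg_lt_zero.2 hc.pos, hc.pos⟩

/-- The velocity at time zero, as a coordinate vector. -/
theorem IsIntegralArc.velocity_zero {X : (q : M) → TangentSpace (𝓡 d) q} {U : Set M} {x : M}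
    {c : ℝ → M} {ε : ℝ} (hc : IsIntegralArc X U x c ε) :
    (curveVelocity c 0 : EuclideanSpace ℝ (Fin d)) = X x := by
  have h := hc.velocity 0 hc.zero_mem
  obtain rfl := hc.zero
  exact h

/-- The derivative at time zero of a vector-valued function along a curve. -/
theorem hasDerivAt_comp_curve_zero {F' : Type*} [NormedAddCommGroup F'] [NormedSpace ℝ F']
    {F : M → F'} {x : M} (hF : MDifferentiableAt (𝓡 d) 𝓘(ℝ, F') F x) {c : ℝ → M} (h0 : c 0 = x)
    (hc : MDifferentiableAt 𝓘(ℝ, ℝ) (𝓡 d) c 0) {v : EuclideanSpace ℝ (Fin d)}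
    (hv : (curveVelocity c 0 : EuclideanSpace ℝ (Fin d)) = v) :
    HasDerivAt (fun t ↦ F (c t)) (mvfderiv (𝓡 d) F x v) 0 := by
  subst h0 hv
  have h := HasMFDerivAt.comp 0 hF.hasMFDerivAt hc.hasMFDerivAt
  have h2 : HasFDerivAt (𝕜 := ℝ) (E := ℝ) (F := F') (fun s ↦ F (c s)) _ 0 := h.hasFDerivAt
  exact h2.hasDerivAt

variable [IsManifold (𝓡 d) ∞ M]

theorem exists_isIntegralArc [T2Space M] {X : (q : M) → TangentSpace (𝓡 d) q} {U : Set M} {x : M}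
    (hU : U ∈ 𝓝 x)
    (hX : ContMDiffAt (𝓡 d) (𝓡 d).tangent 1 (fun q ↦ (⟨q, X q⟩ : TangentBundle (𝓡 d) M)) x) :
    ∃ c ε, IsIntegralArc X U x c ε := by
  have : IsManifold (𝓡 d) 1 M := IsManifold.of_le (n := ∞) (by norm_num)
  obtain ⟨c, h0, hc⟩ := exists_isMIntegralCurveAt_of_contMDiffAt_boundaryless 0 hX
  have hcU : ∀ᶠ t in 𝓝 (0 : ℝ), c t ∈ U := by
    refine hc.self_of_nhds.continuousAt.eventually_mem ?_
    rwa [h0]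
  obtain ⟨ε, hε, hb⟩ := Metric.eventually_nhds_iff_ball.1 (hc.and hcU)
  have hmem : ∀ t ∈ Ioo (-ε) ε, t ∈ Metric.ball (0 : ℝ) ε := fun t ht ↦ by
    rw [Real.ball_eq_Ioo]; simpa using ht
  refine ⟨c, ε, hε, h0, fun t ht ↦ (hb t (hmem t ht)).2, fun t ht ↦
    (hb t (hmem t ht)).1.mdifferentiableAt, fun t ht ↦ ?_⟩
  have := congrArg (fun L : ℝ →L[ℝ] TangentSpace (𝓡 d) (c t) ↦ L 1) (hb t (hmem t ht)).1.mfderiv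
  exact this.trans (one_smul ℝ (X (c t)))

/-- Integral curves of continuous fields are `C¹`. -/
theorem IsIntegralArc.contMDiffAt {X : (q : M) → TangentSpace (𝓡 d) q} {U : Set M} {x : M}
    {c : ℝ → M} {ε : ℝ} (hc : IsIntegralArc X U x c ε)
    (hX : ∀ q ∈ U, ContMDiffAt (𝓡 d) (𝓡 d).tangent 1
      (fun q ↦ (⟨q, X q⟩ : TangentBundle (𝓡 d) M)) q) {t : ℝ} (ht : t ∈ Ioo (-ε) ε) :
    ContMDiffAt 𝓘(ℝ, ℝ) (𝓡 d) 1 c t := by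
  have hcc : ∀ s ∈ Ioo (-ε) ε, ContinuousAt c s := fun s hs ↦
    (hc.mdifferentiableAt s hs).continuousAt
  rw [contMDiffAt_iff_target]
  refine ⟨hcc t ht, ContDiffAt.contMDiffAt ?_⟩
  have hsrc : ∀ᶠ s in 𝓝 t, c s ∈ (chartAt (EuclideanSpace ℝ (Fin d)) (c t)).source :=
    (hcc t ht).eventually_mem
      ((chartAt _ (c t)).open_source.mem_nhds (mem_chart_source _ (c t)))
  obtain ⟨W, hW, hWo, htW⟩ := eventually_nhds_iff.1 (hsrc.and (isOpen_Ioo.mem_nhds ht))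
  rw [contDiffAt_one_iff]
  refine ⟨fun s ↦ ContinuousLinearMap.toSpanSingleton ℝ (chartCoord (c t) (c s) (X (c s))), W,
    hWo.mem_nhds htW, fun s hs ↦ ?_, fun s hs ↦ ?_⟩
  · refine ContinuousAt.continuousWithinAt ?_
    have h1 : ContinuousAt (fun s ↦ chartCoord (c t) (c s) (X (c s))) s :=
      ContinuousAt.comp (g := fun q ↦ chartCoord (c t) q (X q))
        (contMDiffAt_chartCoord_of_mem (by norm_num) (hW s hs).1
          (hX _ (hc.mem s (hW s hs).2))).continuousAt (hcc s (hW s hs).2)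
    exact ((ContinuousLinearMap.toSpanSingletonCLE (𝕜 := ℝ)
      (E := EuclideanSpace ℝ (Fin d))).continuous.continuousAt).comp h1
  · have h1 := hasDerivAt_extChartAt_curve (hW s hs).1 (hc.mdifferentiableAt s (hW s hs).2)
    rw [hc.velocity s (hW s hs).2] at h1
    exact h1.hasFDerivAt

/-- Two integral curves with the same initial velocity, of a field `X` and of `X - θ N` with
`θ = 0` at the initial point, separate quadratically, in the direction of `N`. -/
theorem IsIntegralArc.eventually_norm_sub_le {X N : (q : M) → TangentSpace (𝓡 d) q} {θ : M → ℝ}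
    {U : Set M} {x : M} {c l : ℝ → M} {ε ε' : ℝ}
    (hX : ContMDiffAt (𝓡 d) (𝓡 d).tangent 1 (fun q ↦ (⟨q, X q⟩ : TangentBundle (𝓡 d) M)) x)
    (hN : ContMDiffAt (𝓡 d) (𝓡 d).tangent 1 (fun q ↦ (⟨q, N q⟩ : TangentBundle (𝓡 d) M)) x)
    (hθ : MDifferentiableAt (𝓡 d) 𝓘(ℝ, ℝ) θ x) (hθx : θ x = 0)
    (hc : IsIntegralArc (fun q ↦ X q - θ q • N q) U x c ε) (hl : IsIntegralArc X U x l ε')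
    {n : EuclideanSpace ℝ (Fin d)} (hn : (N x : EuclideanSpace ℝ (Fin d)) = n)
    {κ : ℝ} (hκ : 0 < κ) :
    ∀ᶠ t in 𝓝[>] (0 : ℝ), ‖extChartAt (𝓡 d) x (c t) - extChartAt (𝓡 d) x (l t) -
      (t ^ 2 / 2) • (-(mvfderiv (𝓡 d) θ x (X x) • n))‖ ≤
        κ * t ^ 2 := by
  let F : M → EuclideanSpace ℝ (Fin d) := fun q ↦ chartCoord x q (X q)
  let G : M → EuclideanSpace ℝ (Fin d) := fun q ↦ chartCoord x q (N q)
  have hF : MDifferentiableAt (𝓡 d) 𝓘(ℝ, EuclideanSpace ℝ (Fin d)) F x :=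
    (contMDiffAt_chartCoord (by norm_num) hX).mdifferentiableAt one_ne_zero
  have hG : MDifferentiableAt (𝓡 d) 𝓘(ℝ, EuclideanSpace ℝ (Fin d)) G x :=
    (contMDiffAt_chartCoord (by norm_num) hN).mdifferentiableAt one_ne_zero
  have hvel : (curveVelocity c 0 : EuclideanSpace ℝ (Fin d)) = X x := by
    refine hc.velocity_zero.trans ?_
    change X x - θ x • N x = X x
    rw [hθx, zero_smul, sub_zero]
  have hc0 := hc.mdifferentiableAt 0 hc.zero_mem
  have hl0 := hl.mdifferentiableAt 0 hl.zero_mem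
  have hsrc : ∀ {γ : ℝ → M}, γ 0 = x → MDifferentiableAt 𝓘(ℝ, ℝ) (𝓡 d) γ 0 →
      ∀ᶠ t in 𝓝 (0 : ℝ), γ t ∈ (chartAt (EuclideanSpace ℝ (Fin d)) x).source :=
    fun {γ} h0 hγ ↦ hγ.continuousAt.eventually_mem
      ((chartAt _ x).open_source.mem_nhds (by rw [h0]; exact mem_chart_source _ x))
  refine eventually_norm_sub_sq_smul_le
    (r' := fun t ↦ F (c t) - θ (c t) • G (c t) - F (l t)) ?_ ?_ ?_ ?_ hκ
  · filter_upwards [hsrc hc.zero hc0, hsrc hl.zero hl0, isOpen_Ioo.mem_nhds hc.zero_mem,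
      isOpen_Ioo.mem_nhds hl.zero_mem] with t h1 h2 h3 h4
    have h5 := hasDerivAt_extChartAt_curve h1 (hc.mdifferentiableAt t h3)
    have h6 := hasDerivAt_extChartAt_curve h2 (hl.mdifferentiableAt t h4)
    rw [hc.velocity t h3, map_sub, map_smul] at h5
    rw [hl.velocity t h4] at h6
    exact h5.fun_sub h6
  · rw [hc.zero, hl.zero, sub_self]
  · simp only [hc.zero, hl.zero, hθx, zero_smul, sub_zero, sub_self]
  · have h1 := hasDerivAt_comp_curve_zero hF hc.zero hc0 hvel
    have h2 := hasDerivAt_comp_curve_zero hF hl.zero hl0 hl.velocity_zero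
    have h3 := hasDerivAt_comp_curve_zero hθ hc.zero hc0 hvel
    have h4 := hasDerivAt_comp_curve_zero hG hc.zero hc0 hvel
    refine ((h1.fun_sub (h3.fun_smul h4)).fun_sub h2).congr_deriv ?_
    have h5 : G x = n := (chartCoord_self x _).trans hn
    rw [hc.zero, hθx, zero_smul, zero_add, h5]
    abel

end Arc

namespace VRStructure

variable {k m : ℕ} {M : Type*} [TopologicalSpace M]
  [ChartedSpace (EuclideanSpace ℝ (Fin (k + m + 1))) M] [IsManifold (𝓡 (k + m + 1)) ∞ M]
  {V : VRStructure k m M} {S U : Set M} {f : M → ℝ} {N : (q : M) → TangentSpace (𝓡 (k + m + 1)) q}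

/-- Integral curves of horizontal fields orthogonal to `N` stay in `S`. -/
theorem IsDefiningPair.mem_of_isIntegralArc (hf : V.IsDefiningPair S U f N)
    {Y : (q : M) → TangentSpace (𝓡 (k + m + 1)) q} (hYh : ∀ q ∈ U, Y q ∈ V.horizontal q)
    (hYN : ∀ q ∈ U, V.metric.inner q (Y q) (N q) = 0) {x : M} (hxS : x ∈ S) {c : ℝ → M} {ε : ℝ}
    (hc : IsIntegralArc Y U x c ε) {t : ℝ} (ht : t ∈ Ioo (-ε) ε) : c t ∈ S := by
  have hd : ∀ s ∈ Ioo (-ε) ε, HasDerivWithinAt (fun s ↦ f (c s)) 0 (Ioo (-ε) ε) s := fun s hs ↦ by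
    have hU := hc.mem s hs
    have h1 := hasDerivAt_comp_curve ((hf.contMDiffAt _ hU).mdifferentiableAt two_ne_zero)
      (hc.mdifferentiableAt s hs)
    refine (h1.congr_deriv ?_).hasDerivWithinAt
    rw [hc.velocity s hs]
    obtain ⟨a, -, ha⟩ := hf.deriv _ hU
    refine (ha _ (hYh _ hU)).trans ?_
    rw [hYN _ hU, mul_zero]
  have h := (convex_Ioo (-ε) ε).norm_image_sub_le_of_norm_hasDerivWithin_le (C := 0) hd
    (fun _ _ ↦ by simp) hc.zero_mem ht
  rw [zero_mul, norm_le_zero_iff, sub_eq_zero, hc.zero] at h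
  have hx : x ∈ S ∩ U := ⟨hxS, hc.zero ▸ hc.mem 0 hc.zero_mem⟩
  have h0 : f x = 0 := (hf.inter_eq.subset hx).2
  exact (hf.inter_eq.superset ⟨hc.mem t ht, h.trans h0⟩).1

/-- A horizontal integral curve in `S` lies in the horizontal exponential surface: run through it
back and forth to obtain a curve defined for all times. -/
theorem mem_horizontalExpSurface_of_isIntegralArc
    {Y : (q : M) → TangentSpace (𝓡 (k + m + 1)) q} (hYh : ∀ q ∈ U, Y q ∈ V.horizontal q)
    (hY : ∀ q ∈ U, ContMDiffAt (𝓡 (k + m + 1)) (𝓡 (k + m + 1)).tangent 1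
      (fun q ↦ (⟨q, Y q⟩ : TangentBundle (𝓡 (k + m + 1)) M)) q) {x : M} {c : ℝ → M} {ε : ℝ}
    (hc : IsIntegralArc Y U x c ε) (hcS : ∀ t ∈ Ioo (-ε) ε, c t ∈ S) {t : ℝ}
    (ht : t ∈ Ioo (-ε) ε) : c t ∈ V.horizontalExpSurface S x := by
  set φ : ℝ → ℝ := fun s ↦ t * Real.sin (Real.pi / 2 * s) with hφ
  have hφm : ∀ s, φ s ∈ Ioo (-ε) ε := fun s ↦ by
    rw [mem_Ioo, ← abs_lt] at ht ⊢
    calc |φ s| = |t| * |Real.sin (Real.pi / 2 * s)| := abs_mul _ _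
      _ ≤ |t| * 1 := by gcongr; exact Real.abs_sin_le_one _
      _ < ε := by rwa [mul_one]
  have hφd : ContDiff ℝ 1 φ := by fun_prop
  refine ⟨fun s ↦ c (φ s), fun s ↦ ?_, fun s ↦ ⟨hcS _ (hφm s), ?_⟩, ?_, ?_⟩
  · exact ContMDiffAt.comp (g := c) (f := φ) s (hc.contMDiffAt hY (hφm s))
      hφd.contDiffAt.contMDiffAt
  · rw [(curveVelocity_comp (hφd.differentiable one_ne_zero s).hasDerivAt
      (hc.mdifferentiableAt _ (hφm s))).2, hc.velocity _ (hφm s)]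
    exact Submodule.smul_mem _ _ (hYh _ (hc.mem _ (hφm s)))
  · simp [hφ, hc.zero]
  · simp [hφ]

end VRStructure

/-! ### Convexity and minimality in Carnot groups -/

/-- If `r` is quadratic with leading term `n`, and `t v + r t` is, up to a small error relative to
`r t`, on the positive side of a hyperplane that contains `v`, then `n` is on the nonnegative
side. -/
theorem le_map_of_eventually_exists {Z : Type*} [NormedAddCommGroup Z] [NormedSpace ℝ Z]
    {ℓ : Z →L[ℝ] ℝ} {r : ℝ → Z} {v n : Z} (hv : ℓ v = 0)
    (hr : ∀ κ > 0, ∀ᶠ t in 𝓝[>] (0 : ℝ), ‖r t - (t ^ 2 / 2) • n‖ ≤ κ * t ^ 2)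
    (hw : ∀ κ > 0, ∀ᶠ t in 𝓝[>] (0 : ℝ), ∃ w, 0 < ℓ w ∧ ‖r t - (w - t • v)‖ ≤ κ * ‖w - t • v‖) :
    0 ≤ ℓ n := by
  by_contra! hn
  set κ := min (1 / 2) (-ℓ n / (4 * (‖ℓ‖ + 1) * (2 + ‖n‖))) with hκ
  have hκ0 : 0 < κ := lt_min (by norm_num) (div_pos (by linarith) (by positivity))
  have hκ1 : κ ≤ 1 / 2 := min_le_left _ _
  have hκ2 : ‖ℓ‖ * κ * (2 + ‖n‖) ≤ -ℓ n / 4 := by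
    calc ‖ℓ‖ * κ * (2 + ‖n‖) ≤ (‖ℓ‖ + 1) * (-ℓ n / (4 * (‖ℓ‖ + 1) * (2 + ‖n‖))) * (2 + ‖n‖) := by
          gcongr
          · linarith
          · exact min_le_right _ _
      _ = -ℓ n / 4 := by field_simp
  obtain ⟨t, ⟨ht1, w, hw0, ht2⟩, ht0⟩ :=
    (((hr κ hκ0).and (hw κ hκ0)).and self_mem_nhdsWithin).exists
  have ht : 0 < t ^ 2 := pow_pos ht0 2
  set h := w - t • v with hh
  have hℓh : 0 < ℓ h := by rw [hh, map_sub, map_smul, hv, smul_zero, sub_zero]; exact hw0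
  have h1 : ‖r t‖ ≤ (‖n‖ / 2 + κ) * t ^ 2 := by
    calc ‖r t‖ = ‖(r t - (t ^ 2 / 2) • n) + (t ^ 2 / 2) • n‖ := by rw [sub_add_cancel]
      _ ≤ κ * t ^ 2 + t ^ 2 / 2 * ‖n‖ := by
          refine (norm_add_le _ _).trans (add_le_add ht1 ?_)
          rw [norm_smul, Real.norm_of_nonneg (by positivity)]
      _ = (‖n‖ / 2 + κ) * t ^ 2 := by ring
  have h2 : ‖h‖ ≤ 2 * ‖r t‖ := by
    have : ‖h‖ ≤ ‖r t‖ + κ * ‖h‖ := by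
      calc ‖h‖ = ‖r t - (r t - h)‖ := by rw [sub_sub_cancel]
        _ ≤ ‖r t‖ + κ * ‖h‖ := (norm_sub_le _ _).trans (by gcongr)
    have h3 : κ * ‖h‖ ≤ 1 / 2 * ‖h‖ := by gcongr
    linarith
  have h3 : ℓ h - ℓ (r t) ≤ ‖ℓ‖ * κ * (‖n‖ + 2 * κ) * t ^ 2 := by
    calc ℓ h - ℓ (r t) = -ℓ (r t - h) := by rw [map_sub ℓ (r t) h, neg_sub]
      _ ≤ ‖ℓ (r t - h)‖ := neg_le_abs _
      _ ≤ ‖ℓ‖ * (κ * (2 * ((‖n‖ / 2 + κ) * t ^ 2))) := by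
          refine (ℓ.le_opNorm _).trans ?_
          gcongr
          refine ht2.trans ?_
          gcongr
          exact h2.trans (by gcongr)
      _ = ‖ℓ‖ * κ * (‖n‖ + 2 * κ) * t ^ 2 := by ring
  have h4 : ℓ (r t) - t ^ 2 / 2 * ℓ n ≤ ‖ℓ‖ * κ * t ^ 2 := by
    calc ℓ (r t) - t ^ 2 / 2 * ℓ n = ℓ (r t - (t ^ 2 / 2) • n) := by
          rw [map_sub, map_smul, smul_eq_mul]
      _ ≤ ‖ℓ (r t - (t ^ 2 / 2) • n)‖ := le_abs_self _
      _ ≤ ‖ℓ‖ * (κ * t ^ 2) := (ℓ.le_opNorm _).trans (by gcongr)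
      _ = ‖ℓ‖ * κ * t ^ 2 := by ring
  have h5 : ‖ℓ‖ * κ * (‖n‖ + 2 * κ) * t ^ 2 + ‖ℓ‖ * κ * t ^ 2 ≤ -ℓ n / 4 * t ^ 2 := by
    calc _ = ‖ℓ‖ * κ * (1 + 2 * κ + ‖n‖) * t ^ 2 := by ring
      _ ≤ ‖ℓ‖ * κ * (2 + ‖n‖) * t ^ 2 := by gcongr; linarith
      _ ≤ -ℓ n / 4 * t ^ 2 := by gcongr
  nlinarith

namespace VRStructure

variable {k m : ℕ} {M : Type*} [TopologicalSpace M]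
  [ChartedSpace (EuclideanSpace ℝ (Fin (k + m + 1))) M] [IsManifold (𝓡 (k + m + 1)) ∞ M]
  {V : VRStructure k m M} [Group M] [LieGroup (𝓡 (k + m + 1)) ∞ M]

/-- Convexity at `x`, read in the chart at `x` along a horizontal curve `c` in the hypersurface:
`c t` is the endpoint of a geodesic with initial velocity on one side of the horizontal tangent
plane, which is compared with the geodesic `l` tangent to `c`. -/
theorem IsCarnot.eventually_exists_of_convex [T2Space M] (hC : V.IsCarnot) {S : Set M} {x : M}
    {ν : TangentSpace (𝓡 (k + m + 1)) x}
    (hν : ∀ B ∈ 𝓝 (0 : TangentSpace (𝓡 (k + m + 1)) x), ∃ U ∈ 𝓝 x,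
      (V.horizontalExpSurface S x ∩ U) \ {x} ⊆
        V.expImage x {w ∈ B | 0 < V.metric.inner x w ν})
    {u : GroupLieAlgebra (𝓡 (k + m + 1)) M} (hu : u ∈ V.horizontal 1)
    {Y : (q : M) → TangentSpace (𝓡 (k + m + 1)) q} {U U' : Set M} {c l : ℝ → M} {ε ε' : ℝ}
    (hc : IsIntegralArc Y U x c ε) (hl : IsIntegralArc (mulInvariantVectorField u) U' x l ε')
    (hcS : ∀ t ∈ Ioo (-ε) ε, c t ∈ V.horizontalExpSurface S x)
    {v : EuclideanSpace ℝ (Fin (k + m + 1))} (hv : v ≠ 0)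
    (hYv : (Y x : EuclideanSpace ℝ (Fin (k + m + 1))) = v)
    (huv : (mulInvariantVectorField u x : EuclideanSpace ℝ (Fin (k + m + 1))) = v)
    {κ : ℝ} (hκ : 0 < κ) :
    ∀ᶠ t in 𝓝[>] (0 : ℝ), ∃ w : EuclideanSpace ℝ (Fin (k + m + 1)), 0 < V.metric.inner x w ν ∧
      ‖extChartAt (𝓡 (k + m + 1)) x (c t) - extChartAt (𝓡 (k + m + 1)) x (l t) - (w - t • v)‖ ≤
        κ * ‖w - t • v‖ := by
  obtain ⟨E, hE⟩ := hC.exists_frame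
  obtain ⟨δ, hδ, hgeo⟩ := hC.exists_isEulerCurve_sub_le hE x hκ
  let B : Set (EuclideanSpace ℝ (Fin (k + m + 1))) := Metric.ball 0 δ
  have hB : B ∈ 𝓝 (0 : EuclideanSpace ℝ (Fin (k + m + 1))) := Metric.ball_mem_nhds _ hδ
  obtain ⟨W, hW, hWsub⟩ := hν B hB
  have hc0 := hc.mdifferentiableAt 0 hc.zero_mem
  have hcW : ∀ᶠ t in 𝓝[>] (0 : ℝ), c t ∈ W :=
    (hc0.continuousAt.eventually_mem (by rwa [hc.zero])).filter_mono nhdsWithin_le_nhds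
  have hcx : ∀ᶠ t in 𝓝[>] (0 : ℝ), c t ≠ x := by
    have hF := hasMFDerivAt_extChartAt_chartCoord (mem_chart_source
      (EuclideanSpace ℝ (Fin (k + m + 1))) x)
    have h1 := hasDerivAt_comp_curve_zero hF.mdifferentiableAt hc.zero hc0
      (hc.velocity_zero.trans hYv)
    have h2 : mvfderiv (𝓡 (k + m + 1)) (extChartAt (𝓡 (k + m + 1)) x) x v = v :=
      (congrArg (fun L : EuclideanSpace ℝ (Fin (k + m + 1)) →L[ℝ]
        EuclideanSpace ℝ (Fin (k + m + 1)) ↦ L v) hF.mfderiv).trans (chartCoord_self x v)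
    rw [h2] at h1
    have h3 := h1.eventually_ne (c := extChartAt (𝓡 (k + m + 1)) x x) hv
    filter_upwards [h3.filter_mono (nhdsWithin_mono _ fun t ht ↦ ne_of_gt ht)] with t ht htx
    exact ht (by rw [htx])
  have hsmall : ∀ᶠ t in 𝓝[>] (0 : ℝ), ‖t • v‖ < δ := by
    have h1 : ContinuousAt (fun t : ℝ ↦ ‖t • v‖) 0 := by fun_prop
    refine (h1.eventually_lt continuousAt_const ?_).filter_mono nhdsWithin_le_nhds
    simpa using hδ
  filter_upwards [hcW, hcx, hsmall, Ioo_mem_nhdsGT hc.pos, Ioo_mem_nhdsGT hl.pos]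
    with t htW htx htδ htε htε'
  obtain ⟨w, ⟨hwB, hwν⟩, γ, hγ, hγ0, hγ1⟩ :=
    hWsub ⟨⟨hcS t ⟨by linarith [hc.pos, htε.1], htε.2⟩, htW⟩, htx⟩
  refine ⟨w, hwν, ?_⟩
  -- the comparison geodesic, on the time interval `[0, 1]`
  have hts : ∀ s ∈ Icc (0 : ℝ) 1, t * s ∈ Ioo (-ε') ε' := fun s hs ↦
    ⟨by nlinarith [htε'.1, hs.1, hl.pos], by nlinarith [htε'.1, htε'.2, hs.2]⟩
  have hvel : ∀ s ∈ Icc (0 : ℝ) 1, MDifferentiableAt 𝓘(ℝ, ℝ) (𝓡 (k + m + 1)) (fun s ↦ l (t * s)) s ∧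
      curveVelocity (d := k + m + 1) (fun s ↦ l (t * s)) s =
        mulInvariantVectorField (t • u) (l (t * s)) := fun s hs ↦ by
    have h1 := curveVelocity_comp (by simpa using (hasDerivAt_id s).const_mul t)
      (hl.mdifferentiableAt _ (hts s hs))
    refine ⟨h1.1, h1.2.trans ?_⟩
    rw [mulInvariantVectorField_smul, hl.velocity _ (hts s hs)]
    rfl
  have hlE := hC.isEulerCurve_of_horizontal hE (Submodule.smul_mem _ t hu)
    (fun s hs ↦ (hvel s hs).1) (fun s hs ↦ (hvel s hs).2)
  have hl0 : l (t * 0) = x := by rw [mul_zero, hl.zero]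
  have hlv : (curveVelocity (d := k + m + 1) (fun s ↦ l (t * s)) 0 :
      EuclideanSpace ℝ (Fin (k + m + 1))) = t • v := by
    have h1 : ∀ p : M, p = x → (mulInvariantVectorField (t • u) p :
        EuclideanSpace ℝ (Fin (k + m + 1))) = t • v := by
      rintro p rfl
      rw [mulInvariantVectorField_smul]
      exact congrArg (fun v : EuclideanSpace ℝ (Fin (k + m + 1)) ↦ t • v) huv
    exact (hvel 0 (left_mem_Icc.2 zero_le_one)).2.trans (h1 _ hl0)
  have hlx : (⟨l (t * 0), curveVelocity (d := k + m + 1) (fun s ↦ l (t * s)) 0⟩ :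
      TangentBundle (𝓡 (k + m + 1)) M) = ⟨x, t • v⟩ :=
    (congrArg _ hlv).trans (tangentBundle_mk_congr hl0 (t • v))
  have h := hgeo w (t • v) γ (fun s ↦ l (t * s)) _ _ (mem_ball_zero_iff.1 hwB) htδ
    (hC.isEulerCurve_of_isGeodesicOn hE hγ) hlE hγ0 hlx
  rwa [hγ1, mul_one] at h

/-- A convex minimal hypersurface would contain a horizontal line, which lies in its own tangent
plane. -/
theorem IsCarnot.not_isLocallyHGConvex [T2Space M] (hC : V.IsCarnot) (hk : 1 ≤ k) {S : Set M}
    (hne : S.Nonempty) (hS : IsC2Hypersurface (k + m + 1) S)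
    (hnc : ∀ p ∈ S, V.IsNoncharacteristicAt S p) (hmin : V.IsMinimal S) :
    ¬ V.IsLocallyHGConvex S := by
  intro hconv
  obtain ⟨x₀, hx₀⟩ := hne
  obtain ⟨U, f, N, hx₀U, hf⟩ := hC.exists_isDefiningPair hS hx₀ (hnc x₀ hx₀)
  obtain ⟨D, hD, hDflat⟩ := hC.exists_flat_connection
  have hNd : ∀ q ∈ U, MDifferentiableAt (𝓡 (k + m + 1)) (𝓡 (k + m + 1)).tangent
      (fun q ↦ (⟨q, N q⟩ : TangentBundle (𝓡 (k + m + 1)) M)) q := fun q hq ↦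
    (hf.contMDiffAt_normal q hq).mdifferentiableAt one_ne_zero
  -- the angle function of a left-invariant field, and the part of the field tangent to `S`
  let θ : GroupLieAlgebra (𝓡 (k + m + 1)) M → M → ℝ := fun u q ↦
    V.metric.inner q (mulInvariantVectorField u q) (N q)
  let Y : GroupLieAlgebra (𝓡 (k + m + 1)) M → (q : M) → TangentSpace (𝓡 (k + m + 1)) q :=
    fun u q ↦ mulInvariantVectorField u q - θ u q • N q
  have huc : ∀ (u : GroupLieAlgebra (𝓡 (k + m + 1)) M) (q : M),
      ContMDiffAt (𝓡 (k + m + 1)) (𝓡 (k + m + 1)).tangent 1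
      (fun q ↦ (⟨q, mulInvariantVectorField u q⟩ : TangentBundle (𝓡 (k + m + 1)) M)) q :=
    fun u q ↦ (contMDiff_mulInvariantVectorField_two u).contMDiffAt.of_le one_le_two
  have hθc : ∀ u, ∀ q ∈ U, ContMDiffAt (𝓡 (k + m + 1)) 𝓘(ℝ, ℝ) 1 (θ u) q := fun u q hq ↦
    contMDiffAt_metric_inner V.metric (by norm_num) (huc u q) (hf.contMDiffAt_normal q hq)
  have hYc : ∀ u, ∀ q ∈ U, ContMDiffAt (𝓡 (k + m + 1)) (𝓡 (k + m + 1)).tangent 1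
      (fun q ↦ (⟨q, Y u q⟩ : TangentBundle (𝓡 (k + m + 1)) M)) q := fun u q hq ↦
    (huc u q).sub_section ((hθc u q hq).smul_section (hf.contMDiffAt_normal q hq))
  have hYh : ∀ u ∈ V.horizontal 1, ∀ q ∈ U, Y u q ∈ V.horizontal q := fun u hu q hq ↦
    Submodule.sub_mem _ (hC.mulInvariant_mem_horizontal hu q)
      (Submodule.smul_mem _ _ (hf.mem q hq))
  have hYN : ∀ u, ∀ q ∈ U, V.metric.inner q (Y u q) (N q) = 0 := fun u q hq ↦ by
    change V.metric.inner q (mulInvariantVectorField u q - θ u q • N q) (N q) = 0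
    rw [map_sub, sub_apply, map_smul, smul_apply, hf.unit q hq, smul_eq_mul, mul_one]
    exact sub_self _
  have hθd : ∀ u, ∀ q ∈ U, ∀ w, mvfderiv (𝓡 (k + m + 1)) (θ u) q w =
      V.metric.inner q (mulInvariantVectorField u q) (D N q w) := fun u q hq w ↦ by
    have h : mvfderiv (𝓡 (k + m + 1)) (θ u) q w = _ :=
      hD.metric q _ _ (mdifferentiableAt_mulInvariant u q) (hNd q hq) w
    rw [h, hDflat, zero_apply, map_zero, zero_apply, zero_add]
  have hinS : ∀ {u : GroupLieAlgebra (𝓡 (k + m + 1)) M}, u ∈ V.horizontal 1 → ∀ {q : M}, q ∈ S →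
      ∀ {c : ℝ → M} {ε : ℝ}, IsIntegralArc (Y u) U q c ε → ∀ t ∈ Ioo (-ε) ε, c t ∈ S :=
    fun {u} hu {q} hq {c ε} hc t ht ↦ hf.mem_of_isIntegralArc (hYh u hu) (hYN u) hq hc ht
  have hlift : ∀ {q : M} {w : TangentSpace (𝓡 (k + m + 1)) q}, w ∈ V.horizontal q →
      ∃ u ∈ V.horizontal 1, mulInvariantVectorField u q = w := fun {q w} hw ↦ by
    obtain ⟨u, rfl⟩ := hC.exists_mulInvariant_eq q w
    exact ⟨u, fun j ↦ by rw [← hC.leftInvariant q, hC.exists_T_eq j]; exact hw j, rfl⟩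
  have hYu : ∀ {u : GroupLieAlgebra (𝓡 (k + m + 1)) M} {q : M}, θ u q = 0 →
      Y u q = mulInvariantVectorField u q := fun {u q} h0 ↦ by
    change mulInvariantVectorField u q - θ u q • N q = _
    rw [h0, zero_smul, sub_zero]
  -- convexity and `H = 0` make the quadratic form of `II₀` vanish
  have hII : ∀ q ∈ S, q ∈ U → ∀ w ∈ V.horizontal q, V.metric.inner q w (N q) = 0 →
      V.metric.inner q (D N q w) w = 0 := fun q hqS hqU w hw hwN ↦ by
    obtain ⟨ν, hν, hνB⟩ := hconv q hqS (hnc q hqS)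
    obtain ⟨σ, hσ0, hσ⟩ := hf.exists_eq_smul hqS hqU hν
    refine hf.inner_eq_zero_of_semidefinite hk hmin hS hD hqS hqU hσ0 ?_ hw hwN
    intro w hw hwN hw1
    obtain ⟨u, hu, huw⟩ := hlift hw
    have hθ0 : θ u q = 0 := by
      change V.metric.inner q (mulInvariantVectorField u q) (N q) = 0
      rw [huw, hwN]
    obtain ⟨c, ε, hc⟩ := exists_isIntegralArc (hf.isOpen.mem_nhds hqU) (hYc u q hqU)
    obtain ⟨l, ε', hl⟩ := exists_isIntegralArc (hf.isOpen.mem_nhds hqU) (huc u q)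
    have hw0 : w ≠ 0 := fun h0 ↦ by
      rw [h0, map_zero] at hw1
      exact zero_ne_one hw1
    let v : EuclideanSpace ℝ (Fin (k + m + 1)) := w
    let n : EuclideanSpace ℝ (Fin (k + m + 1)) := N q
    let ℓ : EuclideanSpace ℝ (Fin (k + m + 1)) →L[ℝ] ℝ := V.metric.inner q ν
    have hℓ : ∀ z : EuclideanSpace ℝ (Fin (k + m + 1)), ℓ z = V.metric.inner q z ν := fun z ↦
      V.inner_comm q ν z
    have hℓN : V.metric.inner q (N q) ν = σ := by
      rw [hσ, map_smul, hf.unit q hqU, smul_eq_mul, mul_one]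
    have key := le_map_of_eventually_exists (ℓ := ℓ) (v := v)
      (n := -(mvfderiv (𝓡 (k + m + 1)) (θ u) q (mulInvariantVectorField u q) • n))
      (r := fun t ↦ extChartAt (𝓡 (k + m + 1)) q (c t) - extChartAt (𝓡 (k + m + 1)) q (l t))
      (by
        refine (hℓ v).trans ?_
        change V.metric.inner q w ν = 0
        rw [hσ, map_smul, hwN, smul_zero])
      (fun κ hκ ↦ hc.eventually_norm_sub_le (huc u q) (hf.contMDiffAt_normal q hqU)
        ((hθc u q hqU).mdifferentiableAt one_ne_zero) hθ0 hl rfl hκ)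
      (fun κ hκ ↦ by
        filter_upwards [hC.eventually_exists_of_convex hνB hu hc hl
          (fun t ht ↦ mem_horizontalExpSurface_of_isIntegralArc (hYh u hu) (hYc u) hc
            (hinS hu hqS hc) ht) (v := v) hw0 ((hYu hθ0).trans huw) huw hκ] with t ht
        obtain ⟨z, hz, hzt⟩ := ht
        exact ⟨z, (hℓ z).symm ▸ hz, hzt⟩)
    rw [map_neg, map_smul, hθd u q hqU, huw, smul_eq_mul, V.inner_comm q w] at key
    have h1 : ℓ n = σ := (hℓ n).trans hℓN
    rw [h1] at key
    linarith
  -- hence a curve in `S` tangent to a left-invariant field is an integral curve of it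
  let i₀ : Fin k := ⟨0, hk⟩
  obtain ⟨e, he, -⟩ := hf.exists_frame hx₀ hx₀U (fun _ ↦ 0) ∅ (by simp) (by simp) (by simp)
  obtain ⟨u, hu, hue⟩ := hlift (he.mem_horizontal i₀)
  have hθ0 : θ u x₀ = 0 := by
    change V.metric.inner x₀ (mulInvariantVectorField u x₀) (N x₀) = 0
    rw [hue]
    exact (hf.mem_tangentVectors_iff hx₀ hx₀U (he.mem_horizontal i₀)).1 (he.mem_tangent i₀)
  obtain ⟨c, ε, hc⟩ := exists_isIntegralArc (hf.isOpen.mem_nhds hx₀U) (hYc u x₀ hx₀U)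
  have hθc0 : ∀ t ∈ Ioo (-ε) ε, θ u (c t) = 0 := fun t ht ↦ by
    have hd : ∀ s ∈ Ioo (-ε) ε, HasDerivWithinAt (fun s ↦ θ u (c s)) 0 (Ioo (-ε) ε) s :=
      fun s hs ↦ by
        have hU := hc.mem s hs
        have h1 := hasDerivAt_comp_curve ((hθc u _ hU).mdifferentiableAt one_ne_zero)
          (hc.mdifferentiableAt s hs)
        refine (h1.congr_deriv ?_).hasDerivWithinAt
        rw [hc.velocity s hs]
        refine (hθd u _ hU _).trans ?_
        have h2 : mulInvariantVectorField u (c s) = Y u (c s) + θ u (c s) • N (c s) :=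
          (sub_add_cancel _ _).symm
        have h3 := hII _ (hinS hu hx₀ hc s hs) hU _ (hYh u hu _ hU) (hYN u _ hU)
        have h4 := hD.metric.inner_add_eq_zero (hNd _ hU) (hNd _ hU) (c := 1) (by
          filter_upwards [hf.isOpen.mem_nhds hU] with y hy using hf.unit y hy) (Y u (c s))
        rw [V.inner_comm (c s) (N (c s)), ← two_mul, mul_eq_zero, or_iff_right two_ne_zero] at h4
        rw [h2, V.inner_comm, map_add, map_smul, h3, h4, smul_zero, add_zero]
    have h := (convex_Ioo (-ε) ε).norm_image_sub_le_of_norm_hasDerivWithin_le (C := 0) hd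
      (fun _ _ ↦ by simp) hc.zero_mem ht
    rw [zero_mul, norm_le_zero_iff, sub_eq_zero, hc.zero, hθ0] at h
    exact h
  have hl : IsIntegralArc (mulInvariantVectorField u) U x₀ c ε :=
    ⟨hc.pos, hc.zero, hc.mem, hc.mdifferentiableAt, fun t ht ↦
      (hc.velocity t ht).trans (hYu (hθc0 t ht))⟩
  -- such a line is tangent to the horizontal tangent plane, which contradicts strictness
  obtain ⟨ν, hν, hνB⟩ := hconv x₀ hx₀ (hnc x₀ hx₀)
  let v : EuclideanSpace ℝ (Fin (k + m + 1)) := e i₀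
  have hv0 : v ≠ 0 := fun h0 ↦ by
    have h1 := he.orthonormal i₀ i₀
    have h2 : e i₀ = 0 := h0
    rw [h2, map_zero, if_pos rfl] at h1
    exact zero_ne_one h1
  obtain ⟨t, w, hw, ht⟩ := (hC.eventually_exists_of_convex hνB hu hc hl
    (fun t ht ↦ mem_horizontalExpSurface_of_isIntegralArc (hYh u hu) (hYc u) hc
      (hinS hu hx₀ hc) ht) hv0 ((hYu hθ0).trans hue) hue (κ := 1 / 2) (by norm_num)).exists
  rw [sub_self, zero_sub, norm_neg] at ht
  have h0 : w - t • v = 0 := norm_le_zero_iff.1 (by linarith)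
  rw [sub_eq_zero] at h0
  have h1 : V.metric.inner x₀ (t • e i₀) ν = 0 := by
    rw [V.inner_comm, map_smul, hν.orthogonal _ (he.mem_tangent i₀) (he.mem_horizontal i₀),
      smul_zero]
  rw [h0] at hw
  exact hw.ne' h1

end VRStructure

end

theorem mainTheorem3 {k m : ℕ} (hk : 1 ≤ k) {M : Type*} [TopologicalSpace M] [T2Space M]
    [SecondCountableTopology M] [ChartedSpace (EuclideanSpace ℝ (Fin (k + m + 1))) M]
    [IsManifold (𝓡 (k + m + 1)) ∞ M] (V : VRStructure k m M) (S : Set M) (hne : S.Nonempty)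
    (hS : IsC2Hypersurface (k + m + 1) S) (hnc : ∀ p ∈ S, V.IsNoncharacteristicAt S p)
    (hmin : V.IsMinimal S) :
    (∀ D : CovariantDerivative (𝓡 (k + m + 1)) (EuclideanSpace ℝ (Fin (k + m + 1)))
        (fun x : M ↦ TangentSpace (𝓡 (k + m + 1)) x), V.IsAdapted D → ∀ p ∈ S,
      (∀ (N : (q : M) → TangentSpace (𝓡 (k + m + 1)) q)
        (e : Fin k → TangentSpace (𝓡 (k + m + 1)) p), V.IsHorizontalNormalField S p N →
        V.IsHorizontalTangentFrame S p e → V.meanCurvature D p N e = 0) ∧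
      ¬ V.IsHorizontallyPositivelyCurvedAt D S p) ∧
    (∀ [Group M] [LieGroup (𝓡 (k + m + 1)) ∞ M], V.IsCarnot → ¬ V.IsLocallyHGConvex S) := by
  refine ⟨fun D hD p hp ↦ ⟨fun N e hN he ↦ hmin.meanCurvature_eq_zero hS hD hp hN he,
    hmin.not_isHorizontallyPositivelyCurvedAt hk hS hD hp⟩, ?_⟩
  intro _ _ hC
  exact hC.not_isLocallyHGConvex hk hne hS hnc hmin
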